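/- **Theorem.** Let $I=[0,1]$ and let $F\colon I\to\mathbb{R}$ be an increasing $C^1$ map with $F(0)=0$ and $F'(x)\ge\alpha$ for all $x\in I$, for some constant $\alpha>1$. Let $f\colon[0,1)\to[0,1)$, $f(x)=F(x) \bmod 1$. *Symbolic dynamics.* Put $b=\lceil F(1)\rceil$, $a_j=F^{-1}(j)$ for $0\le j<b$, $a_b=1$ and $I_j=(a_j,a_{j+1})$. Let $\Sigma_f\subset\{0,\dots,b-1\}^{\mathbb N}$ (sequences indexed from $0$) be the closure of the set of all sequences $s$ for which some $x\in[0,1)$ satisfies $f^k(x)\in I_{s_k}$ for all $k\ge0$. Let $\mathcal L$ be the set of finite words that are initial words of elements of $\Sigma_f$, and $\mathcal L_n$ the set of words of length $n$ in $\mathcal L$. For $s\in\Sigma_f$ let $\pi(s)\in I$ be the unique point of $\bigcap_{n}\overline{\{x\in[0,1): f^k(x)\in I_{s_k}\text{ for all } k<n\}}$. For $w=w_0\cdots w_{n-1}\in\mathcal L_n$ let $\pi(w)=\{x\in[0,1) : f^k(x)\in\overline{I_{w_k}}\text{ for all } 0\le k<n\}$. *Potentials.* Let $\varphi\colon I\to\mathbb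 R$ be such that $\varphi\circ\pi$ is continuous on $\Sigma_f$, let $S_n\varphi(x)=\sum_{k=0}^{n-1}\varphi(f^k(x))$, and suppose that $\varphi$ has the Bowen property $$\sup\{\,|S_n\varphi(x)-S_n\varphi(y)| : n\in\mathbb N,\ w\in\mathcal L_n,\ x,y\in\pi(w)\}<\infty .$$ Write $\varphi_n(\pi(w))=\sup_{x\in\pi(w)}S_n\varphi(x)$ for $w\in\mathcal L_n$. Then there is exactly one equilibrium state $\mu$ for $\varphi$, that is, exactly one $f$-invariant Borel probability measure on $[0,1)$ that maximises $h_\nu(f)+\int\varphi\,d\nu$ (with $h_\nu(f)$ the measure-theoretic entropy) among all $f$-invariant Borel probability measures $\nu$. Moreover: 1. $\mu$ is fully supported: its support is $[0,1)$. 2. $\mu$ is weak Gibbs, in the following sense. The limit $P=\lim_{n\to\infty}\frac1n\log\sum_{w\in\mathcal L_n}e^{\varphi_n(\pi(w))}$ exists in $\mathbb R$, and $\Sigma_f$ has a lexicographically maximal element $m=m_0m_1\cdots$. Consider the directed labelled graph with vertices $0,1,2,\dots$, an edge $i\to i+1$ labelled $m_i$ for each $i$, and an edge $i\to0$ labelled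 $a$ for each $i$ and each letter $a<m_i$. Let $\mathcal G$ be the set of words labelling paths from $0$ to $0$, and for $M\in\mathbb N$ let $\mathcal G(M)$ be the set of words $uv\in\mathcal L$ with $u\in\mathcal G$ and $v$ an initial word (possibly empty) of $m$ of length at most $M$. Then there are a constant $K'>0$ and constants $K_M>0$ ($M\in\mathbb N$) such that for all $M$, $n$ and all $w\in\mathcal G(M)$ of length $n$ $$K_M\le\frac{\mu(\pi(w))}{e^{-nP+\varphi_n(\pi(w))}}\le K'.$$ 3. With $\mathrm{Per}_n=\{x\in[0,1): f^n(x)=x\}$, the measures $$\frac1{\sum_{x\in\mathrm{Per}_n}e^{S_n\varphi(x)}}\sum_{x\in\mathrm{Per}_n}e^{S_n\varphi(x)}\,\delta_x$$ converge to $\mu$ in the weak* topology as $n\to\infty$. -/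

import Mathlib

/-! ### Measure-theoretic (Kolmogorov-Sinai) entropy and equilibrium states -/

namespace ErgodicEntropy

open MeasureTheory Filter

variable {Ω : Type*} [MeasurableSpace Ω]

/-- Shannon entropy of the `n`-th refinement `ξ ∨ T⁻¹ξ ∨ ⋯ ∨ T⁻⁽ⁿ⁻¹⁾ξ` of the finite partition of `Ω`
into the level sets of `ξ : Ω → Fin k`. -/
noncomputable def joinEntropy (μ : Measure Ω) (T : Ω → Ω) {k : ℕ} (ξ : Ω → Fin k) (n : ℕ) : ℝ :=
  ∑ v : Fin n → Fin k, Real.negMulLog (μ.real {x | ∀ j : Fin n, ξ (T^[(j : ℕ)] x) = v j})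

/-- Entropy `h_μ(T, ξ) = lim (1/n) H_μ(ξ ∨ ⋯ ∨ T⁻⁽ⁿ⁻¹⁾ξ)` of `T` relative to a finite partition. -/
noncomputable def partitionEntropy (μ : Measure Ω) (T : Ω → Ω) {k : ℕ} (ξ : Ω → Fin k) : EReal :=
  limsup (fun n : ℕ => ((joinEntropy μ T ξ n / n : ℝ) : EReal)) atTop

/-- The entropy `h_μ(T)`: the supremum over all finite measurable partitions. -/
noncomputable def entropy (μ : Measure Ω) (T : Ω → Ω) : EReal :=
  ⨆ (k : ℕ) (ξ : Ω → Fin k) (_ : Measurable ξ), partitionEntropy μ T ξ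

/-- `μ` is a `T`-invariant probability measure which maximises `h_ν(T) + ∫ φ dν` among all
`T`-invariant probability measures `ν`. -/
def IsEquilibriumState (T : Ω → Ω) (φ : Ω → ℝ) (μ : ProbabilityMeasure Ω) : Prop :=
  MeasurePreserving T (μ : Measure Ω) (μ : Measure Ω) ∧
    ∀ ν : ProbabilityMeasure Ω, MeasurePreserving T (ν : Measure Ω) (ν : Measure Ω) →
      entropy (ν : Measure Ω) T + ((∫ x, φ x ∂(ν : Measure Ω) : ℝ) : EReal) ≤
        entropy (μ : Measure Ω) T + ((∫ x, φ x ∂(μ : Measure Ω) : ℝ) : EReal)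

end ErgodicEntropy

/-! ### `F`-transformations and their symbolic dynamics -/

namespace FTransformation

open MeasureTheory Filter Topology

/-- The phase space `[0,1)`. -/
abbrev Phase : Type := Set.Ico (0 : ℝ) 1

/-- The transformation `f(x) = F(x) mod 1` of `[0,1)`. -/
noncomputable def map (F : ℝ → ℝ) (x : Phase) : Phase :=
  ⟨Int.fract (F x), Int.fract_nonneg _, Int.fract_lt_one _⟩

/-- The size `b = ⌈F(1)⌉` of the alphabet. -/
noncomputable def numBranches (F : ℝ → ℝ) : ℕ := ⌈F 1⌉₊

/-- The alphabet `{0, …, b - 1}`, with the discrete topology. -/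
abbrev Letter (F : ℝ → ℝ) : Type := Fin (numBranches F)

/-- The open interval of monotonicity `I_j = (a_j, a_{j+1})`, where `a_j = F⁻¹(j)` for `j < b` and
`a_b = 1`. -/
def branch (F : ℝ → ℝ) (j : Letter F) : Set ℝ :=
  {x | 0 < x ∧ x < 1 ∧ ((j : ℕ) : ℝ) < F x ∧ F x < ((j : ℕ) : ℝ) + 1}

/-- The symbolic space `Σ_f`: the closure of the set of itineraries of those points whose orbit
stays in the union of the open intervals `I_j`. -/
def shiftSpace (F : ℝ → ℝ) : Set (ℕ → Letter F) :=
  closure {s | ∃ x : Phase, ∀ k : ℕ, (((map F)^[k] x : Phase) : ℝ) ∈ branch F (s k)}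

/-- The language of `Σ_f`: all finite words which are an initial word of an element of `Σ_f`. -/
def language (F : ℝ → ℝ) : Set (List (Letter F)) :=
  {w | ∃ s ∈ shiftSpace F, w = List.ofFn (fun i : Fin w.length => s i)}

/-- The factor map `π : Σ_f → [0,1]`. For `F` uniformly expanding and `s ∈ Σ_f` the nested
intersection of the closed cylinders below is a single point; `π s` is that point. -/
noncomputable def factorMap (F : ℝ → ℝ) (s : ℕ → Letter F) : ℝ :=
  sSup (⋂ n : ℕ, closure (Subtype.val ''
    {x : Phase | ∀ k < n, (((map F)^[k] x : Phase) : ℝ) ∈ branch F (s k)}))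

/-- The class `Ĉ(I)` of potentials `φ` on `I = [0,1]` such that `φ ∘ π` is continuous on `Σ_f`
(values of `φ` outside `[0,1]` play no role). -/
def ContinuousPotential (F φ : ℝ → ℝ) : Prop :=
  ContinuousOn (fun s => φ (factorMap F s)) (shiftSpace F)

/-- The Birkhoff sum `S_n φ(x) = φ(x) + φ(f x) + ⋯ + φ(fⁿ⁻¹ x)`. -/
noncomputable def birkhoff (F φ : ℝ → ℝ) (n : ℕ) (x : Phase) : ℝ :=
  ∑ k ∈ Finset.range n, φ ((map F)^[k] x : Phase)

/-- The cylinder `π(w) = ⋂_{k < |w|} f⁻ᵏ (closure of I_{w_k})` of a word `w`. -/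
def cylinder (F : ℝ → ℝ) (w : List (Letter F)) : Set Phase :=
  {x | ∀ k : Fin w.length, (((map F)^[(k : ℕ)] x : Phase) : ℝ) ∈ closure (branch F (w.get k))}

/-- The Bowen property: `|S_n φ(x) - S_n φ(y)|` is bounded uniformly over all `n`, all words `w` of
length `n` in the language and all `x, y ∈ π(w)`. -/
def BowenProperty (F φ : ℝ → ℝ) : Prop :=
  ∃ V : ℝ, ∀ w ∈ language F, ∀ x ∈ cylinder F w, ∀ y ∈ cylinder F w,
    |birkhoff F φ w.length x - birkhoff F φ w.length y| ≤ V

/-- `φ_n(π(w)) = sup_{x ∈ π(w)} S_n φ(x)`, where `n = |w|`. -/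
noncomputable def wordSup (F φ : ℝ → ℝ) (w : List (Letter F)) : ℝ :=
  sSup (birkhoff F φ w.length '' cylinder F w)

/-- `Λ_n = ∑ exp(φ_n(π(w)))`, over the (finitely many) words `w` of length `n` in the language. -/
noncomputable def partitionSum (F φ : ℝ → ℝ) (n : ℕ) : ℝ :=
  ∑ᶠ w ∈ {w : List (Letter F) | w ∈ language F ∧ w.length = n}, Real.exp (wordSup F φ w)

/-- `P` is the pressure `P(φ) = lim (1/n) log Λ_n`. -/
def IsPressure (F φ : ℝ → ℝ) (P : ℝ) : Prop :=
  Tendsto (fun n : ℕ => (1 / (n : ℝ)) * Real.log (partitionSum F φ n)) atTop (𝓝 P)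

/-- `m` is the lexicographically maximal element of `Σ_f`. -/
def IsLexMax (F : ℝ → ℝ) (m : ℕ → Letter F) : Prop :=
  m ∈ shiftSpace F ∧ ∀ s ∈ shiftSpace F, toLex s ≤ toLex m

/-- Labelled paths in the countable graph presenting the shift with maximal element `m`. The
vertices are `0, 1, 2, …` (base vertex `0`); there is an edge `i → i + 1` labelled `m i`, and for
every letter `a < m i` an edge `i → 0` labelled `a`. `GraphPath m i w j` says that `w` labels a path
from `i` to `j`. -/
inductive GraphPath {F : ℝ → ℝ} (m : ℕ → Letter F) : ℕ → List (Letter F) → ℕ → Prop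
  | nil (i : ℕ) : GraphPath m i [] i
  | climb {i j : ℕ} {w : List (Letter F)} :
      GraphPath m (i + 1) w j → GraphPath m i (m i :: w) j
  | drop {i j : ℕ} {a : Letter F} {w : List (Letter F)} :
      a < m i → GraphPath m 0 w j → GraphPath m i (a :: w) j

/-- The good core `𝒢` of the decomposition `ℒ = 𝒢 𝒞ˢ` of the language: words labelling a path
which begins and ends at the base vertex. -/
def goodCore {F : ℝ → ℝ} (m : ℕ → Letter F) : Set (List (Letter F)) :=
  {u | GraphPath m 0 u 0}

/-- The suffix collection `𝒞ˢ`: all initial words (including the empty one) of `m`. -/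
def suffixes {F : ℝ → ℝ} (m : ℕ → Letter F) : Set (List (Letter F)) :=
  {v | v = List.ofFn (fun i : Fin v.length => m i)}

/-- `𝒢(M)`: the words `u v` in the language with `u ∈ 𝒢`, `v ∈ 𝒞ˢ` and `|v| ≤ M`. -/
def goodWords {F : ℝ → ℝ} (m : ℕ → Letter F) (M : ℕ) : Set (List (Letter F)) :=
  {w | w ∈ language F ∧ ∃ u ∈ goodCore m, ∃ v ∈ suffixes m, v.length ≤ M ∧ w = u ++ v}

/-- The weak Gibbs property of `μ` for the potential `φ` with pressure `P`: the upper constant `K'`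
is uniform, while the lower constant `K_M` may depend on `M`. -/
def WeakGibbs (F φ : ℝ → ℝ) (P : ℝ) (μ : ProbabilityMeasure Phase) : Prop :=
  ∃ m : ℕ → Letter F, IsLexMax F m ∧
    ∃ K' : ℝ, 0 < K' ∧ ∀ M : ℕ, ∃ K : ℝ, 0 < K ∧ ∀ w ∈ goodWords m M,
      K ≤ (μ : Measure Phase).real (cylinder F w) /
          Real.exp (-(w.length : ℝ) * P + wordSup F φ w) ∧
      (μ : Measure Phase).real (cylinder F w) /
          Real.exp (-(w.length : ℝ) * P + wordSup F φ w) ≤ K'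

/-- `Per_n = {x ∈ [0,1) | fⁿ(x) = x}`. -/
def periodicPoints (F : ℝ → ℝ) (n : ℕ) : Set Phase := {x | (map F)^[n] x = x}

/-- The measure `∑_{x ∈ Per_n} exp(S_n φ(x)) δ_x`. -/
noncomputable def weightedPeriodicSum (F φ : ℝ → ℝ) (n : ℕ) : Measure Phase :=
  Measure.sum (fun x : periodicPoints F n =>
    ENNReal.ofReal (Real.exp (birkhoff F φ n (x : Phase))) • Measure.dirac (x : Phase))

/-- The `n`-th periodic orbit measure: the previous measure divided by its total mass
`∑_{x ∈ Per_n} exp(S_n φ(x))`. -/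
noncomputable def periodicMeasure (F φ : ℝ → ℝ) (n : ℕ) : Measure Phase :=
  (weightedPeriodicSum F φ n Set.univ)⁻¹ • weightedPeriodicSum F φ n

end FTransformation

set_option linter.unusedSectionVars false

/-! Half-open branches code `f` by the graph. If `w` labels a path from `0` to `j`, then `f^n` maps
the cylinder of `w` onto `[0, e_j)`, where `e_j` is the left orbit of `1` (`exists_path`,
`exists_inverseBranch`). Hence every word of the language is `uv` with `u` a closed path at `0` and
`v` an initial word of `m`, and closed paths concatenate freely. By the Bowen property, `Φ(w) = sup
S_n φ` is additive under concatenation up to a bounded error.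

The crux is a pressure gap, `Φ(w) ≤ |w|(P - ε) + C` (`exists_pressure_gap`). At bounded cost a word
can be altered near any chosen place into a closed word that differs from it there. So one word of
length `n` produces a number of closed words of comparable weight that is linear in `n`. All closed
words together weigh at most a constant times `exp(nP)`, so `Φ(w) ≤ nP - log n + C`, and
subadditivity turns this into a linear gap. The suffixes `v`, one for each length, therefore have
exponentially small relative weight. Consequently the core and the language both weigh about
`exp(nP)`, and the words ending at a vertex `≥ M` weigh at most `C exp(nP - εM)`.

A nonempty closed word carries exactly one periodic point of its length, so these counts become
Gibbs bounds for the periodic orbit measures, uniform in the period. The gap also prevents mass from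
escaping to `1` and atoms from forming, so cluster points exist, are invariant and satisfy the Gibbs
bounds (`isGibbs_of_tendsto`).

By Kolmogorov-Sinai, no invariant measure has pressure above `P`, while Gibbs measures reach `P`.
Gluing words through the base vertex makes a Gibbs measure ergodic, and an entropy count over
cylinders makes every equilibrium state absolutely continuous with respect to it. So the two
coincide, the periodic measures have a single cluster point, and they converge. -/

namespace ErgodicEntropy

open MeasureTheory Filter

/-! ### Shannon entropy of finite-valued random variables. -/

section Shannon

variable {Ω : Type*} [MeasurableSpace Ω]
  {ι κ ζ : Type*} [Fintype ι] [MeasurableSpace ι] [MeasurableSingletonClass ι]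
  [Fintype κ] [MeasurableSpace κ] [MeasurableSingletonClass κ]
  [Fintype ζ] [MeasurableSpace ζ] [MeasurableSingletonClass ζ]

/-- Shannon entropy of a random variable with finitely many values. -/
noncomputable def shannon (μ : Measure Ω) (X : Ω → ι) : ℝ :=
  ∑ i, Real.negMulLog (μ.real (X ⁻¹' {i}))

/-- Conditional Shannon entropy of `X` given `Z`. -/
noncomputable def condShannon (μ : Measure Ω) (X : Ω → ι) (Z : Ω → ζ) : ℝ :=
  shannon μ (fun x => (X x, Z x)) - shannon μ Z

variable (μ : Measure Ω) [IsProbabilityMeasure μ]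

theorem negMulLog_sum_le {α : Type*} (s : Finset α) (p : α → ℝ) (hp : ∀ i ∈ s, 0 ≤ p i) :
    Real.negMulLog (∑ i ∈ s, p i) ≤ ∑ i ∈ s, Real.negMulLog (p i) := by
  simp only [Real.negMulLog, neg_mul, Finset.sum_neg_distrib, neg_le_neg_iff, Finset.sum_mul]
  refine Finset.sum_le_sum fun i hi => ?_
  rcases (hp i hi).eq_or_lt with h | h
  · simp [← h]
  · exact mul_le_mul_of_nonneg_left
      (Real.log_le_log h (Finset.single_le_sum hp hi)) h.le

theorem real_preimage_comp {X : Ω → ι} (hX : Measurable X) (g : ι → κ) (k : κ) [DecidableEq κ] :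
    μ.real ((fun x => g (X x)) ⁻¹' {k}) = ∑ i with g i = k, μ.real (X ⁻¹' {i}) := by
  rw [sum_measureReal_preimage_singleton _ (fun i _ => hX (measurableSet_singleton i))]
  congr 1
  ext x
  simp

theorem shannon_comp_le {X : Ω → ι} (hX : Measurable X) (g : ι → κ) :
    shannon μ (fun x => g (X x)) ≤ shannon μ X := by
  classical
  unfold shannon
  rw [← Finset.sum_fiberwise (s := Finset.univ) (g := g)]
  refine Finset.sum_le_sum fun k _ => ?_
  rw [real_preimage_comp μ hX]
  exact negMulLog_sum_le _ _ fun _ _ => measureReal_nonneg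

/-- This is `log t ≤ t - 1` at `t = ab/(cp)`, multiplied by `p`. When summed over a joint
distribution the left-hand sides cancel. -/
theorem mul_log_submod {p a b c : ℝ} (hp : 0 ≤ p) (ha : p ≤ a) (hb : p ≤ b) (hac : a ≤ c) :
    p - a * b / c ≤ p * Real.log p + p * Real.log c - p * Real.log a - p * Real.log b := by
  rcases hp.eq_or_lt with h | h
  · subst h
    simp only [zero_mul, zero_sub, add_zero, sub_zero, neg_nonpos]
    exact div_nonneg (mul_nonneg ha hb) (ha.trans hac)
  · have ha' := h.trans_le ha
    have hb' := h.trans_le hb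
    have hc' := ha'.trans_le hac
    have := Real.log_le_sub_one_of_pos (x := a * b / (c * p)) (by positivity)
    rw [Real.log_div (by positivity) (by positivity), Real.log_mul ha'.ne' hb'.ne',
      Real.log_mul hc'.ne' h.ne'] at this
    have h2 := mul_le_mul_of_nonneg_left this h.le
    have h3 : p * (a * b / (c * p) - 1) = a * b / c - p := by field_simp
    linarith

/-- Strong subadditivity, that is, nonnegativity of conditional mutual information; the later
conditional inequalities are read off from it. -/
theorem shannon_submod {X : Ω → ι} {Y : Ω → κ} {Z : Ω → ζ} (hX : Measurable X)
    (hY : Measurable Y) (hZ : Measurable Z) :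
    shannon μ (fun x => (X x, Y x, Z x)) + shannon μ Z ≤
      shannon μ (fun x => (X x, Z x)) + shannon μ (fun x => (Y x, Z x)) := by
  classical
  have hW : Measurable fun x => (X x, Y x, Z x) := hX.prodMk (hY.prodMk hZ)
  set p : ι → κ → ζ → ℝ := fun i j k => μ.real ((fun x => (X x, Y x, Z x)) ⁻¹' {(i, j, k)})
    with hp
  have p0 : ∀ i j k, 0 ≤ p i j k := fun _ _ _ => measureReal_nonneg
  have hXZ : ∀ i k, μ.real ((fun x => (X x, Z x)) ⁻¹' {(i, k)}) = ∑ j, p i j k := by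
    intro i k
    rw [real_preimage_comp μ hW (fun t : ι × κ × ζ => (t.1, t.2.2))]
    refine (Finset.sum_nbij' (fun j => (i, j, k)) (fun t => t.2.1) ?_ ?_ ?_ ?_ ?_).symm <;> simp
    · intro a; rfl
  have hYZ : ∀ j k, μ.real ((fun x => (Y x, Z x)) ⁻¹' {(j, k)}) = ∑ i, p i j k := by
    intro j k
    rw [real_preimage_comp μ hW (fun t : ι × κ × ζ => (t.2.1, t.2.2))]
    refine (Finset.sum_nbij' (fun i => (i, j, k)) (fun t => t.1) ?_ ?_ ?_ ?_ ?_).symm <;> simp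
    · intro a; rfl
  have hZ' : ∀ k, μ.real (Z ⁻¹' {k}) = ∑ i, ∑ j, p i j k := by
    intro k
    rw [show Z = fun x => (fun t : ι × ζ => t.2) (X x, Z x) from rfl,
      real_preimage_comp μ (hX.prodMk hZ) (fun t : ι × ζ => t.2)]
    simp only [← hXZ]
    refine (Finset.sum_nbij' (fun i => (i, k)) (fun t => t.1) ?_ ?_ ?_ ?_ ?_).symm <;> simp
  unfold shannon
  simp only [Fintype.sum_prod_type, hXZ, hYZ, hZ']
  have key : ∀ k, ∑ i, ∑ j, (p i j k - (∑ j', p i j' k) * (∑ i', p i' j k) /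
      (∑ i', ∑ j', p i' j' k)) ≤ ∑ i, ∑ j, (p i j k * Real.log (p i j k) +
        p i j k * Real.log (∑ i', ∑ j', p i' j' k) - p i j k * Real.log (∑ j', p i j' k) -
        p i j k * Real.log (∑ i', p i' j k)) := by
    intro k
    refine Finset.sum_le_sum fun i _ => Finset.sum_le_sum fun j _ => ?_
    refine mul_log_submod (p0 _ _ _) ?_ ?_ ?_
    · exact Finset.single_le_sum (f := fun j' => p i j' k) (fun _ _ => p0 _ _ _)
        (Finset.mem_univ j)
    · exact Finset.single_le_sum (f := fun i' => p i' j k) (fun _ _ => p0 _ _ _)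
        (Finset.mem_univ i)
    · exact Finset.single_le_sum (f := fun i' => ∑ j', p i' j' k)
        (fun _ _ => Finset.sum_nonneg fun _ _ => p0 _ _ _) (Finset.mem_univ i)
  -- Over each value of `Z`, the joint law and its conditionally independent version have the same
  -- mass.
  have zero : ∀ k, ∑ i, ∑ j, (p i j k - (∑ j', p i j' k) * (∑ i', p i' j k) /
      (∑ i', ∑ j', p i' j' k)) = 0 := by
    intro k
    simp only [Finset.sum_sub_distrib, ← Finset.sum_div, ← Finset.mul_sum, ← Finset.sum_mul]
    rw [Finset.sum_comm (f := fun j i => p i j k)]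
    rw [mul_self_div_self, sub_self]
  have tot := Finset.sum_le_sum fun k (_ : k ∈ Finset.univ) => key k
  simp only [zero, Finset.sum_const_zero] at tot
  have e1 : ∑ i, ∑ j, ∑ k, Real.negMulLog (p i j k) =
      -∑ k, ∑ i, ∑ j, p i j k * Real.log (p i j k) := by
    simp only [Real.negMulLog, neg_mul, Finset.sum_neg_distrib, neg_inj]
    rw [Finset.sum_congr rfl fun i _ => Finset.sum_comm, Finset.sum_comm]
  have e2 : ∑ k, Real.negMulLog (∑ i, ∑ j, p i j k) =
      -∑ k, ∑ i, ∑ j, p i j k * Real.log (∑ i', ∑ j', p i' j' k) := by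
    simp only [Real.negMulLog, neg_mul, Finset.sum_neg_distrib, Finset.sum_mul]
  have e3 : ∑ i, ∑ k, Real.negMulLog (∑ j, p i j k) =
      -∑ k, ∑ i, ∑ j, p i j k * Real.log (∑ j', p i j' k) := by
    simp only [Real.negMulLog, neg_mul, Finset.sum_neg_distrib, neg_inj, Finset.sum_mul]
    rw [Finset.sum_comm]
  have e4 : ∑ j, ∑ k, Real.negMulLog (∑ i, p i j k) =
      -∑ k, ∑ i, ∑ j, p i j k * Real.log (∑ i', p i' j k) := by
    simp only [Real.negMulLog, neg_mul, Finset.sum_neg_distrib, neg_inj, Finset.sum_mul]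
    rw [Finset.sum_comm]
    exact Finset.sum_congr rfl fun k _ => Finset.sum_comm
  simp only [Finset.sum_sub_distrib, Finset.sum_add_distrib] at tot
  change ∑ i, ∑ j, ∑ k, Real.negMulLog (p i j k) + _ ≤ _
  rw [e1, e2, e3, e4]
  linarith

theorem shannon_nonneg (X : Ω → ι) : 0 ≤ shannon μ X :=
  Finset.sum_nonneg fun _ _ => Real.negMulLog_nonneg measureReal_nonneg measureReal_le_one

theorem shannon_prod_le {X : Ω → ι} {Y : Ω → κ} (hX : Measurable X) (hY : Measurable Y) :
    shannon μ (fun x => (X x, Y x)) ≤ shannon μ X + shannon μ Y := by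
  have h := shannon_submod μ hX hY (measurable_const (a := ()))
  have h1 := shannon_comp_le μ (hX.prodMk (hY.prodMk (measurable_const (a := ()))))
    (fun t : ι × κ × Unit => (t.1, t.2.1))
  have h2 := shannon_comp_le μ hX (fun t : ι => (t, ()))
  have h3 := shannon_comp_le μ hY (fun t : κ => (t, ()))
  have h4 := shannon_nonneg μ (fun _ : Ω => ())
  linarith

/-- Strong subadditivity for `X`, `Z` given `g ∘ Z`; since `Z` determines `g ∘ Z`, adjoining the
latter to `Z` adds no entropy. -/
theorem condShannon_anti {X : Ω → ι} {Z : Ω → ζ} (hX : Measurable X) (hZ : Measurable Z)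
    (g : ζ → κ) : condShannon μ X Z ≤ condShannon μ X (fun x => g (Z x)) := by
  have hg : Measurable fun x => g (Z x) := (measurable_of_countable g).comp hZ
  have h := shannon_submod μ hX hZ hg
  have h1 := shannon_comp_le μ (hX.prodMk (hZ.prodMk hg))
    (fun t : ι × ζ × κ => (t.1, t.2.1))
  have h2 := shannon_comp_le μ hZ (fun t : ζ => (t, g t))
  unfold condShannon
  linarith

theorem condShannon_comp_le {X : Ω → ι} {Z : Ω → ζ} (hX : Measurable X) (hZ : Measurable Z)
    (g : ι → κ) : condShannon μ (fun x => g (X x)) Z ≤ condShannon μ X Z := by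
  have h1 := shannon_comp_le μ (hX.prodMk hZ) (fun t : ι × ζ => (g t.1, t.2))
  unfold condShannon
  linarith

theorem condShannon_pi_le {n : ℕ} {X : Fin n → Ω → ι} {Z : Ω → ζ} (hX : ∀ j, Measurable (X j))
    (hZ : Measurable Z) :
    condShannon μ (fun x j => X j x) Z ≤ ∑ j, condShannon μ (X j) Z := by
  induction n with
  | zero =>
    have h1 := shannon_comp_le μ hZ (fun z : ζ => ((fun j => j.elim0 : Fin 0 → ι), z))
    have h2 : (fun x => ((fun j => X j x), Z x)) =
        fun x => ((fun j => j.elim0 : Fin 0 → ι), Z x) := by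
      funext x; congr 1; funext j; exact j.elim0
    simp only [condShannon, Finset.univ_eq_empty, Finset.sum_empty, h2]
    linarith
  | succ n ih =>
    have ht : Measurable fun x (j : Fin n) => X j.succ x :=
      measurable_pi_lambda _ fun j => hX _
    have h1 := shannon_comp_le μ ((hX 0).prodMk (ht.prodMk hZ))
      (fun t : ι × (Fin n → ι) × ζ => ((Fin.cons t.1 t.2.1 : Fin (n + 1) → ι), t.2.2))
    have h2 := shannon_submod μ (hX 0) ht hZ
    have h3 := ih (X := fun j => X j.succ) fun j => hX _
    rw [Fin.sum_univ_succ]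
    have h4 : (fun x => ((fun j => X j x), Z x)) = fun x =>
        ((Fin.cons (X 0 x) (fun j : Fin n => X j.succ x) : Fin (n + 1) → ι), Z x) := by
      funext x; congr 1; funext j; refine Fin.cases ?_ (fun j => ?_) j <;> simp
    simp only [condShannon] at h3 ⊢
    rw [h4]
    linarith

theorem shannon_comp_measurePreserving {T : Ω → Ω} (hT : MeasurePreserving T μ μ) {X : Ω → ι}
    (hX : Measurable X) : shannon μ (fun x => X (T x)) = shannon μ X := by
  unfold shannon
  refine Finset.sum_congr rfl fun i _ => ?_
  rw [show (fun x => X (T x)) ⁻¹' {i} = T ⁻¹' (X ⁻¹' {i}) from rfl,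
    measureReal_def, hT.measure_preimage (hX (measurableSet_singleton i)).nullMeasurableSet,
    measureReal_def]

theorem condShannon_comp_measurePreserving {T : Ω → Ω} (hT : MeasurePreserving T μ μ) {X : Ω → ι}
    {Z : Ω → ζ} (hX : Measurable X) (hZ : Measurable Z) :
    condShannon μ (fun x => X (T x)) (fun x => Z (T x)) = condShannon μ X Z := by
  unfold condShannon
  rw [shannon_comp_measurePreserving μ hT hZ,
    ← shannon_comp_measurePreserving μ hT (hX.prodMk hZ)]

-- Two of the four joint cells have mass below `δ`, and the other two have nearly the masses of `C`
-- and its complement. Uniform continuity of `negMulLog` on `[0,1]` costs `ε/4` for each of the four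
-- cells.
open Classical in
theorem exists_condShannon_indicator_lt {ε : ℝ} (hε : 0 < ε) :
    ∃ δ > 0, ∀ A C : Set Ω, MeasurableSet A → MeasurableSet C → μ.real (symmDiff A C) < δ →
      condShannon μ (fun x => decide (x ∈ A)) (fun x => decide (x ∈ C)) < ε := by
  have huc : UniformContinuousOn Real.negMulLog (Set.Icc 0 1) :=
    isCompact_Icc.uniformContinuousOn_of_continuous Real.continuous_negMulLog.continuousOn
  obtain ⟨δ, hδ, h⟩ := Metric.uniformContinuousOn_iff.1 huc (ε / 4) (by positivity)
  refine ⟨δ, hδ, fun A C hA hC hAC => ?_⟩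
  have hmA : Measurable fun x => decide (x ∈ A) :=
    measurable_to_bool (by convert hA using 1; ext x; simp)
  have hmC : Measurable fun x => decide (x ∈ C) :=
    measurable_to_bool (by convert hC using 1; ext x; simp)
  have split : ∀ c : Bool, μ.real ((fun x => decide (x ∈ C)) ⁻¹' {c}) =
      μ.real ((fun x => (decide (x ∈ A), decide (x ∈ C))) ⁻¹' {(true, c)}) +
      μ.real ((fun x => (decide (x ∈ A), decide (x ∈ C))) ⁻¹' {(false, c)}) := by
    intro c
    rw [← measureReal_union]
    · congr 1; ext x; by_cases hx : x ∈ A <;> simp [hx]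
    · rw [Set.disjoint_left]; intro x hx; simp only [Set.mem_preimage, Set.mem_singleton_iff,
        Prod.mk.injEq] at hx ⊢; simp [hx.1]
    · exact (hmA.prodMk hmC) (measurableSet_singleton _)
  have b1 : μ.real ((fun x => (decide (x ∈ A), decide (x ∈ C))) ⁻¹' {(true, false)}) < δ :=
    (measureReal_mono fun x => by simp [Set.mem_symmDiff]; tauto).trans_lt hAC
  have b2 : μ.real ((fun x => (decide (x ∈ A), decide (x ∈ C))) ⁻¹' {(false, true)}) < δ :=
    (measureReal_mono fun x => by simp [Set.mem_symmDiff]; tauto).trans_lt hAC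
  set p : Bool → Bool → ℝ :=
    fun a c => μ.real ((fun x => (decide (x ∈ A), decide (x ∈ C))) ⁻¹' {(a, c)}) with hp
  have m1 : ∀ a c, p a c ∈ Set.Icc (0 : ℝ) 1 := fun a c =>
    ⟨measureReal_nonneg, measureReal_le_one⟩
  have m2 : ∀ c, p true c + p false c ∈ Set.Icc (0 : ℝ) 1 := fun c => by
    change μ.real _ + μ.real _ ∈ _
    rw [← split]; exact ⟨measureReal_nonneg, measureReal_le_one⟩
  have k1 := h _ (m1 true false) 0 (by simp) (by
    rw [Real.dist_eq, sub_zero, abs_of_nonneg (m1 _ _).1]; exact b1)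
  have k2 := h _ (m1 false true) 0 (by simp) (by
    rw [Real.dist_eq, sub_zero, abs_of_nonneg (m1 _ _).1]; exact b2)
  have k3 := h _ (m1 true true) _ (m2 true) (by
    rw [Real.dist_eq, abs_sub_comm, add_sub_cancel_left, abs_of_nonneg (m1 _ _).1]; exact b2)
  have k4 := h _ (m1 false false) _ (m2 false) (by
    rw [Real.dist_eq, abs_sub_comm, add_sub_cancel_right, abs_of_nonneg (m1 _ _).1]; exact b1)
  simp only [condShannon, shannon, Fintype.sum_prod_type, Fintype.sum_bool, split]
  simp only [Real.dist_eq, abs_lt, Real.negMulLog_zero] at k1 k2 k3 k4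
  simp only [hp] at k1 k2 k3 k4
  linarith [k1.1, k1.2, k2.1, k2.2, k3.1, k3.2, k4.1, k4.2]

end Shannon

/-! ### The Kolmogorov-Sinai theorem for generating partitions. -/

section KolmogorovSinai

variable {Ω : Type*} [MeasurableSpace Ω] (μ : Measure Ω)

theorem joinEntropy_eq_shannon (T : Ω → Ω) {k : ℕ} (ξ : Ω → Fin k) (n : ℕ) :
    joinEntropy μ T ξ n = shannon μ (fun x (j : Fin n) => ξ (T^[(j : ℕ)] x)) := by
  unfold joinEntropy shannon
  refine Finset.sum_congr rfl fun v _ => ?_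
  congr 2
  ext x
  simp [funext_iff]

variable [IsProbabilityMeasure μ]

theorem measurable_code {T : Ω → Ω} (hT : Measurable T) {k : ℕ} {ξ : Ω → Fin k}
    (hξ : Measurable ξ) (n : ℕ) : Measurable fun x (j : Fin n) => ξ (T^[(j : ℕ)] x) :=
  measurable_pi_lambda _ fun _ => hξ.comp (hT.iterate _)

theorem joinEntropy_add_le {T : Ω → Ω} (hT : MeasurePreserving T μ μ) {k : ℕ} {ξ : Ω → Fin k}
    (hξ : Measurable ξ) (n l : ℕ) :
    joinEntropy μ T ξ (n + l) ≤ joinEntropy μ T ξ n + joinEntropy μ T ξ l := by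
  simp only [joinEntropy_eq_shannon]
  have hn := measurable_code hT.measurable hξ n
  have hl := measurable_code hT.measurable hξ l
  have hl' : Measurable fun x (j : Fin l) => ξ (T^[(j : ℕ)] (T^[n] x)) :=
    hl.comp (hT.iterate n).measurable
  have h1 := shannon_prod_le μ hn hl'
  rw [shannon_comp_measurePreserving μ (hT.iterate n) hl] at h1
  have h2 := shannon_comp_le μ (hn.prodMk hl')
    (fun t (i : Fin (n + l)) => if h : (i : ℕ) < n then t.1 ⟨i, h⟩ else t.2 ⟨i - n, by omega⟩)
  refine (le_of_eq ?_).trans (h2.trans h1)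
  congr 1
  funext x i
  by_cases h : (i : ℕ) < n
  · simp [h]
  · simp only [h, dite_false, ← Function.iterate_add_apply]
    rw [Nat.sub_add_cancel (by omega)]

/-- The `ξ`-code of length `n + l` contains, for each `j < n`, the block of length `l` that predicts
`η ∘ T^j`. -/
theorem joinEntropy_le_add_condShannon {T : Ω → Ω} (hT : MeasurePreserving T μ μ) {k q : ℕ}
    {ξ : Ω → Fin k} (hξ : Measurable ξ) {η : Ω → Fin q} (hη : Measurable η) (n l : ℕ) :
    joinEntropy μ T η n ≤ joinEntropy μ T ξ (n + l) +
      n * condShannon μ η (fun x (j : Fin l) => ξ (T^[(j : ℕ)] x)) := by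
  simp only [joinEntropy_eq_shannon]
  have hn := measurable_code hT.measurable hη n
  have hl := measurable_code hT.measurable hξ l
  have hnl := measurable_code hT.measurable hξ (n + l)
  have h1 := shannon_comp_le μ (hn.prodMk hnl) Prod.fst
  have h2 := condShannon_pi_le μ (fun j : Fin n => hη.comp (hT.iterate j).measurable) hnl
  have h3 : ∀ j : Fin n, condShannon μ (η ∘ T^[(j : ℕ)])
      (fun x (i : Fin (n + l)) => ξ (T^[(i : ℕ)] x)) ≤
      condShannon μ η (fun x (j : Fin l) => ξ (T^[(j : ℕ)] x)) := by
    intro j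
    rw [← condShannon_comp_measurePreserving μ (hT.iterate j) hη hl]
    refine (condShannon_anti μ (hη.comp (hT.iterate j).measurable) hnl
      (fun v (i : Fin l) => v ⟨i + j, by omega⟩)).trans (le_of_eq ?_)
    congr 1
    funext x i
    simp [Function.iterate_add_apply]
  have h4 := Finset.sum_le_sum fun j (_ : j ∈ Finset.univ) => h3 j
  rw [Finset.sum_const, Finset.card_univ, Fintype.card_fin, nsmul_eq_mul] at h4
  have h5 := h2.trans h4
  simp only [condShannon, Function.comp_apply] at h5 h1 ⊢
  linarith

-- Each of the `q` level sets of `η` is approximated by a set of `ξ`-codes, at entropy cost `ε/q`.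
-- Since `η` is a function of its `q` indicators, the costs add up.
open Classical in
theorem exists_condShannon_code_lt {T : Ω → Ω} (hT : Measurable T) {k q : ℕ}
    {ξ : Ω → Fin k} (hξ : Measurable ξ) {η : Ω → Fin q} (hη : Measurable η)
    (hgen : ∀ A, MeasurableSet A → ∀ ε > 0, ∃ (l : ℕ) (S : Set (Fin l → Fin k)),
      μ.real (symmDiff A {x | (fun j : Fin l => ξ (T^[(j : ℕ)] x)) ∈ S}) < ε)
    {ε : ℝ} (hε : 0 < ε) :
    ∃ l : ℕ, condShannon μ η (fun x (j : Fin l) => ξ (T^[(j : ℕ)] x)) < ε := by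
  have := nonempty_of_isProbabilityMeasure μ
  have : Nonempty (Fin q) := ⟨η (Classical.arbitrary Ω)⟩
  have hq : 0 < q := Fin.pos_iff_nonempty.2 this
  obtain ⟨δ, hδ, hind⟩ := exists_condShannon_indicator_lt μ (ε := ε / q) (by positivity)
  choose l S hS using fun i : Fin q =>
    hgen (η ⁻¹' {i}) (hη (measurableSet_singleton i)) δ hδ
  let L := Finset.univ.sup l
  refine ⟨L, ?_⟩
  have hL := measurable_code hT hξ L
  have hmi : ∀ i : Fin q, Measurable fun x => decide (x ∈ η ⁻¹' {i}) := fun i =>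
    measurable_to_bool (by
      have := hη (measurableSet_singleton i); convert this using 1; ext x; simp)
  let e : Fin q → Fin q → Bool := fun i j => decide (i = j)
  have he : Function.Injective e := fun i j h => by
    have := congrFun h j; simpa [e] using this
  have h1 := condShannon_comp_le μ (measurable_pi_lambda _ hmi) hL (Function.invFun e)
  have h2 : (fun x => Function.invFun e fun i => decide (x ∈ η ⁻¹' {i})) = η := by
    funext x
    refine (congrArg _ ?_).trans (Function.leftInverse_invFun he (η x))
    funext i
    simp [e]
  rw [h2] at h1
  refine h1.trans_lt ((condShannon_pi_le μ hmi hL).trans_lt ?_)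
  have h3 : ∀ i : Fin q, condShannon μ (fun x => decide (x ∈ η ⁻¹' {i}))
      (fun x (j : Fin L) => ξ (T^[(j : ℕ)] x)) < ε / q := by
    intro i
    have hi : l i ≤ L := Finset.le_sup (Finset.mem_univ i)
    refine (condShannon_anti μ (hmi i) hL
      (fun v => decide ((fun j : Fin (l i) => v ⟨j, by omega⟩) ∈ S i))).trans_lt ?_
    exact hind _ _ (hη (measurableSet_singleton i))
      (measurable_code hT hξ (l i) (Set.toFinite (S i)).measurableSet) (hS i)
  calc _ < ∑ _i : Fin q, ε / q := Finset.sum_lt_sum_of_nonempty Finset.univ_nonempty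
        fun i _ => h3 i
    _ = ε := by simp; field_simp

/-- **Kolmogorov-Sinai**: the entropy is bounded by the normalised entropies of any generating
partition. -/
theorem entropy_le_joinEntropy_div {T : Ω → Ω} (hT : MeasurePreserving T μ μ) {k : ℕ}
    {ξ : Ω → Fin k} (hξ : Measurable ξ)
    (hgen : ∀ A, MeasurableSet A → ∀ ε > 0, ∃ (l : ℕ) (S : Set (Fin l → Fin k)),
      μ.real (symmDiff A {x | (fun j : Fin l => ξ (T^[(j : ℕ)] x)) ∈ S}) < ε)
    {n : ℕ} (hn : n ≠ 0) :
    entropy μ T ≤ ((joinEntropy μ T ξ n / n : ℝ) : EReal) := by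
  have hnn : ∀ n, 0 ≤ joinEntropy μ T ξ n := fun n => by
    rw [joinEntropy_eq_shannon]; exact shannon_nonneg μ _
  have hsub : Subadditive fun n => joinEntropy μ T ξ n := joinEntropy_add_le μ hT hξ
  have hbdd : BddBelow (Set.range fun n => joinEntropy μ T ξ n / n) :=
    ⟨0, by rintro _ ⟨n, rfl⟩; exact div_nonneg (hnn n) n.cast_nonneg⟩
  refine iSup_le fun q => iSup_le fun η => iSup_le fun hη => ?_
  -- The extra `l` letters of the code cost only `H_l`, which disappears after division by `N`; so
  -- the rate of `η` exceeds that of `ξ` by at most `ε`.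
  have key : ∀ ε > 0, partitionEntropy μ T η ≤ ((hsub.lim + ε : ℝ) : EReal) := by
    intro ε hε
    obtain ⟨l, hl⟩ := exists_condShannon_code_lt μ hT.measurable hξ hη hgen hε
    have hlim : Tendsto (fun N : ℕ => joinEntropy μ T ξ N / N + joinEntropy μ T ξ l / N + ε) atTop
        (nhds (hsub.lim + 0 + ε)) :=
      ((hsub.tendsto_lim hbdd).add (tendsto_const_div_atTop_nhds_zero_nat _)).add_const ε
    rw [add_zero] at hlim
    have hlim' := (continuous_coe_real_ereal.tendsto _).comp hlim
    rw [← hlim'.limsup_eq]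
    refine limsup_le_limsup ?_
    filter_upwards [eventually_gt_atTop 0] with N hN
    refine EReal.coe_le_coe_iff.2 ?_
    have hN' : (0 : ℝ) < N := by exact_mod_cast hN
    have h1 := joinEntropy_le_add_condShannon μ hT hξ hη N l
    have h2 := joinEntropy_add_le μ hT hξ N l
    change _ ≤ joinEntropy μ T ξ N / N + joinEntropy μ T ξ l / N + ε
    rw [← add_div, div_add' _ _ _ hN'.ne', div_le_div_iff_of_pos_right hN']
    nlinarith
  refine le_trans ?_ (EReal.coe_le_coe_iff.2 (hsub.lim_le_div hbdd hn))
  refine EReal.le_of_forall_lt_iff_le.1 fun z hz => ?_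
  have := key (z - hsub.lim) (by have := EReal.coe_lt_coe_iff.1 hz; linarith)
  simpa using this

end KolmogorovSinai

end ErgodicEntropy

/-! ### Expanding maps, graph paths and inverse branches. -/

namespace FTransformation

open MeasureTheory Filter Topology

/-- The properties of `F` on which the symbolic dynamics of `F mod 1` rests. -/
structure IsExpanding (F : ℝ → ℝ) (α : ℝ) : Prop where
  one_lt : 1 < α
  zero : F 0 = 0
  cont : ContinuousOn F (Set.Icc 0 1)
  expand : ∀ x ∈ Set.Icc (0 : ℝ) 1, ∀ y ∈ Set.Icc (0 : ℝ) 1, x ≤ y → α * (y - x) ≤ F y - F x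

/-- Mean value inequality. The derivative of `F` enters the argument only here. -/
theorem isExpanding_of_derivWithin {F : ℝ → ℝ} {α : ℝ} (hα : 1 < α)
    (hF : ContDiffOn ℝ 1 F (Set.Icc 0 1)) (h0 : F 0 = 0)
    (hd : ∀ x ∈ Set.Icc (0 : ℝ) 1, α ≤ derivWithin F (Set.Icc 0 1) x) : IsExpanding F α where
  one_lt := hα
  zero := h0
  cont := hF.continuousOn
  expand x hx y hy hxy := by
    refine (convex_Icc (0 : ℝ) 1).mul_sub_le_image_sub_of_le_deriv hF.continuousOn
      ((hF.differentiableOn (by norm_num)).mono interior_subset) (fun t ht => ?_) x hx y hy hxy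
    have := hd t (interior_subset ht)
    rwa [derivWithin_of_mem_nhds (mem_interior_iff_mem_nhds.1 ht)] at this

/-- The left orbit `1, F(1⁻) mod 1, …` of the right end point of `[0,1)`, taken in `(0,1]`. -/
noncomputable def edge (F : ℝ → ℝ) : ℕ → ℝ
  | 0 => 1
  -- Subtracting the ceiling minus one, not the floor, keeps the orbit in `(0,1]`: an integer value
  -- of `F` yields `1`, the left limit of `F mod 1`.
  | l + 1 => F (edge F l) - ((⌈F (edge F l)⌉₊ - 1 : ℕ) : ℝ)

namespace GraphPath

variable {F : ℝ → ℝ} {m : ℕ → Letter F}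

theorem append {i k j : ℕ} {u v : List (Letter F)} (hu : GraphPath m i u k)
    (hv : GraphPath m k v j) : GraphPath m i (u ++ v) j := by
  induction hu with
  | nil => exact hv
  | climb _ ih => exact .climb (ih hv)
  | drop ha _ ih => exact .drop ha (ih hv)

theorem split {i j : ℕ} {u v : List (Letter F)} (h : GraphPath m i (u ++ v) j) :
    ∃ k, GraphPath m i u k ∧ GraphPath m k v j := by
  induction u generalizing i with
  | nil => exact ⟨i, .nil i, h⟩
  | cons a u ih =>
    cases h with
    | climb h => obtain ⟨k, h1, h2⟩ := ih h; exact ⟨k, .climb h1, h2⟩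
    | drop ha h => obtain ⟨k, h1, h2⟩ := ih h; exact ⟨k, .drop ha h1, h2⟩

/-- The graph is deterministic: the edges leaving `i` carry the distinct labels `a ≤ m i`. -/
theorem unique {i j k : ℕ} {w : List (Letter F)} (h : GraphPath m i w j)
    (h' : GraphPath m i w k) : j = k := by
  induction h with
  | nil => cases h'; rfl
  | climb _ ih =>
    cases h' with
    | climb h => exact ih h
    | drop ha _ => exact absurd ha (lt_irrefl _)
  | drop ha _ ih =>
    cases h' with
    | climb h => exact absurd ha (lt_irrefl _)
    | drop _ h => exact ih h

theorem le_length {i j : ℕ} {w : List (Letter F)} (h : GraphPath m i w j) :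
    j ≤ i + w.length := by
  induction h with
  | nil => simp
  | climb _ ih => simp only [List.length_cons]; omega
  | drop _ _ ih => simp only [List.length_cons]; omega

end GraphPath

namespace IsExpanding

variable {F : ℝ → ℝ} {α : ℝ} (h : IsExpanding F α)

include h

theorem strictMonoOn : StrictMonoOn F (Set.Icc 0 1) := fun x hx y hy hxy => by
  have := h.expand x hx y hy hxy.le
  nlinarith [h.one_lt]

theorem sub_le_sub {x y : ℝ} (hx : x ∈ Set.Icc (0 : ℝ) 1) (hy : y ∈ Set.Icc (0 : ℝ) 1)
    (hxy : x ≤ y) : y - x ≤ F y - F x := by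
  have := h.expand x hx y hy hxy
  nlinarith [h.one_lt]

theorem le_apply {x : ℝ} (hx : x ∈ Set.Icc (0 : ℝ) 1) : α * x ≤ F x := by
  have := h.expand 0 (by simp) x hx hx.1
  simpa [h.zero] using this

theorem apply_nonneg {x : ℝ} (hx : x ∈ Set.Icc (0 : ℝ) 1) : 0 ≤ F x :=
  (mul_nonneg (by linarith [h.one_lt]) hx.1).trans (h.le_apply hx)

theorem apply_pos {x : ℝ} (hx : x ∈ Set.Icc (0 : ℝ) 1) (hx0 : 0 < x) : 0 < F x :=
  (mul_pos (by linarith [h.one_lt]) hx0).trans_le (h.le_apply hx)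

theorem apply_lt_one {x : Phase} : F x < F 1 :=
  h.strictMonoOn ⟨x.2.1, x.2.2.le⟩ (by simp) x.2.2

theorem floor_lt (x : Phase) : ⌊F x⌋₊ < numBranches F := by
  have h0 := h.apply_nonneg (x := x) ⟨x.2.1, x.2.2.le⟩
  rw [Nat.floor_lt h0]
  exact h.apply_lt_one.trans_le (Nat.le_ceil _)

/-- The index of the half-open branch containing `x`. -/
noncomputable def digit (x : Phase) : Letter F := ⟨⌊F x⌋₊, h.floor_lt x⟩

theorem digit_le (x : Phase) : ((h.digit x : ℕ) : ℝ) ≤ F x :=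
  Nat.floor_le (h.apply_nonneg ⟨x.2.1, x.2.2.le⟩)

theorem lt_digit_add_one (x : Phase) : F x < ((h.digit x : ℕ) : ℝ) + 1 := Nat.lt_floor_add_one _

theorem digit_eq {x : Phase} {j : Letter F} (h1 : ((j : ℕ) : ℝ) ≤ F x)
    (h2 : F x < ((j : ℕ) : ℝ) + 1) : h.digit x = j :=
  Fin.ext ((Nat.floor_eq_iff (h.apply_nonneg ⟨x.2.1, x.2.2.le⟩)).2 ⟨h1, h2⟩)

theorem coe_map (x : Phase) : ((map F x : Phase) : ℝ) = F x - ((h.digit x : ℕ) : ℝ) := by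
  have h1 := h.digit_le x
  have h2 := h.lt_digit_add_one x
  exact Int.fract_eq_iff.2 ⟨by linarith, by linarith, ((h.digit x : ℕ) : ℤ), by simp⟩

theorem digit_map_eq {x y : Phase} {a : Letter F} (hx : F x = y + ((a : ℕ) : ℝ)) :
    h.digit x = a ∧ map F x = y := by
  have ha : h.digit x = a := h.digit_eq (by linarith [y.2.1]) (by linarith [y.2.2])
  refine ⟨ha, Subtype.ext ?_⟩
  rw [h.coe_map, ha, hx, add_sub_cancel_right]

theorem edge_mem (l : ℕ) : edge F l ∈ Set.Ioc (0 : ℝ) 1 := by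
  induction l with
  | zero => simp [edge]
  | succ l ih =>
    have hp := h.apply_pos ⟨ih.1.le, ih.2⟩ ih.1
    have h1 : 0 < ⌈F (edge F l)⌉₊ := Nat.ceil_pos.2 hp
    have h2 : ⌈F (edge F l)⌉₊ - 1 < F (edge F l) := by
      have := Nat.ceil_lt_add_one hp.le; linarith
    have h3 := Nat.le_ceil (F (edge F l))
    simp only [edge, Set.mem_Ioc]
    rw [Nat.cast_sub (by omega)]
    push_cast
    constructor <;> linarith

theorem edge_mem_Icc (l : ℕ) : edge F l ∈ Set.Icc (0 : ℝ) 1 :=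
  ⟨(h.edge_mem l).1.le, (h.edge_mem l).2⟩

/-- The itinerary `m` of `1⁻`. -/
noncomputable def maxWord (l : ℕ) : Letter F := ⟨⌈F (edge F l)⌉₊ - 1, by
  have hp := h.apply_pos (h.edge_mem_Icc l) (h.edge_mem l).1
  have h1 : 0 < ⌈F (edge F l)⌉₊ := Nat.ceil_pos.2 hp
  have h2 : ⌈F (edge F l)⌉₊ ≤ ⌈F 1⌉₊ :=
    Nat.ceil_mono (h.strictMonoOn.monotoneOn (h.edge_mem_Icc l) (by simp) (h.edge_mem l).2)
  unfold numBranches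
  omega⟩

theorem apply_edge (l : ℕ) : F (edge F l) = edge F (l + 1) + ((h.maxWord l : ℕ) : ℝ) := by
  simp [edge, maxWord]

/-- The word of the first `n` digits of the orbit of `x`. -/
noncomputable def itin : ℕ → Phase → List (Letter F)
  | 0, _ => []
  | n + 1, x => h.digit x :: itin n (map F x)

@[simp] theorem length_itin (n : ℕ) (x : Phase) : (h.itin n x).length = n := by
  induction n generalizing x with
  | zero => rfl
  | succ n ih => simp [itin, ih]

theorem itin_add (n k : ℕ) (x : Phase) :
    h.itin (n + k) x = h.itin n x ++ h.itin k ((map F)^[n] x) := by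
  induction n generalizing x with
  | zero => simp [itin]
  | succ n ih => rw [Nat.succ_add]; simp [itin, ih]

theorem itin_eq_ofFn (n : ℕ) (x : Phase) :
    h.itin n x = List.ofFn fun i : Fin n => h.digit ((map F)^[(i : ℕ)] x) := by
  induction n generalizing x with
  | zero => simp [itin]
  | succ n ih => simp [itin, ih, List.ofFn_succ]

theorem getElem_itin {n k : ℕ} (x : Phase) (hk : k < n) :
    (h.itin n x)[k]'(by simpa using hk) = h.digit ((map F)^[k] x) := by
  simp [itin_eq_ofFn]

theorem itin_append_iff {u v : List (Letter F)} {x : Phase} :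
    h.itin (u ++ v).length x = u ++ v ↔
      h.itin u.length x = u ∧ h.itin v.length ((map F)^[u.length] x) = v := by
  rw [List.length_append, h.itin_add]
  exact ⟨fun e => List.append_inj e (by simp), fun e => by rw [e.1, e.2]⟩

/-- The half-open cylinder of a word. -/
def halfCylinder (w : List (Letter F)) : Set Phase := {x | h.itin w.length x = w}

/-- A point below `e_i` has digit at most `m_i`. With digit `m_i` its image lies below `e_{i+1}`;
with a smaller digit nothing more is known than that the image lies below `e_0 = 1`. -/
theorem exists_path (n : ℕ) {x : Phase} {i : ℕ} (hx : (x : ℝ) < edge F i) :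
    ∃ j, GraphPath h.maxWord i (h.itin n x) j ∧ (((map F)^[n] x : Phase) : ℝ) < edge F j := by
  induction n generalizing x i with
  | zero => exact ⟨i, .nil i, hx⟩
  | succ n ih =>
    have h1 := h.strictMonoOn ⟨x.2.1, x.2.2.le⟩ (h.edge_mem_Icc i) hx
    have h2 := h.digit_le x
    have h3 := h.apply_edge i
    have h4 := h.edge_mem (i + 1)
    have h5 : ((h.digit x : ℕ) : ℝ) < (h.maxWord i : ℕ) + 1 := by linarith [h4.2]
    have h6 : (h.digit x : ℕ) < (h.maxWord i : ℕ) + 1 := by exact_mod_cast h5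
    rcases (Nat.lt_succ_iff.1 h6).lt_or_eq with hlt | heq
    · obtain ⟨j, hj, hj'⟩ := ih (x := map F x) (i := 0) (by simpa [edge] using (map F x).2.2)
      exact ⟨j, .drop hlt hj, hj'⟩
    · obtain ⟨j, hj, hj'⟩ := ih (x := map F x) (i := i + 1) (by
        rw [h.coe_map, heq]; linarith)
      refine ⟨j, ?_, hj'⟩
      rw [itin, Fin.ext heq]
      exact .climb hj

theorem exists_path_zero (n : ℕ) (x : Phase) :
    ∃ j, GraphPath h.maxWord 0 (h.itin n x) j ∧ (((map F)^[n] x : Phase) : ℝ) < edge F j :=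
  h.exists_path n (by simpa [edge] using x.2.2)

/-- Working on the closed interval `[0, F 1]` lets inverse branches extend continuously to the end
point `e_j`, where fixed points are later controlled. -/
theorem exists_inverse : ∃ G : ℝ → ℝ, (∀ t ∈ Set.Icc 0 (F 1), G t ∈ Set.Icc (0 : ℝ) 1 ∧
    F (G t) = t) ∧ ∀ t ∈ Set.Icc 0 (F 1), ∀ s ∈ Set.Icc 0 (F 1), |G t - G s| ≤ |t - s| := by
  have hs : ∀ t ∈ Set.Icc 0 (F 1), ∃ x, x ∈ Set.Icc (0 : ℝ) 1 ∧ F x = t := by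
    have := intermediate_value_Icc (zero_le_one' ℝ) h.cont
    rw [h.zero] at this
    exact fun t ht => this ht
  choose! G hG using hs
  refine ⟨G, hG, fun t ht s hs => ?_⟩
  rcases le_total (G t) (G s) with hts | hts
  · have := h.sub_le_sub (hG t ht).1 (hG s hs).1 hts
    rw [(hG t ht).2, (hG s hs).2] at this
    rw [abs_sub_comm, abs_sub_comm t, abs_of_nonneg (by linarith), abs_of_nonneg (by linarith)]
    exact this
  · have := h.sub_le_sub (hG s hs).1 (hG t ht).1 hts
    rw [(hG t ht).2, (hG s hs).2] at this
    rw [abs_of_nonneg (by linarith), abs_of_nonneg (by linarith)]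
    exact this

/-- Each path of the graph carries an inverse branch of an iterate. -/
theorem exists_inverseBranch {i j : ℕ} {w : List (Letter F)} (hp : GraphPath h.maxWord i w j) :
    ∃ g : ℝ → ℝ, (∀ y ∈ Set.Icc 0 (edge F j), g y ∈ Set.Icc 0 (edge F i)) ∧
      (∀ y ∈ Set.Icc 0 (edge F j), ∀ z ∈ Set.Icc 0 (edge F j), |g y - g z| ≤ |y - z|) ∧
      (∀ y : Phase, (y : ℝ) < edge F j → ∃ x : Phase, (x : ℝ) = g y ∧ (x : ℝ) < edge F i ∧
        h.itin w.length x = w ∧ (map F)^[w.length] x = y) ∧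
      (j < i + w.length → g (edge F j) < edge F i) ∧
      (j = i + w.length → g (edge F j) = edge F i) := by
  obtain ⟨G, hG, hG'⟩ := h.exists_inverse
  have bound : ∀ i, F (edge F i) ≤ F 1 := fun i =>
    h.strictMonoOn.monotoneOn (h.edge_mem_Icc i) (by simp) (h.edge_mem i).2
  have Gle : ∀ i t, 0 ≤ t → t ≤ F (edge F i) → G t ≤ edge F i := fun i t h0 ht => by
    rw [← h.strictMonoOn.le_iff_le (hG t ⟨h0, ht.trans (bound i)⟩).1 (h.edge_mem_Icc i),
      (hG t ⟨h0, ht.trans (bound i)⟩).2]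
    exact ht
  have Glt : ∀ i t, 0 ≤ t → t < F (edge F i) → G t < edge F i := fun i t h0 ht => by
    rw [← h.strictMonoOn.lt_iff_lt (hG t ⟨h0, ht.le.trans (bound i)⟩).1 (h.edge_mem_Icc i),
      (hG t ⟨h0, ht.le.trans (bound i)⟩).2]
    exact ht
  have point : ∀ (i : ℕ) (a : Letter F) (y : Phase) (w : List (Letter F)) (z : Phase),
      (y : ℝ) + ((a : ℕ) : ℝ) < F (edge F i) → h.itin w.length y = w →
      (map F)^[w.length] y = z → ∃ x : Phase, (x : ℝ) = G (y + ((a : ℕ) : ℝ)) ∧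
        (x : ℝ) < edge F i ∧ h.itin (a :: w).length x = a :: w ∧
        (map F)^[(a :: w).length] x = z := by
    intro i a y w z hlt hw hz
    have h0 : 0 ≤ (y : ℝ) + ((a : ℕ) : ℝ) := add_nonneg y.2.1 (Nat.cast_nonneg _)
    have h1 := Glt i _ h0 hlt
    have h2 := hG _ ⟨h0, hlt.le.trans (bound i)⟩
    have h3 := h.digit_map_eq (x := ⟨G (y + ((a : ℕ) : ℝ)), h2.1.1,
      h1.trans_le (h.edge_mem i).2⟩) (y := y) (a := a) h2.2
    refine ⟨⟨G (y + ((a : ℕ) : ℝ)), h2.1.1, h1.trans_le (h.edge_mem i).2⟩, rfl, h1, ?_, ?_⟩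
    · rw [List.length_cons, itin, h3.1, h3.2, hw]
    · rw [List.length_cons, Function.iterate_succ_apply, h3.2, hz]
  induction hp with
  | nil i =>
    exact ⟨id, fun _ hy => hy, fun _ _ _ _ => le_rfl, fun y hy => ⟨y, rfl, hy, rfl, rfl⟩,
      fun hlt => by simp at hlt, fun _ => rfl⟩
  | @climb i j w hp ih =>
    obtain ⟨g, g1, g2, g3, g4, g5⟩ := ih
    have e := h.apply_edge i
    have rng : ∀ y ∈ Set.Icc 0 (edge F j), g y + ((h.maxWord i : ℕ) : ℝ) ∈ Set.Icc 0 (F 1) :=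
      fun y hy => ⟨add_nonneg (g1 y hy).1 (Nat.cast_nonneg _), by
        linarith [(g1 y hy).2, bound i]⟩
    refine ⟨fun y => G (g y + ((h.maxWord i : ℕ) : ℝ)), fun y hy => ⟨(hG _ (rng y hy)).1.1, ?_⟩,
      fun y hy z hz => ?_, fun y hy => ?_, fun hlt => ?_, fun heq => ?_⟩
    · exact Gle i _ (rng y hy).1 (by linarith [(g1 y hy).2])
    · refine (hG' _ (rng y hy) _ (rng z hz)).trans ?_
      rw [add_sub_add_right_eq_sub]
      exact g2 y hy z hz
    · obtain ⟨x, x1, x2, x3, x4⟩ := g3 y hy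
      simp only [← x1]
      exact point i _ x w y (by linarith) x3 x4
    · have := g4 (by simp only [List.length_cons] at hlt; omega)
      exact Glt i _ (rng _ ⟨(h.edge_mem j).1.le, le_rfl⟩).1 (by linarith)
    · have := g5 (by simp only [List.length_cons] at heq; omega)
      have r := rng _ ⟨(h.edge_mem j).1.le, le_rfl⟩
      rw [this] at r
      simp only [this, ← e] at r ⊢
      exact h.strictMonoOn.injOn (hG _ r).1 (h.edge_mem_Icc i) (hG _ r).2
  | @drop i j a w ha hp ih =>
    obtain ⟨g, g1, g2, g3, g4, g5⟩ := ih
    have e := h.apply_edge i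
    have e' := (h.edge_mem (i + 1)).1
    have ha' : ((a : ℕ) : ℝ) + 1 ≤ (h.maxWord i : ℕ) := by exact_mod_cast ha
    have e0 : edge F 0 = 1 := rfl
    -- At a drop, `g y + a ≤ 1 + a ≤ m_i < F(e_i)`, with strict inequality even at the closed end `y
    -- = e_j`.
    have lt : ∀ y ∈ Set.Icc 0 (edge F j), g y + ((a : ℕ) : ℝ) < F (edge F i) := fun y hy => by
      linarith [(g1 y hy).2]
    have rng : ∀ y ∈ Set.Icc 0 (edge F j), g y + ((a : ℕ) : ℝ) ∈ Set.Icc 0 (F 1) :=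
      fun y hy => ⟨add_nonneg (g1 y hy).1 (Nat.cast_nonneg _), by linarith [lt y hy, bound i]⟩
    refine ⟨fun y => G (g y + ((a : ℕ) : ℝ)), fun y hy => ⟨(hG _ (rng y hy)).1.1, ?_⟩,
      fun y hy z hz => ?_, fun y hy => ?_, fun hlt => ?_, fun heq => ?_⟩
    · exact Gle i _ (rng y hy).1 (lt y hy).le
    · refine (hG' _ (rng y hy) _ (rng z hz)).trans ?_
      rw [add_sub_add_right_eq_sub]
      exact g2 y hy z hz
    · obtain ⟨x, x1, x2, x3, x4⟩ := g3 y hy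
      simp only [← x1]
      exact point i _ x w y (by rw [x1]; exact lt y ⟨y.2.1, hy.le⟩) x3 x4
    · exact Glt i _ (rng _ ⟨(h.edge_mem j).1.le, le_rfl⟩).1 (lt _ ⟨(h.edge_mem j).1.le, le_rfl⟩)
    · have := hp.le_length
      simp only [List.length_cons] at heq; omega

theorem pow_mul_sub_le {n : ℕ} {x y : Phase} (hxy : x ≤ y) (e : h.itin n x = h.itin n y) :
    α ^ n * ((y : ℝ) - x) ≤ ((map F)^[n] y : Phase) - ((map F)^[n] x : Phase) := by
  induction n generalizing x y with
  | zero => simp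
  | succ n ih =>
    simp only [itin, List.cons.injEq] at e
    have h1 := h.expand x ⟨x.2.1, x.2.2.le⟩ y ⟨y.2.1, y.2.2.le⟩ hxy
    have h2 : ((map F y : Phase) : ℝ) - (map F x : Phase) = F y - F x := by
      rw [h.coe_map, h.coe_map, e.1]; ring
    have h0 : (0 : ℝ) ≤ y - x := sub_nonneg.2 hxy
    have hle : map F x ≤ map F y := by
      have : (0 : ℝ) ≤ α * (y - x) := mul_nonneg (by linarith [h.one_lt]) h0
      exact Subtype.coe_le_coe.1 (by linarith)
    have h3 := ih hle e.2
    simp only [Function.iterate_succ_apply]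
    refine le_trans ?_ h3
    rw [pow_succ, mul_assoc, h2]
    exact mul_le_mul_of_nonneg_left h1 (pow_nonneg (by linarith [h.one_lt]) _)

theorem sub_le_iterate_sub {n : ℕ} {x y : Phase} (hxy : x ≤ y) (e : h.itin n x = h.itin n y) :
    (y : ℝ) - x ≤ ((map F)^[n] y : Phase) - ((map F)^[n] x : Phase) := by
  have h1 := h.pow_mul_sub_le hxy e
  have h2 : (1 : ℝ) ≤ α ^ n := one_le_pow₀ h.one_lt.le
  have h3 : (0 : ℝ) ≤ (y : ℝ) - x := sub_nonneg.2 hxy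
  nlinarith

theorem eq_of_itin_eq_of_iterate_eq {n : ℕ} {x y : Phase} (e : h.itin n x = h.itin n y)
    (e' : (map F)^[n] x = (map F)^[n] y) : x = y := by
  rcases le_total x y with hxy | hxy
  · have := h.sub_le_iterate_sub hxy e
    rw [e', sub_self] at this
    exact le_antisymm hxy (Subtype.coe_le_coe.1 (by linarith))
  · have := h.sub_le_iterate_sub hxy e.symm
    rw [e', sub_self] at this
    exact le_antisymm (Subtype.coe_le_coe.1 (by linarith)) hxy

/-- A point between two points with equal digit shares that digit, and monotonicity preserves the
order along the orbit: cylinders are intervals. -/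
theorem itin_eq_of_mem_Icc {n : ℕ} {x y z : Phase} (e : h.itin n x = h.itin n y)
    (hxz : x ≤ z) (hzy : z ≤ y) : h.itin n z = h.itin n x := by
  induction n generalizing x y z with
  | zero => rfl
  | succ n ih =>
    simp only [itin, List.cons.injEq] at e ⊢
    have mono := h.strictMonoOn.monotoneOn
    have h1 := mono ⟨x.2.1, x.2.2.le⟩ ⟨z.2.1, z.2.2.le⟩ hxz
    have h2 := mono ⟨z.2.1, z.2.2.le⟩ ⟨y.2.1, y.2.2.le⟩ hzy
    have h3 := h.digit_le x
    have h4 := h.lt_digit_add_one y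
    rw [← e.1] at h4
    have hz : h.digit z = h.digit x := h.digit_eq (by linarith) (by linarith)
    refine ⟨hz, ih e.2 (Subtype.coe_le_coe.1 ?_) (Subtype.coe_le_coe.1 ?_)⟩ <;>
    · simp only [h.coe_map, hz, ← e.1]; linarith

/-- The image `[0, e_j)` of the cylinder is open on the right, so `f^n x` can be moved slightly to
the right and pulled back by the inverse branch. -/
theorem exists_gt_itin_eq (n : ℕ) (x : Phase) {ε : ℝ} (hε : 0 < ε) :
    ∃ y : Phase, x < y ∧ (y : ℝ) < x + ε ∧ h.itin n y = h.itin n x := by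
  obtain ⟨j, hj, hlt⟩ := h.exists_path_zero n x
  obtain ⟨g, -, g2, g3, -⟩ := h.exists_inverseBranch hj
  rw [h.length_itin] at g3
  set z := (map F)^[n] x with hz
  obtain ⟨t, ht0, ht1⟩ : ∃ t : ℝ, 0 < t ∧ t < ε ∧ (z : ℝ) + t < edge F j :=
    ⟨min ε (edge F j - z) / 2, half_pos (lt_min hε (sub_pos.2 hlt)),
      by linarith [min_le_left ε (edge F j - z), half_lt_self (lt_min hε (sub_pos.2 hlt))],
      by linarith [min_le_right ε (edge F j - z), half_lt_self (lt_min hε (sub_pos.2 hlt))]⟩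
  let z' : Phase := ⟨z + t, add_nonneg z.2.1 ht0.le, ht1.2.trans_le (h.edge_mem j).2⟩
  obtain ⟨x', x1, -, x3, x4⟩ := g3 z hlt
  obtain ⟨y, y1, -, y3, y4⟩ := g3 z' ht1.2
  have ex : x' = x := h.eq_of_itin_eq_of_iterate_eq x3 x4
  subst ex
  have hb := g2 z' ⟨z'.2.1, ht1.2.le⟩ z ⟨z.2.1, hlt.le⟩
  have e : (z' : ℝ) - z = t := by simp [z']
  rw [← x1, ← y1, e, abs_of_pos ht0] at hb
  refine ⟨y, lt_of_not_ge fun hyx => ?_, by linarith [abs_le.1 hb], y3⟩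
  have := h.sub_le_iterate_sub hyx y3
  rw [y4, x4] at this
  have h2 : (y : ℝ) ≤ x' := hyx
  linarith

theorem exists_lt_itin_eq (n : ℕ) {x : Phase} (hx : (0 : ℝ) < ((map F)^[n] x : Phase)) {ε : ℝ}
    (hε : 0 < ε) :
    ∃ y : Phase, y < x ∧ (x : ℝ) - ε < y ∧ h.itin n y = h.itin n x := by
  obtain ⟨j, hj, hlt⟩ := h.exists_path_zero n x
  obtain ⟨g, -, g2, g3, -⟩ := h.exists_inverseBranch hj
  rw [h.length_itin] at g3
  set z := (map F)^[n] x with hz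
  obtain ⟨t, ht0, ht1⟩ : ∃ t : ℝ, 0 < t ∧ t < ε ∧ 0 ≤ (z : ℝ) - t :=
    ⟨min ε z / 2, half_pos (lt_min hε hx),
      by linarith [min_le_left ε z, half_lt_self (lt_min hε hx)],
      by linarith [min_le_right ε z, half_lt_self (lt_min hε hx)]⟩
  let z' : Phase := ⟨z - t, ht1.2, by linarith [z.2.2]⟩
  have hz' : (z' : ℝ) = z - t := rfl
  obtain ⟨x', x1, -, x3, x4⟩ := g3 z hlt
  obtain ⟨y, y1, -, y3, y4⟩ := g3 z' (by linarith)
  have ex : x' = x := h.eq_of_itin_eq_of_iterate_eq x3 x4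
  subst ex
  have hb := g2 z' ⟨z'.2.1, by linarith⟩ z ⟨z.2.1, hlt.le⟩
  rw [← x1, ← y1, hz', sub_sub_cancel_left, abs_neg, abs_of_pos ht0] at hb
  refine ⟨y, lt_of_not_ge fun hyx => ?_, by linarith [abs_le.1 hb], y3⟩
  have := h.sub_le_iterate_sub hyx y3.symm
  rw [y4, x4] at this
  have h2 : (x' : ℝ) ≤ y := hyx
  linarith

/-- A word together with the final image `0` determines the point, and there are countably many
words. All differences between open, half-open and closed cylinders lie in this set. -/
theorem countable_hits_zero : {x : Phase | ∃ k, (((map F)^[k] x : Phase) : ℝ) = 0}.Countable := by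
  have : {x : Phase | ∃ k, (((map F)^[k] x : Phase) : ℝ) = 0} =
      ⋃ w : List (Letter F), {x : Phase | h.itin w.length x = w ∧
        (((map F)^[w.length] x : Phase) : ℝ) = 0} := by
    ext x
    simp only [Set.mem_ofPred_eq, Set.mem_iUnion]
    exact ⟨fun ⟨k, hk⟩ => ⟨h.itin k x, by simpa using hk⟩, fun ⟨w, hw⟩ => ⟨_, hw.2⟩⟩
  rw [this]
  refine Set.countable_iUnion fun w => Set.Subsingleton.countable fun x hx y hy => ?_
  exact h.eq_of_itin_eq_of_iterate_eq (hx.1.trans hy.1.symm)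
    (Subtype.ext (hx.2.trans hy.2.symm))

end IsExpanding

end FTransformation

/-! ### Language, maximal sequence, periodic points and topology of cylinders. -/

namespace FTransformation

open MeasureTheory Filter Topology

namespace IsExpanding

variable {F : ℝ → ℝ} {α : ℝ} (h : IsExpanding F α)

include h

theorem exists_generic {x y : Phase} (hxy : x < y) :
    ∃ z : Phase, x < z ∧ z < y ∧ ∀ k, (((map F)^[k] z : Phase) : ℝ) ≠ 0 := by
  have hc := h.countable_hits_zero.image Subtype.val
  obtain ⟨t, ht, htx, hty⟩ := (hc.dense_compl ℝ).exists_between (Subtype.coe_lt_coe.2 hxy)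
  refine ⟨⟨t, x.2.1.trans htx.le, hty.trans y.2.2⟩, htx, hty, fun k hk => ht ?_⟩
  exact ⟨⟨t, x.2.1.trans htx.le, hty.trans y.2.2⟩, ⟨k, hk⟩, rfl⟩

theorem halfCylinder_nonempty {j : ℕ} {w : List (Letter F)} (hp : GraphPath h.maxWord 0 w j) :
    (h.halfCylinder w).Nonempty := by
  obtain ⟨g, -, -, g3, -⟩ := h.exists_inverseBranch hp
  obtain ⟨x, -, -, hx, -⟩ := g3 ⟨0, by simp, by simp⟩ (h.edge_mem j).1
  exact ⟨x, hx⟩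

theorem mem_branch_digit {x : Phase} (h0 : (x : ℝ) ≠ 0) (h1 : ((map F x : Phase) : ℝ) ≠ 0) :
    (x : ℝ) ∈ branch F (h.digit x) := by
  refine ⟨lt_of_le_of_ne x.2.1 h0.symm, x.2.2, ?_, h.lt_digit_add_one x⟩
  have := lt_of_le_of_ne (map F x).2.1 h1.symm
  rw [h.coe_map] at this
  linarith

theorem digit_eq_of_mem_branch {x : Phase} {j : Letter F} (hx : (x : ℝ) ∈ branch F j) :
    h.digit x = j := h.digit_eq hx.2.2.1.le hx.2.2.2

theorem mem_closure_branch (x : Phase) : (x : ℝ) ∈ closure (branch F (h.digit x)) := by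
  refine Metric.mem_closure_iff.2 fun ε hε => ?_
  obtain ⟨y, hxy, hyε, e⟩ := h.exists_gt_itin_eq 1 x hε
  have hy0 : (0 : ℝ) < y := x.2.1.trans_lt hxy
  have h1 := h.sub_le_iterate_sub hxy.le e.symm
  simp only [Function.iterate_one] at h1
  have h2 : (0 : ℝ) < (y : ℝ) - x := sub_pos.2 hxy
  have h3 := (map F x).2.1
  have e' : h.digit y = h.digit x := by simpa [itin] using e
  refine ⟨y, e' ▸ h.mem_branch_digit hy0.ne' (by linarith), ?_⟩
  rw [Real.dist_eq, abs_sub_comm, abs_of_pos h2]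
  linarith

theorem closure_branch_subset (j : Letter F) :
    closure (branch F j) ⊆ Set.Icc 0 1 ∩ F ⁻¹' Set.Icc ((j : ℕ) : ℝ) ((j : ℕ) + 1) :=
  closure_minimal (fun _ hx => ⟨⟨hx.1.le, hx.2.1.le⟩, hx.2.2.1.le, hx.2.2.2.le⟩)
    (h.cont.preimage_isClosed_of_isClosed isClosed_Icc isClosed_Icc)

/-- A point of the closed branch has another digit only if `F x = j + 1`, and then `f x = 0`. -/
theorem digit_eq_of_mem_closure_branch {x : Phase} {j : Letter F}
    (hx : (x : ℝ) ∈ closure (branch F j)) (h0 : ((map F x : Phase) : ℝ) ≠ 0) :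
    h.digit x = j := by
  obtain ⟨-, h1, h2⟩ := h.closure_branch_subset j hx
  refine h.digit_eq h1 (lt_of_le_of_ne h2 fun e => h0 ?_)
  have : F x = ((j : ℕ) + 1 : ℕ) := by push_cast; exact e
  simp [map, this]

theorem halfCylinder_subset_cylinder (w : List (Letter F)) :
    h.halfCylinder w ⊆ cylinder F w := by
  intro x hx k
  have hx' : h.itin w.length x = w := hx
  have e : w.get k = h.digit ((map F)^[(k : ℕ)] x) := by
    have := h.getElem_itin x k.2
    rw [← this, List.get_eq_getElem]
    congr 1
    exact hx'.symm
  rw [e]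
  exact h.mem_closure_branch _

theorem mem_halfCylinder_of_mem_cylinder {w : List (Letter F)} {x : Phase}
    (hx : x ∈ cylinder F w) (h0 : ∀ k, (((map F)^[k] x : Phase) : ℝ) ≠ 0) :
    x ∈ h.halfCylinder w := by
  refine List.ext_getElem (by simp) fun k hk hk' => ?_
  rw [h.getElem_itin x hk']
  refine h.digit_eq_of_mem_closure_branch (hx ⟨k, hk'⟩) ?_
  rw [← Function.iterate_succ_apply' (map F) k x]
  exact h0 _

/-- The full itinerary of a point. -/
noncomputable def code (x : Phase) (k : ℕ) : Letter F := h.digit ((map F)^[k] x)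

theorem itin_eq_ofFn_code (n : ℕ) (x : Phase) :
    h.itin n x = List.ofFn fun i : Fin n => h.code x i := h.itin_eq_ofFn n x

theorem exists_generic_mem_halfCylinder {w : List (Letter F)}
    (hw : (h.halfCylinder w).Nonempty) :
    ∃ z ∈ h.halfCylinder w, ∀ k, (((map F)^[k] z : Phase) : ℝ) ≠ 0 := by
  obtain ⟨x, hx⟩ := hw
  obtain ⟨y, hxy, -, e⟩ := h.exists_gt_itin_eq w.length x one_pos
  obtain ⟨z, hz1, hz2, hz⟩ := h.exists_generic hxy
  exact ⟨z, (h.itin_eq_of_mem_Icc e.symm hz1.le hz2.le).trans hx, hz⟩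

/-- A nonempty half-open cylinder contains points whose orbit avoids `0`; for these the half-open
coding is the open-interval coding that defines the shift. -/
theorem mem_shiftSpace_of_prefixes {s : ℕ → Letter F}
    (hs : ∀ n, (h.halfCylinder (List.ofFn fun i : Fin n => s i)).Nonempty) :
    s ∈ shiftSpace F := by
  choose z hz hz0 using fun n => h.exists_generic_mem_halfCylinder (hs n)
  refine mem_closure_of_tendsto (f := fun n => h.code (z n)) (b := atTop) ?_
    (Eventually.of_forall fun n => ⟨z n, fun k => h.mem_branch_digit (hz0 n k) (by
      rw [← Function.iterate_succ_apply' (map F) k (z n)]; exact hz0 n _)⟩)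
  rw [tendsto_pi_nhds]
  intro k
  refine tendsto_nhds_of_eventually_eq ?_
  filter_upwards [eventually_gt_atTop k] with n hn
  have h1 : h.itin n (z n) = List.ofFn fun i : Fin n => s i := by
    have : h.itin (List.ofFn fun i : Fin n => s i).length (z n) = _ := hz n
    rwa [List.length_ofFn] at this
  rw [itin_eq_ofFn_code] at h1
  exact congrFun (List.ofFn_injective h1) ⟨k, hn⟩

theorem code_mem_shiftSpace (x : Phase) : h.code x ∈ shiftSpace F :=
  h.mem_shiftSpace_of_prefixes fun n => ⟨x, by
    change h.itin _ x = _
    rw [List.length_ofFn, itin_eq_ofFn_code]⟩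

theorem exists_itin_eq_of_mem_shiftSpace {s : ℕ → Letter F} (hs : s ∈ shiftSpace F) (n : ℕ) :
    ∃ x : Phase, h.itin n x = List.ofFn fun i : Fin n => s i := by
  have ho : IsOpen (Set.pi (↑(Finset.range n)) fun i => ({s i} : Set (Letter F))) :=
    isOpen_set_pi (Finset.finite_toSet _) fun i _ => isOpen_discrete _
  obtain ⟨s', hs', x, hx⟩ := mem_closure_iff.1 hs _ ho fun i _ => rfl
  refine ⟨x, ?_⟩
  rw [h.itin_eq_ofFn]
  congr 1
  funext i
  rw [h.digit_eq_of_mem_branch (hx i)]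
  exact hs' i (by simp)

theorem mem_language_iff {w : List (Letter F)} :
    w ∈ language F ↔ ∃ j, GraphPath h.maxWord 0 w j := by
  constructor
  · rintro ⟨s, hs, hw⟩
    obtain ⟨x, hx⟩ := h.exists_itin_eq_of_mem_shiftSpace hs w.length
    obtain ⟨j, hj, -⟩ := h.exists_path_zero w.length x
    rw [hx, ← hw] at hj
    exact ⟨j, hj⟩
  · rintro ⟨j, hj⟩
    obtain ⟨x, hx⟩ := h.halfCylinder_nonempty hj
    refine ⟨h.code x, h.code_mem_shiftSpace x, ?_⟩
    have hx' : h.itin w.length x = w := hx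
    rw [← h.itin_eq_ofFn_code, hx']

theorem itin_mem_language (n : ℕ) (x : Phase) : h.itin n x ∈ language F := by
  obtain ⟨j, hj, -⟩ := h.exists_path_zero n x
  exact h.mem_language_iff.2 ⟨j, hj⟩

theorem path_maxWord (i n : ℕ) :
    GraphPath h.maxWord i (List.ofFn fun k : Fin n => h.maxWord (i + k)) (i + n) := by
  induction n generalizing i with
  | zero => exact .nil i
  | succ n ih =>
    rw [List.ofFn_succ]
    have := ih (i + 1)
    rw [show i + (n + 1) = i + 1 + n by ring]
    refine .climb ?_
    convert this using 3 with k
    simp; ring_nf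

/-- A larger sequence would first leave `m` at some place `i`; the common prefix leads to vertex
`i`, from which no letter above `m_i` can be read. -/
theorem isLexMax_maxWord : IsLexMax F h.maxWord := by
  constructor
  · refine h.mem_shiftSpace_of_prefixes fun n => h.halfCylinder_nonempty (j := 0 + n) ?_
    simpa using h.path_maxWord 0 n
  · intro s hs
    by_contra hlt
    obtain ⟨i, hi, hlt⟩ := not_le.1 hlt
    obtain ⟨x, hx⟩ := h.exists_itin_eq_of_mem_shiftSpace hs (i + 1)
    obtain ⟨j, hj, -⟩ := h.exists_path_zero (i + 1) x
    rw [hx, List.ofFn_succ', List.concat_eq_append] at hj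
    obtain ⟨k, h1, h2⟩ := hj.split
    have h3 : (List.ofFn fun k : Fin i => s k) = List.ofFn fun k : Fin i => h.maxWord (0 + k) := by
      congr 1; funext k; rw [zero_add]; exact (hi k k.2).symm
    simp only [Fin.val_castSucc, h3] at h1
    have hk : k = 0 + i := h1.unique (h.path_maxWord 0 i)
    subst hk
    simp only [Fin.val_last, zero_add] at h2
    have hlt' : h.maxWord i < s i := hlt
    generalize s i = a at h2 hlt'
    cases h2 with
    | climb _ => exact lt_irrefl _ hlt'
    | drop ha _ => exact lt_asymm ha hlt'

/-- The inverse branch of a closed word is a continuous self-map of `[0,1]`, so it has a fixed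
point. A nonempty word sends `1` strictly below `1`, so the fixed point is in the phase space. -/
theorem isFixedPt_of_path {w : List (Letter F)} (hw : w ≠ [])
    (hp : GraphPath h.maxWord 0 w 0) :
    ∃ x : Phase, h.itin w.length x = w ∧ (map F)^[w.length] x = x := by
  obtain ⟨g, g1, g2, g3, g4, -⟩ := h.exists_inverseBranch hp
  have e0 : edge F 0 = 1 := rfl
  rw [e0] at g1 g2 g3 g4
  have hlt := g4 (by have := List.length_pos_iff.2 hw; omega)
  have hc : ContinuousOn (fun y => y - g y) (Set.Icc 0 1) := by
    refine continuousOn_id.sub (LipschitzOnWith.of_dist_le_mul (K := 1) fun y hy z hz => ?_).continuousOn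
    simpa [Real.dist_eq] using g2 y hy z hz
  obtain ⟨y, hy, hy0⟩ := intermediate_value_Icc (zero_le_one' ℝ) hc
    (show (0 : ℝ) ∈ Set.Icc _ _ from ⟨by linarith [(g1 0 (by simp)).1], by linarith⟩)
  have hgy : g y = y := by simp only at hy0; linarith
  have hy1 : y < 1 := lt_of_le_of_ne hy.2 fun e => by rw [e] at hgy; linarith
  obtain ⟨x, x1, -, x3, x4⟩ := g3 ⟨y, hy.1, hy1⟩ hy1
  have : x = ⟨y, hy.1, hy1⟩ := Subtype.ext (x1.trans hgy)
  exact ⟨x, x3, x4.trans this.symm⟩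

theorem eq_of_mem_periodicPoints {n : ℕ} (hn : n ≠ 0) {x y : Phase}
    (hx : x ∈ periodicPoints F n) (hy : y ∈ periodicPoints F n) (e : h.itin n x = h.itin n y) :
    x = y := by
  wlog hxy : x ≤ y generalizing x y
  · exact (this hy hx e.symm (le_of_not_ge hxy)).symm
  have h1 := h.pow_mul_sub_le hxy e
  have hx' : (map F)^[n] x = x := hx
  have hy' : (map F)^[n] y = y := hy
  rw [hx', hy'] at h1
  have h2 : 1 < α ^ n := one_lt_pow₀ h.one_lt hn
  have h3 : (x : ℝ) ≤ y := hxy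
  exact le_antisymm hxy (Subtype.coe_le_coe.1 (by nlinarith))

theorem finite_periodicPoints {n : ℕ} (hn : n ≠ 0) : (periodicPoints F n).Finite := by
  refine Set.Finite.of_finite_image (f := h.itin n)
    ((List.finite_length_eq (Letter F) n).subset ?_)
    fun x hx y hy e => h.eq_of_mem_periodicPoints hn hx hy e
  rintro _ ⟨x, -, rfl⟩
  exact h.length_itin n x

theorem halfCylinder_mem_nhds {w : List (Letter F)} {x : Phase} (hx : x ∈ h.halfCylinder w)
    (h0 : (((map F)^[w.length] x : Phase) : ℝ) ≠ 0) : h.halfCylinder w ∈ 𝓝 x := by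
  obtain ⟨y, hxy, -, e⟩ := h.exists_gt_itin_eq w.length x one_pos
  obtain ⟨z, hzx, -, e'⟩ := h.exists_lt_itin_eq w.length
    (lt_of_le_of_ne ((map F)^[w.length] x).2.1 h0.symm) one_pos
  refine mem_of_superset (Icc_mem_nhds hzx hxy) fun t ht => ?_
  exact (h.itin_eq_of_mem_Icc (e'.trans e.symm) ht.1 ht.2).trans (e'.trans hx)

/-- A point with `f^n x ≠ 0` is interior to its own `n`-cylinder, hence interior or exterior to any
other. So cylinders are continuity sets of measures without atoms. -/
theorem frontier_halfCylinder_subset (w : List (Letter F)) :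
    frontier (h.halfCylinder w) ⊆ {x | ∃ k, (((map F)^[k] x : Phase) : ℝ) = 0} := by
  intro x hx
  by_contra h0
  have h0' : (((map F)^[w.length] x : Phase) : ℝ) ≠ 0 := fun e => h0 ⟨_, e⟩
  by_cases hxw : x ∈ h.halfCylinder w
  · exact hx.2 (mem_interior_iff_mem_nhds.2 (h.halfCylinder_mem_nhds hxw h0'))
  · have h1 : h.halfCylinder (h.itin w.length x) ∈ 𝓝 x :=
      h.halfCylinder_mem_nhds (by simp [halfCylinder]) (by rwa [h.length_itin])
    obtain ⟨y, hy1, hy2⟩ := mem_closure_iff_nhds.1 hx.1 _ h1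
    simp only [halfCylinder, Set.mem_ofPred_eq, length_itin] at hy1 hy2 hxw
    exact hxw (hy1.symm.trans hy2)

theorem exists_right_mem_halfCylinder (n : ℕ) (x : Phase) :
    ∃ r : ℝ, (x : ℝ) < r ∧ ∀ y : Phase, x ≤ y → (y : ℝ) < r → h.itin n y = h.itin n x := by
  obtain ⟨y, hxy, -, e⟩ := h.exists_gt_itin_eq n x one_pos
  exact ⟨y, hxy, fun z hxz hzy => h.itin_eq_of_mem_Icc e.symm hxz (le_of_lt hzy)⟩

/-- Along a sequence increasing to `p` some word recurs infinitely often, and since cylinders are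
intervals it fills a left neighbourhood. The case `p = 1` controls the missing end of the phase
space. -/
theorem exists_left_mem_halfCylinder (n : ℕ) {p : ℝ} (hp : p ∈ Set.Ioc (0 : ℝ) 1) :
    ∃ q < p, ∃ w ∈ language F, w.length = n ∧
      ∀ y : Phase, q < y → (y : ℝ) < p → h.itin n y = w := by
  set u : ℕ → Phase := fun k => ⟨p - p / (k + 1), by
    have : p / (k + 1) ≤ p := div_le_self hp.1.le (by linarith [k.cast_nonneg (α := ℝ)])
    linarith, by
    have : 0 < p / ((k : ℝ) + 1) := div_pos hp.1 (by positivity)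
    linarith [hp.2]⟩
  have hup : ∀ k, (u k : ℝ) < p := fun k => by
    have : 0 < p / ((k : ℝ) + 1) := div_pos hp.1 (by positivity)
    simp only [u]; linarith
  have hmono : Monotone u := fun k l hkl => Subtype.coe_le_coe.1 (by
    simp only [u]
    have : p / ((l : ℝ) + 1) ≤ p / (k + 1) := div_le_div_of_nonneg_left hp.1.le (by positivity)
      (by have : (k : ℝ) ≤ l := by exact_mod_cast hkl
          linarith)
    linarith)
  have hlim : Tendsto (fun k => (u k : ℝ)) atTop (𝓝 p) := by
    have h1 := (tendsto_one_div_add_atTop_nhds_zero_nat (𝕜 := ℝ)).const_mul p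
    have h2 := h1.const_sub p
    simpa [u, div_eq_mul_inv] using h2
  have hfin : {w : List (Letter F) | w.length = n}.Finite := List.finite_length_eq _ n
  obtain ⟨w, hw, hfr⟩ : ∃ w ∈ {w : List (Letter F) | w.length = n},
      ∃ᶠ k in atTop, h.itin n (u k) = w := by
    by_contra hcon
    push Not at hcon
    have := (hfin.eventually_all (l := (atTop : Filter ℕ))
      (p := fun w k => h.itin n (u k) ≠ w)).2 hcon
    obtain ⟨k, hk⟩ := this.exists
    exact hk _ (h.length_itin n _) rfl
  obtain ⟨k, hk⟩ := hfr.exists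
  refine ⟨u k, hup k, w, hk ▸ h.itin_mem_language n _, hw, fun y hky hyp => ?_⟩
  obtain ⟨l, hl, hl'⟩ := (hfr.and_eventually (hlim.eventually_const_lt hyp)).exists
  exact (h.itin_eq_of_mem_Icc (hk.trans hl.symm) (le_of_lt hky) (le_of_lt hl')).trans hk

theorem dist_le_of_itin_eq {n : ℕ} {x y : Phase} (e : h.itin n x = h.itin n y) :
    |(x : ℝ) - y| ≤ α⁻¹ ^ n := by
  wlog hxy : x ≤ y generalizing x y
  · rw [abs_sub_comm]; exact this e.symm (le_of_not_ge hxy)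
  have h1 := h.pow_mul_sub_le hxy e
  have h2 := ((map F)^[n] y).2.2
  have h3 := ((map F)^[n] x).2.1
  have h4 : 0 < α ^ n := pow_pos (by linarith [h.one_lt]) n
  have h5 : (x : ℝ) ≤ y := hxy
  rw [abs_sub_comm, abs_of_nonneg (sub_nonneg.2 h5), inv_pow, ← one_div, le_div_iff₀ h4]
  linarith

theorem exists_halfCylinder_subset {x : Phase} {U : Set Phase} (hU : U ∈ 𝓝 x) :
    ∃ n, h.halfCylinder (h.itin n x) ⊆ U := by
  obtain ⟨ε, hε, hb⟩ := Metric.mem_nhds_iff.1 hU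
  obtain ⟨n, hn⟩ := exists_pow_lt_of_lt_one hε (inv_lt_one_of_one_lt₀ h.one_lt)
  refine ⟨n, fun y hy => hb ?_⟩
  have e : h.itin n y = h.itin n x := by
    have : h.itin (h.itin n x).length y = h.itin n x := hy
    rwa [h.length_itin] at this
  exact (h.dist_le_of_itin_eq e).trans_lt hn

/-! ### Measurability and approximation by cylinders. -/

theorem measurable_map : Measurable (map F) := by
  have : Measurable fun x : Phase => F x :=
    (h.cont.comp_continuous continuous_subtype_val fun x => ⟨x.2.1, x.2.2.le⟩).measurable
  exact (measurable_fract.comp this).subtype_mk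

theorem measurable_digit : Measurable h.digit := by
  have : Measurable fun x : Phase => F x :=
    (h.cont.comp_continuous continuous_subtype_val fun x => ⟨x.2.1, x.2.2.le⟩).measurable
  refine measurable_to_countable' fun a => ?_
  have e : h.digit ⁻¹' {a} = (fun x : Phase => ⌊F x⌋₊) ⁻¹' {(a : ℕ)} := by
    ext x; simp [digit, Fin.ext_iff]
  rw [e]
  exact (Nat.measurable_floor.comp this) (measurableSet_singleton _)

theorem measurableSet_itin (n : ℕ) (S : Set (List (Letter F))) :
    MeasurableSet {x | h.itin n x ∈ S} := by
  have hm : Measurable fun (x : Phase) (i : Fin n) => h.digit ((map F)^[(i : ℕ)] x) :=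
    measurable_pi_lambda _ fun i => h.measurable_digit.comp (h.measurable_map.iterate i)
  have : {x | h.itin n x ∈ S} = (fun (x : Phase) (i : Fin n) => h.digit ((map F)^[(i : ℕ)] x)) ⁻¹'
      {v | List.ofFn v ∈ S} := by
    ext x; simp [itin_eq_ofFn]
  rw [this]
  exact hm (Set.toFinite _).measurableSet

theorem measurableSet_halfCylinder (w : List (Letter F)) : MeasurableSet (h.halfCylinder w) :=
  h.measurableSet_itin w.length {w}

theorem borel_eq_generateFrom :
    (inferInstance : MeasurableSpace Phase) =
      MeasurableSpace.generateFrom (Set.range h.halfCylinder) := by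
  refine le_antisymm ?_ (MeasurableSpace.generateFrom_le ?_)
  · rw [BorelSpace.measurable_eq (α := Phase)]
    refine MeasurableSpace.generateFrom_le fun U hU => ?_
    have : U = ⋃ w ∈ {w | h.halfCylinder w ⊆ U}, h.halfCylinder w := by
      refine Set.Subset.antisymm (fun x hx => ?_) (Set.iUnion₂_subset fun w hw => hw)
      obtain ⟨n, hn⟩ := h.exists_halfCylinder_subset (IsOpen.mem_nhds hU hx)
      exact Set.mem_biUnion hn (by simp [halfCylinder])
    rw [this]
    exact MeasurableSet.biUnion (Set.to_countable _) fun w _ =>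
      MeasurableSpace.measurableSet_generateFrom ⟨w, rfl⟩
  · rintro _ ⟨w, rfl⟩
    exact h.measurableSet_halfCylinder w

/-- Sets determined by finitely many digits form an algebra that generates the Borel sets. -/
theorem exists_itin_approx (ν : Measure Phase) [IsFiniteMeasure ν] {A : Set Phase}
    (hA : MeasurableSet A) {ε : ℝ} (hε : 0 < ε) :
    ∃ (n : ℕ) (S : Set (List (Letter F))), ν.real (symmDiff A {x | h.itin n x ∈ S}) < ε := by
  set 𝒜 : Set (Set Phase) := {B | ∃ (n : ℕ) (S : Set (List (Letter F))),
    B = {x | h.itin n x ∈ S}} with h𝒜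
  have lift : ∀ n k (S : Set (List (Letter F))),
      {x | h.itin n x ∈ S} = {x | h.itin (n + k) x ∈ {w | w.take n ∈ S}} := by
    intro n k S
    ext x
    simp only [Set.mem_ofPred_eq]
    rw [h.itin_add, List.take_left' (h.length_itin n x)]
  have alg : IsSetAlgebra 𝒜 := by
    refine ⟨⟨0, ∅, by simp⟩, ?_, ?_⟩
    · rintro _ ⟨n, S, rfl⟩
      exact ⟨n, Sᶜ, rfl⟩
    · rintro _ _ ⟨n, S, rfl⟩ ⟨k, S', rfl⟩
      refine ⟨n + k, {w | w.take n ∈ S} ∪ {w | w.take k ∈ S'}, ?_⟩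
      rw [lift n k S, lift k n S', add_comm k n]
      rfl
  have hgen : (inferInstance : MeasurableSpace Phase) = MeasurableSpace.generateFrom 𝒜 := by
    refine le_antisymm ?_ (MeasurableSpace.generateFrom_le ?_)
    · conv_lhs => rw [h.borel_eq_generateFrom]
      refine MeasurableSpace.generateFrom_mono ?_
      rintro _ ⟨w, rfl⟩
      exact ⟨w.length, {w}, rfl⟩
    · rintro _ ⟨n, S, rfl⟩
      exact h.measurableSet_itin n S
  obtain ⟨_, ⟨n, S, rfl⟩, hlt⟩ :=
    (Measure.MeasureDense.of_generateFrom_isSetAlgebra_finite ν alg hgen).approx A hA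
      (measure_ne_top _ _) ε hε
  refine ⟨n, S, ?_⟩
  rw [measureReal_def]
  exact (ENNReal.toReal_lt_of_lt_ofReal hlt)

/-- Cylinders are nested or disjoint, hence a π-system. -/
theorem ext_of_halfCylinder {ν ρ : Measure Phase} [IsProbabilityMeasure ν]
    [IsProbabilityMeasure ρ] (e : ∀ w, ν (h.halfCylinder w) = ρ (h.halfCylinder w)) : ν = ρ := by
  refine ext_of_generate_finite _ h.borel_eq_generateFrom ?_ ?_ (by simp)
  · rintro _ ⟨u, rfl⟩ _ ⟨v, rfl⟩ ⟨x, hxu, hxv⟩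
    rcases le_total u.length v.length with hl | hl
    · refine ⟨v, (Set.inter_eq_right.2 fun y hy => ?_).symm⟩
      obtain ⟨k, hk⟩ := Nat.exists_eq_add_of_le hl
      simp only [halfCylinder, Set.mem_ofPred_eq, hk, h.itin_add] at hxu hxv hy ⊢
      exact (List.append_inj (hy.trans hxv.symm) (by simp)).1.trans hxu
    · refine ⟨u, (Set.inter_eq_left.2 fun y hy => ?_).symm⟩
      obtain ⟨k, hk⟩ := Nat.exists_eq_add_of_le hl
      simp only [halfCylinder, Set.mem_ofPred_eq, hk, h.itin_add] at hxu hxv hy ⊢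
      exact (List.append_inj (hy.trans hxu.symm) (by simp)).1.trans hxv
  · rintro _ ⟨w, rfl⟩
    exact e w

end IsExpanding

end FTransformation

/-! ### Weights on words and surgery on words. -/

namespace FTransformation

open MeasureTheory Filter Topology

theorem sum_le_sum_of_injOn {ι κ : Type*} {s : Finset ι} {t : Finset κ} {f : ι → ℝ} {g : κ → ℝ}
    (e : ι → κ) (he : Set.InjOn e s) (hst : ∀ i ∈ s, e i ∈ t) (hfg : ∀ i ∈ s, f i ≤ g (e i))
    (hg : ∀ k ∈ t, 0 ≤ g k) : ∑ i ∈ s, f i ≤ ∑ k ∈ t, g k := by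
  classical
  calc ∑ i ∈ s, f i ≤ ∑ i ∈ s, g (e i) := Finset.sum_le_sum hfg
    _ = ∑ k ∈ s.image e, g k := (Finset.sum_image he).symm
    _ ≤ ∑ k ∈ t, g k := Finset.sum_le_sum_of_subset_of_nonneg
        (Finset.image_subset_iff.2 hst) fun k hk _ => hg k hk

/-- All words of length `n`. -/
noncomputable def words (F : ℝ → ℝ) (n : ℕ) : Finset (List (Letter F)) :=
  (List.finite_length_eq (Letter F) n).toFinset

@[simp] theorem mem_words {F : ℝ → ℝ} {n : ℕ} {w : List (Letter F)} :
    w ∈ words F n ↔ w.length = n := by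
  simp [words]

open Classical in
/-- The sum of `exp Φ` over the words of length `n` belonging to `S`. -/
noncomputable def weightSum {F : ℝ → ℝ} (Φ : List (Letter F) → ℝ) (S : Set (List (Letter F)))
    (n : ℕ) : ℝ :=
  ∑ w ∈ words F n with w ∈ S, Real.exp (Φ w)

/-- Weights on words which are additive under concatenation up to a bounded error. -/
structure IsAlmostAdditive (F : ℝ → ℝ) (Φ : List (Letter F) → ℝ) (V B : ℝ) : Prop where
  V_nonneg : 0 ≤ V
  B_nonneg : 0 ≤ B
  append_le : ∀ u v, u ++ v ∈ language F → Φ (u ++ v) ≤ Φ u + Φ v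
  le_append : ∀ u v, u ++ v ∈ language F → Φ u + Φ v ≤ Φ (u ++ v) + V
  abs_le : ∀ w ∈ language F, |Φ w| ≤ B * w.length

theorem weightSum_nonneg {F : ℝ → ℝ} (Φ : List (Letter F) → ℝ) (S : Set (List (Letter F)))
    (n : ℕ) : 0 ≤ weightSum Φ S n :=
  Finset.sum_nonneg fun _ _ => (Real.exp_pos _).le

open Classical in
theorem weightSum_mono {F : ℝ → ℝ} (Φ : List (Letter F) → ℝ) {S S' : Set (List (Letter F))}
    (hS : S ⊆ S') (n : ℕ) : weightSum Φ S n ≤ weightSum Φ S' n :=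
  Finset.sum_le_sum_of_subset_of_nonneg
    (fun _ hw => Finset.mem_filter.2 ⟨(Finset.mem_filter.1 hw).1, hS (Finset.mem_filter.1 hw).2⟩) fun _ _ _ => (Real.exp_pos _).le

theorem partitionSum_eq_weightSum (F φ : ℝ → ℝ) (n : ℕ) :
    partitionSum F φ n = weightSum (wordSup F φ) (language F) n := by
  classical
  unfold partitionSum weightSum
  rw [finsum_mem_eq_sum_of_inter_support_eq]
  ext w
  simp [and_comm]

namespace IsExpanding

variable {F : ℝ → ℝ} {α : ℝ} (h : IsExpanding F α)

include h

theorem numBranches_pos : 0 < numBranches F := by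
  have := h.le_apply (x := 1) (by simp)
  exact Nat.ceil_pos.2 (by linarith [h.one_lt])

/-- The smallest letter. -/
def zero' : Letter F := ⟨0, h.numBranches_pos⟩

theorem zero'_le (a : Letter F) : h.zero' ≤ a := Nat.zero_le _

theorem zero'_lt_maxWord_zero : h.zero' < h.maxWord 0 := by
  have := h.le_apply (x := 1) (by simp)
  have h1 : 1 < ⌈F 1⌉₊ := Nat.lt_ceil.2 (by push_cast; linarith [h.one_lt])
  change 0 < ⌈F (edge F 0)⌉₊ - 1
  simp only [edge]
  omega

theorem left_mem_language {u v : List (Letter F)} (hw : u ++ v ∈ language F) :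
    u ∈ language F := by
  obtain ⟨j, hj⟩ := h.mem_language_iff.1 hw
  obtain ⟨k, hk, -⟩ := hj.split
  exact h.mem_language_iff.2 ⟨k, hk⟩

theorem halfCylinder_nonempty_of_mem {w : List (Letter F)} (hw : w ∈ language F) :
    (h.halfCylinder w).Nonempty := by
  obtain ⟨j, hj⟩ := h.mem_language_iff.1 hw
  exact h.halfCylinder_nonempty hj

theorem right_mem_language {u v : List (Letter F)} (hw : u ++ v ∈ language F) :
    v ∈ language F := by
  obtain ⟨x, hx⟩ := h.halfCylinder_nonempty_of_mem hw
  have := (h.itin_append_iff.1 hx).2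
  rw [← this]
  exact h.itin_mem_language _ _

theorem mem_language_of_path {w : List (Letter F)} {j : ℕ} (hp : GraphPath h.maxWord 0 w j) :
    w ∈ language F := h.mem_language_iff.2 ⟨j, hp⟩

theorem path_zeros (n : ℕ) : GraphPath h.maxWord 0 (List.replicate n h.zero') 0 := by
  induction n with
  | zero => exact .nil 0
  | succ n ih => exact .drop h.zero'_lt_maxWord_zero ih

/-- As long as `m` reads `0`, the left orbit of `1` grows by a factor `α` at every step, yet it
stays in `(0,1]`. -/
theorem exists_maxWord_ne_zero (i : ℕ) : ∃ k, h.maxWord (i + k) ≠ h.zero' := by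
  by_contra hcon
  push Not at hcon
  have grow : ∀ k, α ^ k * edge F i ≤ edge F (i + k) := by
    intro k
    induction k with
    | zero => simp
    | succ k ih =>
      have h1 := h.apply_edge (i + k)
      rw [hcon k] at h1
      have h2 := h.le_apply (h.edge_mem_Icc (i + k))
      have h3 : edge F (i + k + 1) = F (edge F (i + k)) := by rw [h1]; simp [zero']
      rw [← add_assoc, h3, pow_succ', mul_assoc]
      exact (mul_le_mul_of_nonneg_left ih (by linarith [h.one_lt])).trans h2
  obtain ⟨k, hk⟩ := pow_unbounded_of_one_lt (edge F i)⁻¹ h.one_lt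
  have h1 := grow k
  have h2 := (h.edge_mem (i + k)).2
  have h3 := (h.edge_mem i).1
  rw [inv_lt_iff_one_lt_mul₀ h3] at hk
  linarith

/-- Zeros climb while `m` reads `0` and drop at its first nonzero letter, so a block of zeros
returns to the base from every vertex. -/
theorem exists_path_zeros (i : ℕ) :
    ∃ N, GraphPath h.maxWord i (List.replicate (N + 1) h.zero') 0 := by
  obtain ⟨k, hk⟩ := h.exists_maxWord_ne_zero i
  induction k generalizing i with
  | zero => exact ⟨0, .drop (lt_of_le_of_ne (h.zero'_le _) (Ne.symm hk)) (.nil 0)⟩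
  | succ k ih =>
    by_cases hi : h.maxWord i = h.zero'
    · obtain ⟨N, hN⟩ := ih (i + 1) (by rwa [show i + 1 + k = i + (k + 1) by ring])
      refine ⟨N + 1, ?_⟩
      rw [List.replicate_succ]
      nth_rewrite 1 [← hi]
      exact .climb hN
    · exact ⟨0, .drop (lt_of_le_of_ne (h.zero'_le _) (Ne.symm hi)) (.nil 0)⟩

theorem eq_replicate_or_exists_last {F : ℝ → ℝ} (z : Letter F) (w : List (Letter F)) :
    w = List.replicate w.length z ∨
      ∃ u a k, a ≠ z ∧ w = u ++ ([a] ++ List.replicate k z) := by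
  induction w using List.reverseRecOn with
  | nil => exact Or.inl rfl
  | append_singleton w b ih =>
    by_cases hb : b = z
    · subst hb
      rcases ih with ih | ⟨u, a, k, ha, hw⟩
      · left
        rw [List.length_append, List.length_singleton, List.replicate_succ', ← ih]
      · exact Or.inr ⟨u, a, k + 1, ha, by rw [hw, List.replicate_succ']; simp⟩
    · exact Or.inr ⟨w, b, 0, hb, by simp⟩

/-- Either the path never drops, or it is cut at its last drop, after which it spells `m` from the
beginning. -/
theorem path_decomp {i j : ℕ} {w : List (Letter F)} (hp : GraphPath h.maxWord i w j) :
    j = i + w.length ∨ ∃ u, w = u ++ (List.ofFn fun k : Fin j => h.maxWord k) ∧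
      GraphPath h.maxWord i u 0 := by
  induction hp with
  | nil => left; rfl
  | climb _ ih =>
    rcases ih with ih | ⟨u, hu, hp⟩
    · left; simp only [List.length_cons]; omega
    · exact Or.inr ⟨_ :: u, by rw [hu]; rfl, .climb hp⟩
  | @drop i j a w ha hp ih =>
    right
    rcases ih with ih | ⟨u, hu, hp⟩
    · refine ⟨[a], ?_, .drop ha (.nil 0)⟩
      have h1 := h.path_maxWord 0 w.length
      obtain ⟨x, hx⟩ := h.halfCylinder_nonempty hp
      have e : w = List.ofFn fun k : Fin j => h.maxWord k := by
        clear ha hx x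
        rw [zero_add] at ih
        subst ih
        have aux : ∀ (w : List (Letter F)) (i : ℕ), GraphPath h.maxWord i w (i + w.length) →
            w = List.ofFn fun k : Fin w.length => h.maxWord (i + k) := by
          intro w
          induction w with
          | nil => intro i _; rfl
          | cons b w ihw =>
            intro i hb
            rw [List.length_cons] at hb
            generalize hk : i + (w.length + 1) = k at hb
            cases hb with
            | climb hb =>
              have := ihw (i + 1) (by rwa [show i + 1 + w.length = k by omega])
              rw [List.length_cons, List.ofFn_succ]
              refine congrArg₂ _ (by simp) (this.trans ?_)
              congr 1; funext k; simp; ring_nf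
            | drop _ hb => have := hb.le_length; omega
        have := aux w 0 (by simpa using hp)
        simpa using this
      rw [← e]; rfl
    · exact ⟨a :: u, by rw [hu]; rfl, .drop ha hp⟩

theorem path_zero_decomp {j : ℕ} {w : List (Letter F)} (hp : GraphPath h.maxWord 0 w j) :
    ∃ u, w = u ++ (List.ofFn fun k : Fin j => h.maxWord k) ∧ GraphPath h.maxWord 0 u 0 := by
  -- Prepending the letter `0`, which drops to the base, excludes the alternative of a path without
  -- drops.
  have h0 : GraphPath h.maxWord 0 (h.zero' :: w) j := .drop h.zero'_lt_maxWord_zero hp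
  rcases h.path_decomp h0 with h1 | ⟨u, hu, hu'⟩
  · have := hp.le_length; simp at h1; omega
  · cases u with
    | nil =>
      have := congrArg List.length hu
      have := hp.le_length
      simp at *; omega
    | cons a u =>
      rw [List.cons_append, List.cons.injEq] at hu
      obtain ⟨rfl, hu⟩ := hu
      refine ⟨u, hu, ?_⟩
      generalize hz : h.zero' = z at hu'
      cases hu' with
      | climb _ => exact absurd hz h.zero'_lt_maxWord_zero.ne
      | drop _ hu' => exact hu'

variable {Φ : List (Letter F) → ℝ} {V B : ℝ} (hΦ : IsAlmostAdditive F Φ V B)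

include hΦ

/-- Replace the last nonzero letter by `0`. That letter witnesses `0 < m_l` at the vertex `l` where
it is read, so the new letter drops to the base and the trailing zeros stay there. Two joins cost
`2V` and the two letters `2B`. -/
theorem exists_closed_modification {w : List (Letter F)} (hw : w ∈ language F) :
    ∃ w' : List (Letter F), GraphPath h.maxWord 0 w' 0 ∧ w'.length = w.length ∧ Φ w ≤ Φ w' + 2 * (V + B) ∧
      ∃ p : ℕ, ∀ i : ℕ, i ≠ p → w'[i]? = w[i]? := by
  have hV := hΦ.V_nonneg
  have hB := hΦ.B_nonneg
  rcases eq_replicate_or_exists_last h h.zero' w with e | ⟨u, a, k, ha, e⟩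
  · exact ⟨w, e ▸ h.path_zeros _, rfl, by linarith, 0, fun _ _ => rfl⟩
  · subst e
    obtain ⟨j, hj⟩ := h.mem_language_iff.1 hw
    obtain ⟨l, hl, hl'⟩ := hj.split
    have ha' : a ≤ h.maxWord l := by
      cases hl' with
      | climb _ => exact le_rfl
      | drop ha _ => exact ha.le
    have hz : h.zero' < h.maxWord l :=
      (lt_of_le_of_ne (h.zero'_le a) (Ne.symm ha)).trans_le ha'
    have hp : GraphPath h.maxWord 0 (u ++ ([h.zero'] ++ List.replicate k h.zero')) 0 :=
      hl.append (.drop hz (h.path_zeros k))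
    refine ⟨_, hp, by simp, ?_, u.length, fun i hi => ?_⟩
    · have hL := h.mem_language_of_path hp
      have hw1 := h.right_mem_language hw
      have hL1 := h.right_mem_language hL
      have h1 := hΦ.append_le _ _ hw
      have h2 := hΦ.append_le _ _ hw1
      have h3 := hΦ.le_append _ _ hL
      have h4 := hΦ.le_append _ _ hL1
      have h5 := abs_le.1 (hΦ.abs_le _ (h.left_mem_language hw1))
      have h6 := abs_le.1 (hΦ.abs_le _ (h.left_mem_language hL1))
      simp only [List.length_singleton, Nat.cast_one, mul_one] at h5 h6
      linarith [h5.1, h5.2, h6.1, h6.2]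
    · rcases lt_or_gt_of_ne hi with hi | hi
      · rw [List.getElem?_append_left hi, List.getElem?_append_left hi]
      · rw [List.getElem?_append_right hi.le, List.getElem?_append_right hi.le]
        obtain ⟨t, ht⟩ : ∃ t, i - u.length = t + 1 := ⟨i - u.length - 1, by omega⟩
        simp [ht]

/-- Cut out the block of length `K` at `j`, close up the pieces before and after it, and insert a
closed block that starts with `m_0` or `0`, whichever differs from the letter at `j`. Outside the
block only the places `p` and `q`, altered by the two closures, can change. -/
theorem exists_marked_modification : ∃ C : ℝ, ∃ K : ℕ, 0 < K ∧ ∀ w ∈ language F, ∀ j : ℕ,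
    j + K ≤ w.length → ∃ u : List (Letter F), GraphPath h.maxWord 0 u 0 ∧ u.length = w.length ∧ Φ w ≤ Φ u + C ∧
      u[j]? ≠ w[j]? ∧ ∃ p q : ℕ, ∀ i : ℕ, i ≠ p → i ≠ q → (i < j ∨ j + K ≤ i) → u[i]? = w[i]? := by
  obtain ⟨M, hM⟩ := h.exists_path_zeros 1
  have hc1 : GraphPath h.maxWord 0 (h.maxWord 0 :: List.replicate (M + 1) h.zero') 0 := .climb hM
  have hc0 : GraphPath h.maxWord 0 (h.zero' :: List.replicate (M + 1) h.zero') 0 :=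
    .drop h.zero'_lt_maxWord_zero (h.path_zeros _)
  have hV := hΦ.V_nonneg
  have hB := hΦ.B_nonneg
  -- Two closures cost `4(V + B)`, exchanging the blocks `2B(M + 2)`, and the two joins `2V`.
  refine ⟨4 * (V + B) + 2 * (B * (M + 2)) + 2 * V, M + 2, by omega, fun w hw j hj => ?_⟩
  obtain ⟨c, hc, hcl, hcne⟩ : ∃ d : List (Letter F), GraphPath h.maxWord 0 d 0 ∧ d.length = M + 2 ∧
      d[0]? ≠ w[j]? := by
    by_cases hz : w[j]? = some h.zero'
    · exact ⟨_, hc1, by simp, by simpa [hz] using h.zero'_lt_maxWord_zero.ne'⟩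
    · exact ⟨_, hc0, by simp, by simpa using Ne.symm hz⟩
  have e1 : w = w.take j ++ ((w.drop j).take (M + 2) ++ (w.drop j).drop (M + 2)) := by simp
  have hw' := hw
  rw [e1] at hw'
  have hw2 := h.right_mem_language hw'
  obtain ⟨u, hu, hul, huΦ, p, hp⟩ :=
    h.exists_closed_modification hΦ (h.left_mem_language hw')
  obtain ⟨v, hv, hvl, hvΦ, q, hq⟩ :=
    h.exists_closed_modification hΦ (h.right_mem_language hw2)
  have hul' : u.length = j := by rw [hul, List.length_take]; omega
  have hvl' : v.length = w.length - (j + (M + 2)) := by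
    rw [hvl]; simp only [List.length_drop]; omega
  have hpath := hu.append (hc.append hv)
  have hL := h.mem_language_of_path hpath
  have hL2 := h.right_mem_language hL
  refine ⟨u ++ (c ++ v), hpath, ?_, ?_, ?_, p, j + (M + 2) + q, fun i hip hiq hi => ?_⟩
  · simp only [List.length_append]; omega
  · have a1 := hΦ.append_le _ _ hw'
    have a2 := hΦ.append_le _ _ hw2
    have a3 := hΦ.le_append _ _ hL
    have a4 := hΦ.le_append _ _ hL2
    have a5 := abs_le.1 (hΦ.abs_le _ (h.left_mem_language hw2))
    have a6 := abs_le.1 (hΦ.abs_le _ (h.left_mem_language hL2))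
    have a7 : ((w.drop j).take (M + 2)).length = M + 2 := by
      rw [List.length_take, List.length_drop]; omega
    rw [a7] at a5
    rw [hcl] at a6
    rw [← e1] at a1
    push_cast at a5 a6
    linarith [a5.1, a5.2, a6.1, a6.2]
  · rw [List.getElem?_append_right hul'.le, hul', Nat.sub_self,
      List.getElem?_append_left (by omega)]
    exact hcne
  · rcases hi with hi | hi
    · rw [List.getElem?_append_left (by omega), hp i hip, List.getElem?_take_of_lt hi]
    · rw [List.getElem?_append_right (by omega), List.getElem?_append_right (by omega),
        hq _ (by omega)]
      simp only [List.getElem?_drop]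
      congr 1; omega

end IsExpanding

end FTransformation

/-! ### Pressure and the pressure gap. -/

namespace FTransformation

open MeasureTheory Filter Topology

/-- The initial word of length `n` of `m`. -/
def initWord {F : ℝ → ℝ} (m : ℕ → Letter F) (n : ℕ) : List (Letter F) :=
  List.ofFn fun k : Fin n => m k

@[simp] theorem length_initWord {F : ℝ → ℝ} (m : ℕ → Letter F) (n : ℕ) :
    (initWord m n).length = n := by simp [initWord]

namespace IsExpanding

variable {F : ℝ → ℝ} {α : ℝ} (h : IsExpanding F α)

include h

theorem path_initWord (n : ℕ) : GraphPath h.maxWord 0 (initWord h.maxWord n) n := by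
  simpa [initWord] using h.path_maxWord 0 n

theorem goodCore_subset_language : goodCore h.maxWord ⊆ language F :=
  fun _ hw => h.mem_language_of_path hw

variable {Φ : List (Letter F) → ℝ} {V B : ℝ} (hΦ : IsAlmostAdditive F Φ V B)

include hΦ

theorem weight_nil : Φ [] = 0 := by
  have := hΦ.abs_le [] (h.mem_language_of_path (.nil 0))
  simpa using this

-- Altering `w` at each possible place `j` gives closed words of comparable weight. The words
-- obtained for different `j` repeat at most `K + 2` times, so their number is linear in the length.
open Classical in
theorem exists_mul_exp_le_weightSum : ∃ C : ℝ, 0 < C ∧ ∃ K : ℕ, ∀ w ∈ language F, K ≤ w.length →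
    ((w.length : ℝ) + 1 - K) * Real.exp (Φ w) ≤ C * weightSum Φ (goodCore h.maxWord) w.length := by
  obtain ⟨C, K, hK, hmod⟩ := h.exists_marked_modification hΦ
  refine ⟨(K + 2) * Real.exp C, by positivity, K, fun w hw hwK => ?_⟩
  choose! u hu hul huΦ hne p q hpq using hmod w hw
  set J := Finset.range (w.length + 1 - K) with hJ
  have hJ' : ∀ j ∈ J, j + K ≤ w.length := fun j hj => by
    rw [hJ, Finset.mem_range] at hj; omega
  -- If the words for `j` and `j₀` agree, then the word for `j₀` differs from `w` at `j`; so `j` is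
  -- one of its two exceptional places or lies in its block of length `K`.
  have fib : ∀ v ∈ J.image u, (J.filter fun j => u j = v).card ≤ K + 2 := by
    intro v hv
    obtain ⟨j₀, hj₀, rfl⟩ := Finset.mem_image.1 hv
    have hsub : (J.filter fun j => u j = u j₀) ⊆
        {p j₀, q j₀} ∪ Finset.Ico j₀ (j₀ + K) := by
      intro j hj
      obtain ⟨hj, hjj⟩ := Finset.mem_filter.1 hj
      by_contra hcon
      simp only [Finset.mem_union, Finset.mem_insert, Finset.mem_singleton, Finset.mem_Ico,
        not_or, not_and] at hcon
      refine hne j (hJ' j hj) ?_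
      rw [hjj]
      exact hpq j₀ (hJ' _ hj₀) j hcon.1.1 hcon.1.2 (by omega)
    refine (Finset.card_le_card hsub).trans ((Finset.card_union_le _ _).trans ?_)
    rw [Nat.card_Ico]
    have := Finset.card_le_two (a := p j₀) (b := q j₀)
    omega
  have hcard := Finset.card_le_mul_card_image (f := u) J (K + 2) fib
  rw [hJ, Finset.card_range] at hcard
  have hsum : ((J.image u).card : ℝ) * Real.exp (Φ w - C) ≤
      weightSum Φ (goodCore h.maxWord) w.length := by
    rw [← nsmul_eq_mul, ← Finset.sum_const]
    refine sum_le_sum_of_injOn id Function.injective_id.injOn (fun v hv => ?_) (fun v hv => ?_)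
      fun _ _ => (Real.exp_pos _).le
    · obtain ⟨j, hj, rfl⟩ := Finset.mem_image.1 hv
      exact Finset.mem_filter.2 ⟨mem_words.2 (hul j (hJ' j hj)), hu j (hJ' j hj)⟩
    · obtain ⟨j, hj, rfl⟩ := Finset.mem_image.1 hv
      exact Real.exp_le_exp.2 (by have := huΦ j (hJ' j hj); simp only [id]; linarith)
  have hcard' : (w.length : ℝ) + 1 - K ≤ (K + 2) * (J.image u).card := by
    have : ((w.length + 1 - K : ℕ) : ℝ) ≤ ((K + 2) * (J.image u).card : ℕ) := by
      exact_mod_cast hcard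
    rw [Nat.cast_sub (by omega)] at this
    push_cast at this
    exact this
  calc ((w.length : ℝ) + 1 - K) * Real.exp (Φ w)
      ≤ (K + 2) * (J.image u).card * Real.exp (Φ w) :=
        mul_le_mul_of_nonneg_right hcard' (Real.exp_pos _).le
    _ = (K + 2) * Real.exp C * ((J.image u).card * Real.exp (Φ w - C)) := by
        rw [Real.exp_sub, mul_div_assoc', mul_assoc, mul_assoc, mul_div_cancel₀ _ (Real.exp_pos C).ne']
    _ ≤ _ := mul_le_mul_of_nonneg_left hsum (by positivity)

theorem weightSum_good_mul_le (n k : ℕ) :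
    weightSum Φ (goodCore h.maxWord) n * weightSum Φ (goodCore h.maxWord) k ≤
      Real.exp V * weightSum Φ (goodCore h.maxWord) (n + k) := by
  classical
  unfold weightSum
  rw [Finset.sum_mul_sum, ← Finset.sum_product', Finset.mul_sum]
  refine sum_le_sum_of_injOn (fun t => t.1 ++ t.2) ?_ ?_ ?_ fun _ _ => by positivity
  · rintro ⟨u, v⟩ huv ⟨u', v'⟩ huv' e
    simp only [Finset.coe_product, Finset.coe_filter, mem_words, Set.mem_prod,
      Set.mem_ofPred_eq] at huv huv'
    have := List.append_inj e (huv.1.1.trans huv'.1.1.symm)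
    exact Prod.ext this.1 this.2
  · rintro ⟨u, v⟩ huv
    simp only [Finset.mem_product, Finset.mem_filter, mem_words] at huv ⊢
    exact ⟨by rw [List.length_append, huv.1.1, huv.2.1], GraphPath.append huv.1.2 huv.2.2⟩
  · rintro ⟨u, v⟩ huv
    simp only [Finset.mem_product, Finset.mem_filter, mem_words] at huv
    rw [← Real.exp_add, ← Real.exp_add]
    have := hΦ.le_append u v (h.mem_language_of_path (GraphPath.append huv.1.2 huv.2.2))
    exact Real.exp_le_exp.2 (by linarith)

theorem weightSum_language_add_le (n k : ℕ) :
    weightSum Φ (language F) (n + k) ≤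
      weightSum Φ (language F) n * weightSum Φ (language F) k := by
  classical
  unfold weightSum
  rw [Finset.sum_mul_sum, ← Finset.sum_product']
  refine sum_le_sum_of_injOn (fun w => (w.take n, w.drop n)) ?_ ?_ ?_ fun _ _ => by positivity
  · intro w _ w' _ e
    simp only [Prod.mk.injEq] at e
    rw [← List.take_append_drop n w, ← List.take_append_drop n w', e.1, e.2]
  · intro w hw
    simp only [Finset.mem_product, Finset.mem_filter, mem_words, List.length_take,
      List.length_drop] at hw ⊢
    have hw2 := hw.2
    rw [← List.take_append_drop n w] at hw2
    exact ⟨⟨by omega, h.left_mem_language hw2⟩, ⟨by omega, h.right_mem_language hw2⟩⟩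
  · intro w hw
    simp only [Finset.mem_filter, mem_words] at hw
    have hw2 := hw.2
    rw [← List.take_append_drop n w] at hw2
    rw [← Real.exp_add]
    have := hΦ.append_le _ _ hw2
    rw [List.take_append_drop] at this
    exact Real.exp_le_exp.2 this

theorem exp_le_weightSum_good (n : ℕ) :
    Real.exp (-(B * n)) ≤ weightSum Φ (goodCore h.maxWord) n := by
  classical
  have h1 := abs_le.1 (hΦ.abs_le _ (h.mem_language_of_path (h.path_zeros n)))
  rw [List.length_replicate] at h1
  refine (Real.exp_le_exp.2 h1.1).trans ?_
  unfold weightSum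
  exact Finset.single_le_sum (f := fun w => Real.exp (Φ w)) (fun _ _ => (Real.exp_pos _).le)
    (Finset.mem_filter.2 ⟨by simp, h.path_zeros n⟩)

theorem weightSum_language_pos (n : ℕ) : 0 < weightSum Φ (language F) n :=
  (Real.exp_pos _).trans_le ((h.exp_le_weightSum_good hΦ n).trans
    (weightSum_mono Φ h.goodCore_subset_language n))

theorem subadditive_log_weightSum : Subadditive fun n => Real.log (weightSum Φ (language F) n) :=
  fun n k => by
    rw [← Real.log_mul (h.weightSum_language_pos hΦ n).ne' (h.weightSum_language_pos hΦ k).ne']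
    exact Real.log_le_log (h.weightSum_language_pos hΦ _) (h.weightSum_language_add_le hΦ n k)

/-- The pressure exists, and bounds the weight sums from below. -/
theorem exists_pressure : ∃ P : ℝ,
    Tendsto (fun n : ℕ => Real.log (weightSum Φ (language F) n) / n) atTop (𝓝 P) ∧
    ∀ n : ℕ, Real.exp (n * P) ≤ weightSum Φ (language F) n := by
  have hsub := h.subadditive_log_weightSum hΦ
  have hbdd : BddBelow (Set.range fun n : ℕ => Real.log (weightSum Φ (language F) n) / n) := by
    refine ⟨-B, ?_⟩
    rintro _ ⟨n, rfl⟩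
    rcases n.eq_zero_or_pos with rfl | hn
    · simpa using hΦ.B_nonneg
    · have hn' : (0 : ℝ) < n := by exact_mod_cast hn
      simp only
      rw [le_div_iff₀ hn', Real.le_log_iff_exp_le (h.weightSum_language_pos hΦ n)]
      refine le_trans ?_ ((h.exp_le_weightSum_good hΦ n).trans
        (weightSum_mono Φ h.goodCore_subset_language n))
      rw [neg_mul]
  refine ⟨hsub.lim, hsub.tendsto_lim hbdd, fun n => ?_⟩
  rw [← Real.le_log_iff_exp_le (h.weightSum_language_pos hΦ n)]
  rcases n.eq_zero_or_pos with rfl | hn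
  · simp only [Nat.cast_zero, zero_mul]
    refine Real.log_nonneg ?_
    have := (h.exp_le_weightSum_good hΦ 0).trans
      (weightSum_mono Φ h.goodCore_subset_language 0)
    simpa using this
  · have hn' : (0 : ℝ) < n := by exact_mod_cast hn
    have := hsub.lim_le_div hbdd hn.ne'
    rwa [le_div_iff₀ hn', mul_comm] at this

variable {P : ℝ} (hP : Tendsto (fun n : ℕ => Real.log (weightSum Φ (language F) n) / n) atTop (𝓝 P))

include hP

/-- Divided by `exp V`, the core sums are supermultiplicative, since closed words concatenate
freely. Hence the growth rate read off at any single `n` is at most the limit `P`. -/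
theorem weightSum_good_le (n : ℕ) :
    weightSum Φ (goodCore h.maxWord) n ≤ Real.exp V * Real.exp (n * P) := by
  set b := weightSum Φ (goodCore h.maxWord) n * Real.exp (-V) with hb
  have hpos : 0 < weightSum Φ (goodCore h.maxWord) n :=
    (Real.exp_pos _).trans_le (h.exp_le_weightSum_good hΦ n)
  have hb0 : 0 < b := mul_pos hpos (Real.exp_pos _)
  suffices hlog : Real.log b ≤ n * P by
    have := (Real.log_le_iff_le_exp hb0).1 hlog
    rw [hb, Real.exp_neg, ← div_eq_mul_inv, div_le_iff₀ (Real.exp_pos _)] at this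
    linarith
  have hpow : ∀ k : ℕ, b ^ k ≤ weightSum Φ (goodCore h.maxWord) (n * k) := by
    intro k
    induction k with
    | zero => simpa using h.exp_le_weightSum_good hΦ 0
    | succ k ih =>
      rw [pow_succ, Nat.mul_succ]
      have h1 := h.weightSum_good_mul_le hΦ (n * k) n
      have h2 := mul_le_mul_of_nonneg_right ih hb0.le
      refine h2.trans ?_
      rw [hb, Real.exp_neg, ← mul_assoc, ← div_eq_mul_inv, div_le_iff₀ (Real.exp_pos _)]
      linarith
  rcases n.eq_zero_or_pos with rfl | hn
  · have h1 := hpow 1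
    have h2 : weightSum Φ (goodCore h.maxWord) 0 ≤ 1 := by
      classical
      unfold weightSum
      have : (words F 0).filter (· ∈ goodCore h.maxWord) ⊆ {[]} := by
        intro w hw
        simp only [Finset.mem_filter, mem_words, List.length_eq_zero_iff] at hw
        simp [hw.1]
      refine (Finset.sum_le_sum_of_subset_of_nonneg this
        fun _ _ _ => (Real.exp_pos _).le).trans ?_
      simp [h.weight_nil hΦ]
    simp only [pow_one, mul_one] at h1
    simpa using Real.log_nonpos hb0.le (h1.trans h2)
  · have hlim : Tendsto (fun k : ℕ => Real.log (weightSum Φ (language F) (n * k)) / (n * k : ℕ))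
        atTop (𝓝 P) := hP.comp (tendsto_id.const_mul_atTop' hn)
    have hn' : (0 : ℝ) < n := by exact_mod_cast hn
    suffices Real.log b / n ≤ P by
      rwa [div_le_iff₀ hn', mul_comm] at this
    refine ge_of_tendsto hlim ?_
    filter_upwards [eventually_gt_atTop 0] with k hk
    have hk' : (0 : ℝ) < k := by exact_mod_cast hk
    have h1 : Real.log (b ^ k) ≤ Real.log (weightSum Φ (language F) (n * k)) :=
      Real.log_le_log (pow_pos hb0 k)
        ((hpow k).trans (weightSum_mono Φ h.goodCore_subset_language _))
    rw [Real.log_pow] at h1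
    push_cast
    rw [div_le_div_iff₀ hn' (by positivity)]
    nlinarith

/-- No word carries the full pressure: the weight of single words is exponentially small. -/
theorem exists_pressure_gap : ∃ ε > 0, ∃ C ≥ 0, ∀ w ∈ language F, Φ w ≤ w.length * (P - ε) + C := by
  obtain ⟨C, hC, K, hCK⟩ := h.exists_mul_exp_le_weightSum hΦ
  -- At this length the factor `l + 1 - K` won by surgery absorbs all constants and leaves a spare
  -- factor `e`: each block loses `1` against `lP`.
  obtain ⟨l, hl⟩ := exists_nat_gt (C * Real.exp V * Real.exp 1 + K)
  have hlK : K ≤ l := by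
    have : (K : ℝ) ≤ l := by
      have : 0 < C * Real.exp V * Real.exp 1 := by positivity
      linarith
    exact_mod_cast this
  have hl0 : (0 : ℝ) < l := by
    have : 0 < C * Real.exp V * Real.exp 1 := by positivity
    linarith [K.cast_nonneg (α := ℝ)]
  have block : ∀ w ∈ language F, w.length = l → Φ w ≤ l * P - 1 := by
    intro w hw hwl
    have h1 := hCK w hw (by omega)
    rw [hwl] at h1
    have h2 := h.weightSum_good_le hΦ hP l
    have h3 : C * Real.exp V * Real.exp 1 * Real.exp (Φ w) ≤ C * (Real.exp V * Real.exp (l * P)) := by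
      refine le_trans ?_ (h1.trans (mul_le_mul_of_nonneg_left h2 hC.le))
      exact mul_le_mul_of_nonneg_right (by linarith) (Real.exp_pos _).le
    have h4 : Real.exp (1 + Φ w) ≤ Real.exp (l * P) := by
      rw [Real.exp_add]
      have : 0 < C * Real.exp V := by positivity
      refine le_of_mul_le_mul_left ?_ this
      linarith
    have := Real.exp_le_exp.1 h4
    linarith
  have main : ∀ k : ℕ, ∀ w ∈ language F, ∀ r, w.length = k * l + r → r < l →
      Φ w ≤ k * (l * P - 1) + B * l := by
    intro k
    induction k with
    | zero =>
      intro w hw r hr hrl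
      have h1 := (abs_le.1 (hΦ.abs_le w hw)).2
      have h2 : (w.length : ℝ) ≤ l := by rw [hr]; exact_mod_cast (by omega)
      have := mul_le_mul_of_nonneg_left h2 hΦ.B_nonneg
      simp only [Nat.cast_zero, zero_mul, zero_add]
      linarith
    | succ k ih =>
      intro w hw r hr hrl
      have hlen : l ≤ w.length := by rw [hr, Nat.succ_mul]; omega
      have hw' := hw
      rw [← List.take_append_drop l w] at hw'
      have h1 := block _ (h.left_mem_language hw') (by rw [List.length_take]; omega)
      have h2 := ih _ (h.right_mem_language hw') r
        (by rw [List.length_drop, hr, Nat.succ_mul]; omega) hrl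
      have h3 := hΦ.append_le _ _ hw'
      rw [List.take_append_drop] at h3
      push_cast
      linarith
  -- A loss of `1` per `l` letters gives `ε = 1/l`; the constant pays for the incomplete last block.
  refine ⟨1 / l, by positivity, B * l + l * |P - 1 / l|, by have := hΦ.B_nonneg; positivity,
    fun w hw => ?_⟩
  have hlpos : 0 < l := by exact_mod_cast hl0
  have h1 := main (w.length / l) w hw (w.length % l) (by rw [mul_comm]; exact (Nat.div_add_mod _ _).symm)
    (Nat.mod_lt _ hlpos)
  have h2 : (w.length : ℝ) = l * (w.length / l : ℕ) + (w.length % l : ℕ) := by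
    exact_mod_cast (Nat.div_add_mod w.length l).symm
  have h3 : ((w.length % l : ℕ) : ℝ) ≤ l := by exact_mod_cast (Nat.mod_lt _ hlpos).le
  have h4 : ((w.length / l : ℕ) : ℝ) * (l * P - 1) =
      l * (w.length / l : ℕ) * (P - 1 / l) := by field_simp
  have h5 : -(((w.length % l : ℕ) : ℝ) * (P - 1 / l)) ≤ l * |P - 1 / l| := by
    have h6 := neg_abs_le (P - 1 / l)
    have h7 : (0 : ℝ) ≤ (w.length % l : ℕ) := Nat.cast_nonneg _
    have h8 := abs_nonneg (P - 1 / (l : ℝ))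
    nlinarith
  rw [h4] at h1
  calc Φ w ≤ _ := h1
    _ = (w.length : ℝ) * (P - 1 / l) - (w.length % l : ℕ) * (P - 1 / l) + B * l := by
        rw [h2]; ring
    _ ≤ _ := by linarith

end IsExpanding

end FTransformation

/-! ### Weight sums sorted by terminal vertex. -/

namespace FTransformation

open MeasureTheory Filter Topology

/-- The words labelling a path from the base vertex to some vertex of index at least `M`. -/
def highWords {F : ℝ → ℝ} (m : ℕ → Letter F) (M : ℕ) : Set (List (Letter F)) :=
  {w | ∃ j, M ≤ j ∧ GraphPath m 0 w j}

namespace IsExpanding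

variable {F : ℝ → ℝ} {α : ℝ} (h : IsExpanding F α)

include h

theorem language_eq_highWords : language F = highWords h.maxWord 0 := by
  ext w
  rw [h.mem_language_iff]
  exact ⟨fun ⟨j, hj⟩ => ⟨j, Nat.zero_le _, hj⟩, fun ⟨j, _, hj⟩ => ⟨j, hj⟩⟩

variable {Φ : List (Letter F) → ℝ} {V B : ℝ} (hΦ : IsAlmostAdditive F Φ V B)

include hΦ

/-- A word that ends at vertex `j` is a closed word followed by the initial word of `m` of length
`j`, so its closed part determines it. -/
theorem weightSum_vertex_le {n j : ℕ} (hj : j ≤ n) :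
    weightSum Φ {w | GraphPath h.maxWord 0 w j} n ≤
      weightSum Φ (goodCore h.maxWord) (n - j) * Real.exp (Φ (initWord h.maxWord j)) := by
  classical
  unfold weightSum
  rw [Finset.sum_mul]
  have key : ∀ w ∈ (words F n).filter (· ∈ {w | GraphPath h.maxWord 0 w j}),
      ∃ u, w = u ++ initWord h.maxWord j ∧ GraphPath h.maxWord 0 u 0 ∧ w.take (n - j) = u ∧
        u.length = n - j := by
    intro w hw
    simp only [Finset.mem_filter, mem_words, Set.mem_ofPred_eq] at hw
    obtain ⟨u, hu, hp⟩ := h.path_zero_decomp hw.2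
    have hl := congrArg List.length hu
    rw [List.length_append, List.length_ofFn] at hl
    exact ⟨u, hu, hp, by rw [hu]; exact List.take_left' (by omega), by omega⟩
  refine sum_le_sum_of_injOn (fun w => w.take (n - j)) ?_ ?_ ?_ fun _ _ => by positivity
  · intro w hw w' hw' e
    obtain ⟨u, h1, -, h2, -⟩ := key w hw
    obtain ⟨u', h1', -, h2', -⟩ := key w' hw'
    simp only [h2, h2'] at e
    rw [h1, h1', e]
  · intro w hw
    obtain ⟨u, -, h1, h2, h3⟩ := key w hw
    simp only [h2]
    exact Finset.mem_filter.2 ⟨mem_words.2 h3, h1⟩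
  · intro w hw
    obtain ⟨u, h1, -, h2, -⟩ := key w hw
    simp only [h2]
    rw [← Real.exp_add]
    have h3 : w ∈ language F := h.mem_language_of_path (Finset.mem_filter.1 hw).2
    rw [h1] at h3 ⊢
    exact Real.exp_le_exp.2 (hΦ.append_le _ _ h3)

theorem weightSum_high_le_sum (n M : ℕ) :
    weightSum Φ (highWords h.maxWord M) n ≤
      ∑ j ∈ Finset.Icc M n, weightSum Φ {w | GraphPath h.maxWord 0 w j} n := by
  classical
  unfold weightSum
  simp only [Finset.sum_filter]
  rw [Finset.sum_comm]
  refine Finset.sum_le_sum fun w hw => ?_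
  split_ifs with hwM
  · obtain ⟨j, hj, hp⟩ := hwM
    have hjn : j ≤ n := by
      have := hp.le_length
      rw [mem_words.1 hw] at this; omega
    refine le_trans ?_ (Finset.single_le_sum (f := fun j => if w ∈ {w | GraphPath h.maxWord 0 w j}
      then Real.exp (Φ w) else 0) (fun j _ => by positivity) (Finset.mem_Icc.2 ⟨hj, hjn⟩))
    simp [hp]
  · exact Finset.sum_nonneg fun j _ => by positivity

variable {P : ℝ} (hP : Tendsto (fun n : ℕ => Real.log (weightSum Φ (language F) n) / n) atTop (𝓝 P))

include hP

/-- The core contributes `exp((n - j)P)` and, by the gap, the single suffix of length `j`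
contributes `exp(j(P - ε))`. The sum over `j ≥ M` is geometric. -/
theorem exists_weightSum_high_le : ∃ ε > 0, ∃ C > 0, ∀ M n : ℕ,
    weightSum Φ (highWords h.maxWord M) n ≤ C * Real.exp (n * P) * Real.exp (-(ε * M)) := by
  obtain ⟨ε, hε, C, hC, hgap⟩ := h.exists_pressure_gap hΦ hP
  set r := Real.exp (-ε) with hr
  have hr0 : 0 < r := Real.exp_pos _
  have hr1 : r < 1 := (Real.exp_lt_exp.2 (by linarith)).trans_eq Real.exp_zero
  refine ⟨ε, hε, Real.exp V * Real.exp C * (1 - r)⁻¹,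
    mul_pos (by positivity) (inv_pos.2 (by linarith)), fun M n => ?_⟩
  have hterm : ∀ j ∈ Finset.Icc M n, weightSum Φ {w | GraphPath h.maxWord 0 w j} n ≤
      Real.exp V * Real.exp C * Real.exp (n * P) * r ^ j := by
    intro j hj
    have hjn := (Finset.mem_Icc.1 hj).2
    refine (h.weightSum_vertex_le hΦ hjn).trans ?_
    have h1 := h.weightSum_good_le hΦ hP (n - j)
    have h2 := hgap _ (h.mem_language_of_path (h.path_initWord j))
    rw [length_initWord] at h2
    refine (mul_le_mul h1 (Real.exp_le_exp.2 h2) (Real.exp_pos _).le (by positivity)).trans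
      (le_of_eq ?_)
    rw [hr, ← Real.exp_nat_mul]
    simp only [← Real.exp_add]
    congr 1
    rw [Nat.cast_sub hjn]
    ring
  have hgeom : ∑ j ∈ Finset.Icc M n, r ^ j ≤ r ^ M * (1 - r)⁻¹ := by
    have h1 : ∑ j ∈ Finset.Icc M n, r ^ j ≤ ∑ i ∈ Finset.range (n + 1), r ^ M * r ^ i := by
      refine sum_le_sum_of_injOn (fun j => j - M) ?_ ?_ ?_ fun _ _ => by positivity
      · intro a ha b hb e
        have := (Finset.mem_Icc.1 ha).1
        have := (Finset.mem_Icc.1 hb).1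
        simp only at e; omega
      · intro a ha
        have := Finset.mem_Icc.1 ha
        exact Finset.mem_range.2 (by omega)
      · intro a ha
        rw [← pow_add, Nat.add_sub_cancel' (Finset.mem_Icc.1 ha).1]
    rw [← Finset.mul_sum] at h1
    refine h1.trans (mul_le_mul_of_nonneg_left ?_ (by positivity))
    rw [← tsum_geometric_of_lt_one hr0.le hr1]
    exact (summable_geometric_of_lt_one hr0.le hr1).sum_le_tsum _ fun _ _ => by positivity
  refine (h.weightSum_high_le_sum hΦ n M).trans ((Finset.sum_le_sum hterm).trans ?_)
  rw [← Finset.mul_sum]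
  refine (mul_le_mul_of_nonneg_left hgeom (by positivity)).trans (le_of_eq ?_)
  rw [show r ^ M = Real.exp (-(ε * M)) by rw [hr, ← Real.exp_nat_mul]; congr 1; ring]
  ring

theorem exists_weightSum_language_le : ∃ C > 0, ∀ n : ℕ,
    weightSum Φ (language F) n ≤ C * Real.exp (n * P) := by
  obtain ⟨ε, -, C, hC, hb⟩ := h.exists_weightSum_high_le hΦ hP
  refine ⟨C, hC, fun n => ?_⟩
  rw [h.language_eq_highWords]
  simpa using hb 0 n

/-- Vertices below a fixed `M` carry at least half of `exp(nP)`. For the corresponding words the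
suffix has length below `M`, and exchanging it for closed words of the same length costs a bounded
factor. -/
theorem exists_le_weightSum_good
    (hP' : ∀ n : ℕ, Real.exp (n * P) ≤ weightSum Φ (language F) n) : ∃ c > 0, ∀ n : ℕ,
    c * Real.exp (n * P) ≤ weightSum Φ (goodCore h.maxWord) n := by
  obtain ⟨ε, hε, C, hC, hb⟩ := h.exists_weightSum_high_le hΦ hP
  obtain ⟨M, hM⟩ : ∃ M : ℕ, C * Real.exp (-(ε * M)) ≤ 1 / 2 := by
    have : Tendsto (fun M : ℕ => C * Real.exp (-(ε * M))) atTop (𝓝 (C * 0)) :=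
      (Real.tendsto_exp_neg_atTop_nhds_zero.comp
        (tendsto_natCast_atTop_atTop.const_mul_atTop hε)).const_mul C
    rw [mul_zero] at this
    exact (this.eventually_le_const (by norm_num)).exists
  refine ⟨((M + 1) * (2 * Real.exp V * Real.exp (2 * (B * M))))⁻¹, by positivity, fun n => ?_⟩
  have hB := hΦ.B_nonneg
  have hlow : weightSum Φ (language F) n ≤ weightSum Φ (highWords h.maxWord M) n +
      ∑ j ∈ Finset.range (min M (n + 1)), weightSum Φ {w | GraphPath h.maxWord 0 w j} n := by
    classical
    unfold weightSum
    simp only [Finset.sum_filter]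
    rw [Finset.sum_comm, ← Finset.sum_add_distrib]
    refine Finset.sum_le_sum fun w hw => ?_
    have nn : ∀ j ∈ Finset.range (min M (n + 1)),
        0 ≤ (if w ∈ {w | GraphPath h.maxWord 0 w j} then Real.exp (Φ w) else 0) :=
      fun j _ => by positivity
    have nn' := Finset.sum_nonneg nn
    have nn'' : 0 ≤ if w ∈ highWords h.maxWord M then Real.exp (Φ w) else 0 := by positivity
    by_cases h1 : w ∈ language F
    · rw [if_pos h1]
      obtain ⟨j, hj⟩ := h.mem_language_iff.1 h1
      by_cases hjM : M ≤ j
      · rw [if_pos (show w ∈ highWords h.maxWord M from ⟨j, hjM, hj⟩)]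
        linarith
      · have hjn : j ≤ n := by
          have := hj.le_length
          rw [mem_words.1 hw] at this; omega
        have := Finset.single_le_sum nn
          (Finset.mem_range.2 (lt_min (not_le.1 hjM) (by omega : j < n + 1)))
        rw [if_pos (show w ∈ {w | GraphPath h.maxWord 0 w j} from hj)] at this
        linarith
    · rw [if_neg h1]
      linarith
  have hsmall : ∀ j ∈ Finset.range (min M (n + 1)),
      weightSum Φ {w | GraphPath h.maxWord 0 w j} n ≤
        Real.exp V * Real.exp (2 * (B * M)) * weightSum Φ (goodCore h.maxWord) n := by
    intro j hj
    have hj' := lt_min_iff.1 (Finset.mem_range.1 hj)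
    have hjn : j ≤ n := by omega
    have hjM : (j : ℝ) ≤ M := by exact_mod_cast hj'.1.le
    have hBj : B * j ≤ B * M := mul_le_mul_of_nonneg_left hjM hB
    refine (h.weightSum_vertex_le hΦ hjn).trans ?_
    have h1 := h.weightSum_good_mul_le hΦ (n - j) j
    rw [Nat.sub_add_cancel hjn] at h1
    have h2 := h.exp_le_weightSum_good hΦ j
    have h3 := (abs_le.1 (hΦ.abs_le _ (h.mem_language_of_path (h.path_initWord j)))).2
    rw [length_initWord] at h3
    set Z := weightSum Φ (goodCore h.maxWord) (n - j)
    have hZ : 0 ≤ Z := weightSum_nonneg _ _ _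
    calc Z * Real.exp (Φ (initWord h.maxWord j))
        ≤ Z * Real.exp (B * M) :=
          mul_le_mul_of_nonneg_left (Real.exp_le_exp.2 (h3.trans hBj)) hZ
      _ = Z * Real.exp (-(B * M)) * Real.exp (2 * (B * M)) := by
          rw [mul_assoc, ← Real.exp_add]; ring_nf
      _ ≤ Z * weightSum Φ (goodCore h.maxWord) j * Real.exp (2 * (B * M)) := by
          gcongr
          exact (Real.exp_le_exp.2 (by linarith)).trans h2
      _ ≤ Real.exp V * weightSum Φ (goodCore h.maxWord) n * Real.exp (2 * (B * M)) := by
          gcongr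
      _ = _ := by ring
  have hsum := Finset.sum_le_sum hsmall
  rw [Finset.sum_const, Finset.card_range, nsmul_eq_mul] at hsum
  have hZ := weightSum_nonneg Φ (goodCore h.maxWord) n
  have hcard : ((min M (n + 1) : ℕ) : ℝ) ≤ M + 1 := by
    have : min M (n + 1) ≤ M + 1 := (min_le_left _ _).trans (Nat.le_succ _)
    exact_mod_cast this
  have h1 := hb M n
  have h2 : C * Real.exp (n * P) * Real.exp (-(ε * M)) ≤ 1 / 2 * Real.exp (n * P) := by
    have := mul_le_mul_of_nonneg_right hM (Real.exp_pos (n * P)).le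
    linarith
  have h3 : ((min M (n + 1) : ℕ) : ℝ) *
      (Real.exp V * Real.exp (2 * (B * M)) * weightSum Φ (goodCore h.maxWord) n) ≤
      (M + 1) * (Real.exp V * Real.exp (2 * (B * M)) * weightSum Φ (goodCore h.maxWord) n) :=
    mul_le_mul_of_nonneg_right hcard (by positivity)
  rw [inv_mul_le_iff₀ (by positivity)]
  have := hP' n
  linarith

end IsExpanding

end FTransformation

/-! ### Bowen potentials and the weights they induce. -/

namespace FTransformation

open MeasureTheory Filter Topology ErgodicEntropy

/-- Bounded measurable potentials whose Birkhoff sums vary by at most `V` on cylinders. -/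
structure IsBowenPotential (F φ : ℝ → ℝ) (V B : ℝ) : Prop where
  V_nonneg : 0 ≤ V
  B_nonneg : 0 ≤ B
  measurable : Measurable fun x : Phase => φ x
  abs_le : ∀ x : Phase, |φ x| ≤ B
  bowen : ∀ w ∈ language F, ∀ x ∈ cylinder F w, ∀ y ∈ cylinder F w,
    |birkhoff F φ w.length x - birkhoff F φ w.length y| ≤ V

theorem birkhoff_add (F φ : ℝ → ℝ) (n k : ℕ) (x : Phase) :
    birkhoff F φ (n + k) x = birkhoff F φ n x + birkhoff F φ k ((map F)^[n] x) := by
  simp only [birkhoff, Finset.sum_range_add, ← Function.iterate_add_apply, add_comm]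

theorem mem_cylinder_append {F : ℝ → ℝ} {u v : List (Letter F)} {x : Phase}
    (hx : x ∈ cylinder F (u ++ v)) :
    x ∈ cylinder F u ∧ (map F)^[u.length] x ∈ cylinder F v := by
  constructor
  · intro k
    have := hx ⟨k, by rw [List.length_append]; omega⟩
    simpa [List.getElem_append_left k.2] using this
  · intro k
    have := hx ⟨u.length + k, by rw [List.length_append]; omega⟩
    rw [← Function.iterate_add_apply, add_comm (k : ℕ)]
    simpa using this

namespace IsExpanding

variable {F : ℝ → ℝ} {α : ℝ} (h : IsExpanding F α)

include h

/-- The open cylinders along the itinerary lie within `α⁻ⁿ` of `x`, and generic points just to the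
right of `x` keep `x` in their closures. -/
theorem factorMap_code (x : Phase) : factorMap F (h.code x) = x := by
  have key : (⋂ n : ℕ, closure (Subtype.val '' {y : Phase | ∀ k < n,
      (((map F)^[k] y : Phase) : ℝ) ∈ branch F (h.code x k)})) = {(x : ℝ)} := by
    refine Set.Subset.antisymm (fun t ht => ?_) (Set.singleton_subset_iff.2 ?_)
    · have hb : ∀ n : ℕ, |t - x| ≤ α⁻¹ ^ n := by
        intro n
        have hsub : closure (Subtype.val '' {y : Phase | ∀ k < n,
            (((map F)^[k] y : Phase) : ℝ) ∈ branch F (h.code x k)}) ⊆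
            Metric.closedBall (x : ℝ) (α⁻¹ ^ n) := by
          refine closure_minimal ?_ Metric.isClosed_closedBall
          rintro _ ⟨y, hy, rfl⟩
          rw [Metric.mem_closedBall, Real.dist_eq]
          refine h.dist_le_of_itin_eq ?_
          rw [h.itin_eq_ofFn, h.itin_eq_ofFn]
          congr 1
          funext i
          exact h.digit_eq_of_mem_branch (hy i i.2)
        have := hsub (Set.mem_iInter.1 ht n)
        rwa [Metric.mem_closedBall, Real.dist_eq] at this
      have h0 : Tendsto (fun n : ℕ => α⁻¹ ^ n) atTop (𝓝 0) :=
        tendsto_pow_atTop_nhds_zero_of_lt_one (inv_nonneg.2 (by linarith [h.one_lt]))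
          (inv_lt_one_of_one_lt₀ h.one_lt)
      have := ge_of_tendsto' h0 hb
      rw [Set.mem_singleton_iff]
      exact sub_eq_zero.1 (abs_eq_zero.1 (le_antisymm this (abs_nonneg _)))
    · refine Set.mem_iInter.2 fun n => Metric.mem_closure_iff.2 fun ε hε => ?_
      obtain ⟨y, hxy, hyε, e⟩ := h.exists_gt_itin_eq n x hε
      obtain ⟨z, hxz, hzy, hz⟩ := h.exists_generic hxy
      have ez := h.itin_eq_of_mem_Icc e.symm hxz.le hzy.le
      refine ⟨z, ⟨z, fun k hk => ?_, rfl⟩, ?_⟩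
      · have hd : h.digit ((map F)^[k] z) = h.code x k := by
          rw [h.itin_eq_ofFn, h.itin_eq_ofFn] at ez
          exact congrFun (List.ofFn_injective ez) ⟨k, hk⟩
        rw [← hd]
        refine h.mem_branch_digit (hz k) ?_
        rw [← Function.iterate_succ_apply' (map F) k z]; exact hz _
      · have h1 : (x : ℝ) < z := hxz
        have h2 : (z : ℝ) < y := hzy
        rw [Real.dist_eq, abs_sub_comm, abs_of_pos (by linarith)]
        linarith
  rw [factorMap, key, csSup_singleton]

/-- On the phase space `φ` is the continuous function `φ ∘ π` composed with the measurable coding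
map. -/
theorem measurable_potential {φ : ℝ → ℝ} (hφ : ContinuousPotential F φ) :
    Measurable fun x : Phase => φ x := by
  have hc : Measurable ((shiftSpace F).domRestrict fun s => φ (factorMap F s)) :=
    (continuousOn_iff_continuous_domRestrict.1 hφ).measurable
  have hcode : Measurable h.code :=
    measurable_pi_lambda _ fun k => h.measurable_digit.comp (h.measurable_map.iterate k)
  have := hc.comp (hcode.subtype_mk (h := h.code_mem_shiftSpace))
  convert this using 1
  funext x
  exact (congrArg φ (h.factorMap_code x)).symm

/-- Boundedness of `φ` is the Bowen property for one-letter words, of which there are finitely many.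
-/
theorem exists_isBowenPotential {φ : ℝ → ℝ} (hφ : ContinuousPotential F φ)
    (hB : BowenProperty F φ) : ∃ V B, IsBowenPotential F φ V B := by
  obtain ⟨V, hV⟩ := hB
  have hbd : ∃ B, ∀ x : Phase, |φ x| ≤ B := by
    have hx : ∀ a : Letter F, ∃ b, ∀ x : Phase, h.digit x = a → |φ x| ≤ b := by
      intro a
      by_cases ha : ∃ y, h.digit y = a
      · obtain ⟨y, hy⟩ := ha
        refine ⟨V + |φ y|, fun x hx => ?_⟩
        have mem : ∀ z, h.digit z = a → z ∈ cylinder F [a] := fun z hz =>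
          h.halfCylinder_subset_cylinder [a] (by simp [halfCylinder, itin, hz])
        have hl : [a] ∈ language F := by
          have := h.itin_mem_language 1 y
          simpa [itin, hy] using this
        have := hV [a] hl x (mem x hx) y (mem y hy)
        simp only [birkhoff, List.length_singleton, Finset.range_one, Finset.sum_singleton,
          Function.iterate_zero, id] at this
        have h2 := abs_sub_abs_le_abs_sub (φ x) (φ y)
        linarith
      · exact ⟨0, fun x hx => absurd ⟨x, hx⟩ ha⟩
    choose b hb using hx
    refine ⟨∑ a, |b a|, fun x => (hb _ x rfl).trans ((le_abs_self _).trans ?_)⟩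
    exact Finset.single_le_sum (f := fun a => |b a|) (fun _ _ => abs_nonneg _)
      (Finset.mem_univ _)
  obtain ⟨B, hB⟩ := hbd
  exact ⟨|V|, B, abs_nonneg V, (abs_nonneg _).trans (hB ⟨0, by simp⟩), h.measurable_potential hφ,
    hB, fun w hw x hx y hy => (hV w hw x hx y hy).trans (le_abs_self V)⟩

end IsExpanding

namespace IsBowenPotential

variable {F φ : ℝ → ℝ} {V B : ℝ} (hφ : IsBowenPotential F φ V B)

include hφ

theorem abs_birkhoff_le (n : ℕ) (x : Phase) : |birkhoff F φ n x| ≤ B * n := by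
  refine (Finset.abs_sum_le_sum_abs _ _).trans ((Finset.sum_le_sum fun k _ => hφ.abs_le _).trans ?_)
  simp [mul_comm]

theorem birkhoff_le_wordSup {w : List (Letter F)} {x : Phase} (hx : x ∈ cylinder F w) :
    birkhoff F φ w.length x ≤ wordSup F φ w := by
  refine le_csSup ⟨B * w.length, ?_⟩ ⟨x, hx, rfl⟩
  rintro _ ⟨y, -, rfl⟩
  exact (_root_.abs_le.1 (hφ.abs_birkhoff_le _ y)).2

theorem wordSup_le_birkhoff_add {w : List (Letter F)} (hw : w ∈ language F) {x : Phase}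
    (hx : x ∈ cylinder F w) : wordSup F φ w ≤ birkhoff F φ w.length x + V := by
  refine csSup_le ⟨_, x, hx, rfl⟩ ?_
  rintro _ ⟨y, hy, rfl⟩
  linarith [(_root_.abs_le.1 (hφ.bowen w hw y hy x hx)).2]

/-- At a common point, each of the two suprema exceeds its Birkhoff sum by at most `V`, hence the
constant `2V`. -/
theorem isAlmostAdditive {α : ℝ} (h : IsExpanding F α) :
    IsAlmostAdditive F (wordSup F φ) (2 * V) B where
  V_nonneg := by linarith [hφ.V_nonneg]
  B_nonneg := hφ.B_nonneg
  append_le u v hw := by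
    obtain ⟨x, hx⟩ := h.halfCylinder_nonempty_of_mem hw
    refine csSup_le ⟨_, x, h.halfCylinder_subset_cylinder _ hx, rfl⟩ ?_
    rintro _ ⟨y, hy, rfl⟩
    have := mem_cylinder_append hy
    rw [List.length_append, birkhoff_add]
    exact add_le_add (hφ.birkhoff_le_wordSup this.1) (hφ.birkhoff_le_wordSup this.2)
  le_append u v hw := by
    obtain ⟨x, hx⟩ := h.halfCylinder_nonempty_of_mem hw
    have hx' := h.halfCylinder_subset_cylinder _ hx
    have h1 := mem_cylinder_append hx'
    have h2 := hφ.birkhoff_le_wordSup hx'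
    rw [List.length_append, birkhoff_add] at h2
    have h3 := hφ.wordSup_le_birkhoff_add (h.left_mem_language hw) h1.1
    have h4 := hφ.wordSup_le_birkhoff_add (h.right_mem_language hw) h1.2
    linarith
  abs_le w hw := by
    obtain ⟨x, hx⟩ := h.halfCylinder_nonempty_of_mem hw
    have hx' := h.halfCylinder_subset_cylinder _ hx
    rw [_root_.abs_le]
    constructor
    · exact (_root_.abs_le.1 (hφ.abs_birkhoff_le w.length x)).1.trans (hφ.birkhoff_le_wordSup hx')
    · refine csSup_le ⟨_, x, hx', rfl⟩ ?_
      rintro _ ⟨y, -, rfl⟩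
      exact (_root_.abs_le.1 (hφ.abs_birkhoff_le _ y)).2

theorem measurable_birkhoff (hm : Measurable (map F)) (n : ℕ) :
    Measurable (birkhoff F φ n) :=
  Finset.measurable_fun_sum _ fun k _ => hφ.measurable.comp (hm.iterate k)

theorem integrable_birkhoff (hm : Measurable (map F)) (ν : Measure Phase)
    [IsProbabilityMeasure ν] (n : ℕ) : Integrable (birkhoff F φ n) ν :=
  Integrable.of_bound (hφ.measurable_birkhoff hm n).aestronglyMeasurable (B * n)
    (Eventually.of_forall fun x => by rw [Real.norm_eq_abs]; exact hφ.abs_birkhoff_le n x)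

theorem integral_birkhoff {ν : Measure Phase} [IsProbabilityMeasure ν]
    (hν : MeasurePreserving (map F) ν ν) (n : ℕ) :
    ∫ x, birkhoff F φ n x ∂ν = n * ∫ x : Phase, φ x ∂ν := by
  have hc : ∀ k, ∫ x, φ ((map F)^[k] x : Phase) ∂ν = ∫ x : Phase, φ x ∂ν := fun k => by
    have hk := hν.iterate k
    conv_rhs => rw [← hk.map_eq]
    rw [integral_map hk.measurable.aemeasurable hφ.measurable.aestronglyMeasurable]
  have hi : ∀ k, Integrable (fun x => φ ((map F)^[k] x : Phase)) ν := fun k =>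
    Integrable.of_bound (hφ.measurable.comp (hν.iterate k).measurable).aestronglyMeasurable B
      (Eventually.of_forall fun x => by rw [Real.norm_eq_abs]; exact hφ.abs_le _)
  unfold birkhoff
  rw [integral_finsetSum _ fun k _ => hi k]
  simp [hc]

end IsBowenPotential

theorem negMulLog_le_one {s : ℝ} (hs : 0 ≤ s) : Real.negMulLog s ≤ 1 := by
  rcases hs.eq_or_lt with rfl | hs
  · simp
  · have := Real.log_le_sub_one_of_pos (inv_pos.2 hs)
    rw [Real.log_inv] at this
    have h2 := mul_le_mul_of_nonneg_left this hs.le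
    rw [mul_sub, mul_inv_cancel₀ hs.ne'] at h2
    unfold Real.negMulLog
    linarith

/-- The finite variational principle, from `log t ≤ t - 1`. The `p i` need not sum to `1`, so it
applies to any subfamily of cylinders. -/
theorem sum_negMulLog_add_le {ι : Type*} (A : Finset ι) (p Ψ : ι → ℝ) (hp : ∀ i ∈ A, 0 ≤ p i) :
    ∑ i ∈ A, (Real.negMulLog (p i) + p i * Ψ i) ≤
      Real.negMulLog (∑ i ∈ A, p i) + (∑ i ∈ A, p i) * Real.log (∑ i ∈ A, Real.exp (Ψ i)) := by
  rcases A.eq_empty_or_nonempty with rfl | hA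
  · simp
  set s := ∑ i ∈ A, p i with hs
  set W := ∑ i ∈ A, Real.exp (Ψ i) with hW
  have hW0 : 0 < W := Finset.sum_pos (fun _ _ => Real.exp_pos _) hA
  have hs0 : 0 ≤ s := Finset.sum_nonneg hp
  have term : ∀ i ∈ A, Real.negMulLog (p i) + p i * Ψ i ≤
      p i * (Real.log W - Real.log s) + (s / W * Real.exp (Ψ i) - p i) := by
    intro i hi
    rcases (hp i hi).eq_or_lt with h0 | h0
    · rw [← h0]
      simp only [Real.negMulLog_zero, zero_mul, zero_add, sub_zero]
      positivity
    · have hs1 : 0 < s := h0.trans_le (Finset.single_le_sum hp hi)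
      have := Real.log_le_sub_one_of_pos (x := s * Real.exp (Ψ i) / (W * p i)) (by positivity)
      rw [Real.log_div (by positivity) (by positivity), Real.log_mul hs1.ne' (Real.exp_pos _).ne',
        Real.log_mul hW0.ne' h0.ne', Real.log_exp] at this
      have h2 := mul_le_mul_of_nonneg_left this h0.le
      have h3 : p i * (s * Real.exp (Ψ i) / (W * p i) - 1) = s / W * Real.exp (Ψ i) - p i := by
        field_simp
      unfold Real.negMulLog
      linarith
  refine (Finset.sum_le_sum term).trans (le_of_eq ?_)
  rw [Finset.sum_add_distrib, Finset.sum_sub_distrib, ← Finset.sum_mul, ← Finset.mul_sum,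
    ← hs, ← hW, div_mul_cancel₀ _ hW0.ne']
  unfold Real.negMulLog
  ring

end FTransformation

/-! ### The variational inequality. -/

namespace FTransformation

open MeasureTheory Filter Topology ErgodicEntropy

namespace IsExpanding

variable {F : ℝ → ℝ} {α : ℝ} (h : IsExpanding F α)

include h

theorem halfCylinder_eq_preimage {w : List (Letter F)} {n : ℕ} (hw : w.length = n) :
    h.halfCylinder w = h.itin n ⁻¹' {w} := by
  subst hw; rfl

open Classical in
theorem sum_real_halfCylinder (ν : Measure Phase) [IsFiniteMeasure ν] (n : ℕ)
    (S : Set (List (Letter F))) :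
    ∑ w ∈ words F n with w ∈ S, ν.real (h.halfCylinder w) = ν.real {x | h.itin n x ∈ S} := by
  rw [Finset.sum_congr rfl fun w hw => by
    rw [h.halfCylinder_eq_preimage (mem_words.1 (Finset.mem_filter.1 hw).1)],
    sum_measureReal_preimage_singleton _ fun w _ => h.measurableSet_itin n {w}]
  congr 1
  ext x
  simp

theorem sum_real_halfCylinder_eq_one (ν : Measure Phase) [IsProbabilityMeasure ν] (n : ℕ) :
    ∑ w ∈ words F n, ν.real (h.halfCylinder w) = 1 := by
  classical
  have := h.sum_real_halfCylinder ν n Set.univ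
  simpa using this

theorem joinEntropy_eq_sum (ν : Measure Phase) (n : ℕ) :
    joinEntropy ν (map F) h.digit n =
      ∑ w ∈ words F n, Real.negMulLog (ν.real (h.halfCylinder w)) := by
  refine Finset.sum_nbij List.ofFn (fun v _ => by simp) List.ofFn_injective.injOn ?_ ?_
  · intro w hw
    have hw' : w.length = n := mem_words.1 hw
    subst hw'
    exact ⟨w.get, by simp, List.ofFn_get w⟩
  · intro v _
    congr 2
    ext x
    rw [h.halfCylinder_eq_preimage (n := n) (by simp)]
    simp only [Set.mem_ofPred_eq, Set.mem_preimage, Set.mem_singleton_iff, itin_eq_ofFn]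
    rw [List.ofFn_inj]
    exact ⟨fun e => funext e, fun e => congrFun e⟩

theorem real_halfCylinder_eq_zero (ν : Measure Phase) {w : List (Letter F)}
    (hw : w ∉ language F) : ν.real (h.halfCylinder w) = 0 := by
  have : h.halfCylinder w = ∅ := by
    refine Set.eq_empty_of_forall_notMem fun x hx => hw ?_
    have hx' : h.itin w.length x = w := hx
    exact hx' ▸ h.itin_mem_language _ _
  simp [this]

theorem integral_itin (ν : Measure Phase) [IsProbabilityMeasure ν] (Φ : List (Letter F) → ℝ)
    (n : ℕ) : Integrable (fun x => Φ (h.itin n x)) ν ∧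
      ∫ x, Φ (h.itin n x) ∂ν = ∑ w ∈ words F n, ν.real (h.halfCylinder w) * Φ w := by
  classical
  have e : (fun x => Φ (h.itin n x)) =
      fun x => ∑ w ∈ words F n, (h.halfCylinder w).indicator (fun _ => Φ w) x := by
    funext x
    rw [Finset.sum_eq_single (h.itin n x)]
    · rw [Set.indicator_of_mem]
      simp [halfCylinder]
    · intro w hw hne
      refine Set.indicator_of_notMem (fun hx => hne ?_) _
      have hx' : h.itin w.length x = w := hx
      rw [mem_words.1 hw] at hx'
      exact hx'.symm
    · simp
  have hi : ∀ w ∈ words F n, Integrable ((h.halfCylinder w).indicator fun _ => Φ w) ν :=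
    fun w _ => (integrable_const _).indicator (h.measurableSet_halfCylinder w)
  rw [e]
  refine ⟨integrable_finsetSum _ hi, ?_⟩
  rw [integral_finsetSum _ hi]
  refine Finset.sum_congr rfl fun w _ => ?_
  rw [integral_indicator_const _ (h.measurableSet_halfCylinder w), smul_eq_mul]

theorem exists_code_approx (ν : Measure Phase) [IsFiniteMeasure ν] (A : Set Phase)
    (hA : MeasurableSet A) (ε : ℝ) (hε : ε > 0) :
    ∃ (l : ℕ) (S : Set (Fin l → Letter F)),
      ν.real (symmDiff A {x | (fun j : Fin l => h.digit ((map F)^[(j : ℕ)] x)) ∈ S}) < ε := by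
  obtain ⟨n, S, hS⟩ := h.exists_itin_approx ν hA hε
  refine ⟨n, {v | List.ofFn v ∈ S}, ?_⟩
  simpa [itin_eq_ofFn] using hS

variable {φ : ℝ → ℝ} {V B : ℝ} (hφ : IsBowenPotential F φ V B)

include hφ

theorem le_sum_wordSup {ν : Measure Phase} [IsProbabilityMeasure ν]
    (hν : MeasurePreserving (map F) ν ν) (n : ℕ) :
    n * ∫ x : Phase, φ x ∂ν ≤ ∑ w ∈ words F n, ν.real (h.halfCylinder w) * wordSup F φ w := by
  rw [← hφ.integral_birkhoff hν, ← (h.integral_itin ν _ n).2]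
  refine integral_mono (hφ.integrable_birkhoff h.measurable_map ν n) (h.integral_itin ν _ n).1
    fun x => ?_
  have hx : x ∈ cylinder F (h.itin n x) := h.halfCylinder_subset_cylinder _ (by simp [halfCylinder])
  simpa using hφ.birkhoff_le_wordSup hx

theorem sum_wordSup_le {ν : Measure Phase} [IsProbabilityMeasure ν]
    (hν : MeasurePreserving (map F) ν ν) (n : ℕ) :
    ∑ w ∈ words F n, ν.real (h.halfCylinder w) * wordSup F φ w ≤ n * ∫ x : Phase, φ x ∂ν + V := by
  have hi := hφ.integrable_birkhoff h.measurable_map ν n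
  rw [← hφ.integral_birkhoff hν, ← (h.integral_itin ν _ n).2]
  have : ∫ x, (birkhoff F φ n x + V) ∂ν = ∫ x, birkhoff F φ n x ∂ν + V := by
    rw [integral_add hi (integrable_const _)]; simp
  rw [← this]
  refine integral_mono (h.integral_itin ν _ n).1 (hi.add (integrable_const _)) fun x => ?_
  have hx : x ∈ cylinder F (h.itin n x) := h.halfCylinder_subset_cylinder _ (by simp [halfCylinder])
  simpa using hφ.wordSup_le_birkhoff_add (h.itin_mem_language n x) hx

theorem joinEntropy_add_le_log {ν : Measure Phase} [IsProbabilityMeasure ν]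
    (hν : MeasurePreserving (map F) ν ν) (n : ℕ) :
    joinEntropy ν (map F) h.digit n + n * ∫ x : Phase, φ x ∂ν ≤
      Real.log (weightSum (wordSup F φ) (language F) n) := by
  classical
  have h1 := h.le_sum_wordSup hφ hν n
  have h2 := sum_negMulLog_add_le ((words F n).filter (· ∈ language F))
    (fun w => ν.real (h.halfCylinder w)) (wordSup F φ) fun _ _ => measureReal_nonneg
  have h3 : ∑ w ∈ words F n with w ∈ language F, ν.real (h.halfCylinder w) = 1 := by
    rw [h.sum_real_halfCylinder]
    simp [h.itin_mem_language]
  rw [h3, Real.negMulLog_one, zero_add, one_mul] at h2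
  rw [h.joinEntropy_eq_sum]
  have h4 : ∑ w ∈ words F n with w ∈ language F, (Real.negMulLog (ν.real (h.halfCylinder w)) +
      ν.real (h.halfCylinder w) * wordSup F φ w) = ∑ w ∈ words F n,
      (Real.negMulLog (ν.real (h.halfCylinder w)) +
        ν.real (h.halfCylinder w) * wordSup F φ w) := by
    rw [Finset.sum_filter]
    refine Finset.sum_congr rfl fun w _ => ?_
    split_ifs with hw
    · rfl
    · simp [h.real_halfCylinder_eq_zero ν hw]
  rw [h4, Finset.sum_add_distrib] at h2
  have h5 : weightSum (wordSup F φ) (language F) n =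
    ∑ w ∈ words F n with w ∈ language F, Real.exp (wordSup F φ w) := rfl
  rw [h5]
  linarith

variable {P : ℝ}

/-- The variational inequality. -/
theorem entropy_add_integral_le
    (hP : Tendsto (fun n : ℕ => Real.log (weightSum (wordSup F φ) (language F) n) / n)
      atTop (𝓝 P)) {ν : Measure Phase} [IsProbabilityMeasure ν]
    (hν : MeasurePreserving (map F) ν ν) :
    entropy ν (map F) + ((∫ x : Phase, φ x ∂ν : ℝ) : EReal) ≤ (P : EReal) := by
  set I := ∫ x : Phase, φ x ∂ν with hI
  have h1 : ∀ᶠ n : ℕ in atTop, entropy ν (map F) ≤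
      ((Real.log (weightSum (wordSup F φ) (language F) n) / n - I : ℝ) : EReal) := by
    filter_upwards [eventually_gt_atTop 0] with n hn
    have hn' : (0 : ℝ) < n := by exact_mod_cast hn
    refine (entropy_le_joinEntropy_div ν hν h.measurable_digit (h.exists_code_approx ν)
      hn.ne').trans (EReal.coe_le_coe_iff.2 ?_)
    have := h.joinEntropy_add_le_log hφ hν n
    rw [div_sub' hn'.ne', div_le_div_iff_of_pos_right hn']
    linarith
  have h2 : Tendsto (fun n : ℕ =>
      ((Real.log (weightSum (wordSup F φ) (language F) n) / n - I : ℝ) : EReal)) atTop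
      (𝓝 ((P - I : ℝ) : EReal)) :=
    (continuous_coe_real_ereal.tendsto _).comp (hP.sub_const I)
  have h3 := ge_of_tendsto h2 h1
  calc entropy ν (map F) + (I : EReal) ≤ ((P - I : ℝ) : EReal) + (I : EReal) :=
        add_le_add_left h3 _
    _ = P := by rw [← EReal.coe_add]; simp

/-- Entropy is at most `H_n / n` for every `n`, so maximal pressure is visible at each finite level.
This is the form in which maximality is used. -/
theorem le_joinEntropy_of_le {ν : Measure Phase} [IsProbabilityMeasure ν]
    (hν : MeasurePreserving (map F) ν ν)
    (hle : (P : EReal) ≤ entropy ν (map F) + ((∫ x : Phase, φ x ∂ν : ℝ) : EReal)) (n : ℕ) :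
    n * P ≤ joinEntropy ν (map F) h.digit n + n * ∫ x : Phase, φ x ∂ν := by
  rcases n.eq_zero_or_pos with rfl | hn
  · simp only [Nat.cast_zero, zero_mul, add_zero]
    rw [joinEntropy_eq_shannon]
    exact shannon_nonneg ν _
  · have hn' : (0 : ℝ) < n := by exact_mod_cast hn
    have h1 := entropy_le_joinEntropy_div ν hν h.measurable_digit (h.exists_code_approx ν) hn.ne'
    have h2 := hle.trans (add_le_add_left h1 _)
    rw [← EReal.coe_add, EReal.coe_le_coe_iff, div_add' _ _ _ hn'.ne', le_div_iff₀ hn'] at h2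
    linarith

end IsExpanding

end FTransformation

/-! ### Gibbs measures: tails, mixing, maximal pressure. -/

namespace FTransformation

open MeasureTheory Filter Topology ErgodicEntropy

/-- Invariant measures with the Gibbs upper bound on all half-open cylinders, and the Gibbs lower
bound on those of the good core. -/
structure IsGibbs {F : ℝ → ℝ} {α : ℝ} (h : IsExpanding F α) (Φ : List (Letter F) → ℝ) (P : ℝ)
    (μ : Measure Phase) : Prop where
  invariant : MeasurePreserving (map F) μ μ
  null : μ {x | ∃ k, (((map F)^[k] x : Phase) : ℝ) = 0} = 0
  upper : ∃ K > 0, ∀ w ∈ language F,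
    μ.real (h.halfCylinder w) ≤ K * Real.exp (Φ w - w.length * P)
  lower : ∃ c > 0, ∀ w, GraphPath h.maxWord 0 w 0 →
    c * Real.exp (Φ w - w.length * P) ≤ μ.real (h.halfCylinder w)

namespace IsExpanding

variable {F : ℝ → ℝ} {α : ℝ} (h : IsExpanding F α)

include h

theorem exists_uniform_path_zeros (M : ℕ) :
    ∃ N, ∀ j ≤ M, GraphPath h.maxWord j (List.replicate N h.zero') 0 := by
  choose N hN using h.exists_path_zeros
  refine ⟨∑ j ∈ Finset.range (M + 1), (N j + 1), fun j hj => ?_⟩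
  have hle : N j + 1 ≤ ∑ j ∈ Finset.range (M + 1), (N j + 1) :=
    Finset.single_le_sum (f := fun j => N j + 1) (fun _ _ => Nat.zero_le _)
      (Finset.mem_range.2 (by omega))
  obtain ⟨r, hr⟩ := Nat.exists_eq_add_of_le hle
  rw [hr, List.replicate_add]
  exact (hN j).append (h.path_zeros r)

theorem halfCylinder_append_subset (u v : List (Letter F)) :
    h.halfCylinder (u ++ v) ⊆ h.halfCylinder u ∩ (map F)^[u.length] ⁻¹' h.halfCylinder v :=
  fun _ hx => h.itin_append_iff.1 hx

theorem exists_lt_of_mem_highWords_compl {w : List (Letter F)} (hw : w ∈ language F) {M : ℕ}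
    (hM : w ∉ highWords h.maxWord M) : ∃ j ≤ M, GraphPath h.maxWord 0 w j := by
  obtain ⟨j, hj⟩ := h.mem_language_iff.1 hw
  exact ⟨j, le_of_not_ge fun hcon => hM ⟨j, hcon, hj⟩, hj⟩

-- The finite variational principle restricted to one class of words; `negMulLog` of the mass of the
-- class accounts for the `1`.
open Classical in
theorem sum_class_le (Φ : List (Letter F) → ℝ) (P : ℝ) (ν : Measure Phase)
    [IsProbabilityMeasure ν] (n : ℕ) (S : Set (List (Letter F))) {D : ℝ}
    (hD : weightSum Φ (S ∩ language F) n ≤ D * Real.exp (n * P)) :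
    ∑ w ∈ words F n with w ∈ S, (Real.negMulLog (ν.real (h.halfCylinder w)) +
      ν.real (h.halfCylinder w) * (Φ w - n * P)) ≤
      1 + ν.real {x | h.itin n x ∈ S} * Real.log D := by
  obtain ⟨U, hU⟩ : ∃ U, U = S ∩ language F := ⟨_, rfl⟩
  rw [← hU] at hD
  set A := (words F n).filter (· ∈ U) with hA
  have h1 := sum_negMulLog_add_le A (fun w => ν.real (h.halfCylinder w))
    (fun w => Φ w - n * P) fun _ _ => measureReal_nonneg
  have h2 : ∑ w ∈ words F n with w ∈ S, (Real.negMulLog (ν.real (h.halfCylinder w)) +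
      ν.real (h.halfCylinder w) * (Φ w - n * P)) = ∑ w ∈ A,
      (Real.negMulLog (ν.real (h.halfCylinder w)) +
      ν.real (h.halfCylinder w) * (Φ w - n * P)) := by
    refine (Finset.sum_subset (fun w hw => ?_) fun w hw hw' => ?_).symm
    · have := Finset.mem_filter.1 hw
      exact Finset.mem_filter.2 ⟨this.1, (hU ▸ this.2 : w ∈ S ∩ language F).1⟩
    · have hw1 := Finset.mem_filter.1 hw
      have : w ∉ language F := fun hl =>
        hw' (Finset.mem_filter.2 ⟨hw1.1, hU ▸ ⟨hw1.2, hl⟩⟩)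
      simp [h.real_halfCylinder_eq_zero ν this]
  have h3 : ∑ w ∈ A, ν.real (h.halfCylinder w) = ν.real {x | h.itin n x ∈ S} := by
    rw [hA, h.sum_real_halfCylinder, hU]
    simp [h.itin_mem_language]
  rw [h2]
  refine h1.trans ?_
  rw [h3]
  refine add_le_add (negMulLog_le_one measureReal_nonneg) ?_
  rcases A.eq_empty_or_nonempty with he | hne
  · rw [he, Finset.sum_empty] at h3
    simp [← h3]
  · refine mul_le_mul_of_nonneg_left (Real.log_le_log
      (Finset.sum_pos (fun _ _ => Real.exp_pos _) hne) ?_) measureReal_nonneg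
    simp only [Real.exp_sub]
    rw [← Finset.sum_div, div_le_iff₀ (Real.exp_pos _)]
    exact hD

variable {φ : ℝ → ℝ} {V B : ℝ} (hφ : IsBowenPotential F φ V B)

include hφ

/-- At maximal pressure a measure cannot put much mass on a class of words of small total weight:
splitting the entropy over the class and its complement leaves only a bounded defect. -/
theorem two_class_le {P : ℝ} {ν : Measure Phase} [IsProbabilityMeasure ν]
    (hν : MeasurePreserving (map F) ν ν) {n : ℕ}
    (hle : n * P ≤ joinEntropy ν (map F) h.digit n + n * ∫ x : Phase, φ x ∂ν)
    (S : Set (List (Letter F))) {D D' : ℝ}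
    (hD : weightSum (wordSup F φ) (S ∩ language F) n ≤ D * Real.exp (n * P))
    (hD' : weightSum (wordSup F φ) (language F) n ≤ D' * Real.exp (n * P)) :
    0 ≤ 2 + ν.real {x | h.itin n x ∈ S} * Real.log D +
      (1 - ν.real {x | h.itin n x ∈ S}) * Real.log D' := by
  classical
  have h1 := h.sum_class_le (wordSup F φ) P ν n S hD
  have h2 := h.sum_class_le (wordSup F φ) P ν n Sᶜ (D := D')
    ((weightSum_mono _ Set.inter_subset_right n).trans hD')
  have h3 : ν.real {x | h.itin n x ∈ Sᶜ} = 1 - ν.real {x | h.itin n x ∈ S} :=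
    probReal_compl_eq_one_sub (h.measurableSet_itin n S)
  have h4 := Finset.sum_filter_add_sum_filter_not (words F n) (· ∈ S)
    fun w => Real.negMulLog (ν.real (h.halfCylinder w)) +
      ν.real (h.halfCylinder w) * (wordSup F φ w - n * P)
  have h5 : ∑ w ∈ words F n, (Real.negMulLog (ν.real (h.halfCylinder w)) +
      ν.real (h.halfCylinder w) * (wordSup F φ w - n * P)) =
      joinEntropy ν (map F) h.digit n + ∑ w ∈ words F n,
        ν.real (h.halfCylinder w) * wordSup F φ w - n * P := by
    rw [h.joinEntropy_eq_sum, Finset.sum_add_distrib]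
    simp only [mul_sub, Finset.sum_sub_distrib]
    rw [← Finset.sum_mul, h.sum_real_halfCylinder_eq_one]
    ring
  have h6 := h.le_sum_wordSup hφ hν n
  rw [h3] at h2
  have h7 : ∑ w ∈ words F n with ¬ w ∈ S, (Real.negMulLog (ν.real (h.halfCylinder w)) +
      ν.real (h.halfCylinder w) * (wordSup F φ w - n * P)) ≤
      1 + (1 - ν.real {x | h.itin n x ∈ S}) * Real.log D' := by
    convert h2 using 2
    ext; simp
  linarith

variable {P : ℝ}
  (hP : Tendsto (fun n : ℕ => Real.log (weightSum (wordSup F φ) (language F) n) / n) atTop (𝓝 P))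

include hP

/-- Measures of maximal pressure rarely see the high vertices of the graph. -/
theorem exists_real_high_le : ∃ C > 0, ∀ ν : Measure Phase, IsProbabilityMeasure ν →
    MeasurePreserving (map F) ν ν →
    (∀ n : ℕ, n * P ≤ joinEntropy ν (map F) h.digit n + n * ∫ x : Phase, φ x ∂ν) →
    ∀ n M : ℕ, M * ν.real {x | h.itin n x ∈ highWords h.maxWord M} ≤ C := by
  obtain ⟨ε, hε, C, hC, hhigh⟩ := h.exists_weightSum_high_le (hφ.isAlmostAdditive h) hP
  refine ⟨(2 + |Real.log C|) / ε, by positivity, fun ν _ hν hle n M => ?_⟩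
  have hlang : weightSum (wordSup F φ) (language F) n ≤ C * Real.exp (n * P) := by
    rw [h.language_eq_highWords]; simpa using hhigh 0 n
  -- The two logarithms combine to `log C - εM` times the mass of the high words.
  have h1 := h.two_class_le hφ hν (hle n) (highWords h.maxWord M)
    (D := C * Real.exp (-(ε * M))) (D' := C)
    ((weightSum_mono _ Set.inter_subset_left n).trans ((hhigh M n).trans (le_of_eq (by ring)))) hlang
  rw [Real.log_mul hC.ne' (Real.exp_pos _).ne', Real.log_exp] at h1
  rw [le_div_iff₀ hε]
  have := le_abs_self (Real.log C)
  linarith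

omit hP

/-- One fixed number of zeros leads from every vertex up to `M` back to the base, at bounded cost,
and the lengthened word has a smaller cylinder. -/
theorem exists_lower_vertex {μ : Measure Phase} [IsProbabilityMeasure μ]
    (hμ : IsGibbs h (wordSup F φ) P μ) (M : ℕ) : ∃ κ > 0, ∀ w, ∀ j ≤ M,
    GraphPath h.maxWord 0 w j →
      κ * Real.exp (wordSup F φ w - w.length * P) ≤ μ.real (h.halfCylinder w) := by
  obtain ⟨N, hN⟩ := h.exists_uniform_path_zeros M
  obtain ⟨c, hc, hlow⟩ := hμ.lower
  have hΦ := hφ.isAlmostAdditive h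
  refine ⟨c * Real.exp (-(B * N) - 2 * V - N * P), by positivity, fun w j hj hp => ?_⟩
  have hp' := hp.append (hN j hj)
  have hL := h.mem_language_of_path hp'
  have h1 := hlow _ hp'
  have h2 := hΦ.le_append _ _ hL
  have h3 := (abs_le.1 (hΦ.abs_le _ (h.right_mem_language hL))).1
  rw [List.length_replicate] at h3
  have h4 : μ.real (h.halfCylinder (w ++ List.replicate N h.zero')) ≤ μ.real (h.halfCylinder w) :=
    measureReal_mono fun x hx => (h.halfCylinder_append_subset _ _ hx).1
  refine le_trans ?_ (h1.trans h4)
  rw [mul_assoc, ← Real.exp_add]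
  refine mul_le_mul_of_nonneg_left (Real.exp_le_exp.2 ?_) hc.le
  rw [List.length_append, List.length_replicate]
  push_cast
  linarith

/-- Glue the two words by a fixed block of zeros through the base; the lower bound for the glued
word is compared with the product of the upper bounds. -/
theorem exists_mixing {μ : Measure Phase} [IsProbabilityMeasure μ]
    (hμ : IsGibbs h (wordSup F φ) P μ) (M : ℕ) : ∃ N : ℕ, ∃ κ > 0, ∀ w w', ∀ j ≤ M, ∀ j' ≤ M,
    GraphPath h.maxWord 0 w j → GraphPath h.maxWord 0 w' j' →
      κ * (μ.real (h.halfCylinder w) * μ.real (h.halfCylinder w')) ≤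
        μ.real (h.halfCylinder w ∩ (map F)^[w.length + N] ⁻¹' h.halfCylinder w') := by
  obtain ⟨N, hN⟩ := h.exists_uniform_path_zeros M
  obtain ⟨κ, hκ, hlow⟩ := h.exists_lower_vertex hφ hμ M
  obtain ⟨K, hK, hup⟩ := hμ.upper
  have hΦ := hφ.isAlmostAdditive h
  refine ⟨N, κ * Real.exp (-(B * N) - 4 * V - N * P) / (K * K), by positivity,
    fun w w' j hj j' hj' hp hp' => ?_⟩
  have hz : GraphPath h.maxWord 0 (w ++ List.replicate N h.zero') 0 := hp.append (hN j hj)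
  have hpath := hz.append hp'
  have hL := h.mem_language_of_path hpath
  have h1 := hlow _ j' hj' hpath
  have h2 := hΦ.le_append _ _ hL
  have h3 := hΦ.le_append _ _ (h.left_mem_language hL)
  have h4 := (abs_le.1 (hΦ.abs_le _ (h.right_mem_language (h.left_mem_language hL)))).1
  rw [List.length_replicate] at h4
  have h5 : μ.real (h.halfCylinder (w ++ List.replicate N h.zero' ++ w')) ≤
      μ.real (h.halfCylinder w ∩ (map F)^[w.length + N] ⁻¹' h.halfCylinder w') := by
    refine measureReal_mono fun x hx => ?_
    have hx1 := h.halfCylinder_append_subset _ _ hx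
    have hx2 := (h.halfCylinder_append_subset _ _ hx1.1).1
    have hx3 := hx1.2
    rw [List.length_append, List.length_replicate] at hx3
    exact ⟨hx2, hx3⟩
  have h6 := hup w (h.mem_language_of_path hp)
  have h7 := hup w' (h.mem_language_of_path hp')
  have h8 := mul_le_mul h6 h7 measureReal_nonneg (by positivity)
  refine le_trans ?_ (h1.trans h5)
  calc κ * Real.exp (-(B * N) - 4 * V - N * P) / (K * K) *
        (μ.real (h.halfCylinder w) * μ.real (h.halfCylinder w'))
      ≤ κ * Real.exp (-(B * N) - 4 * V - N * P) / (K * K) *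
        (K * Real.exp (wordSup F φ w - w.length * P) *
          (K * Real.exp (wordSup F φ w' - w'.length * P))) :=
        mul_le_mul_of_nonneg_left h8 (by positivity)
    _ = κ * Real.exp (-(B * N) - 4 * V - N * P + (wordSup F φ w - w.length * P) +
          (wordSup F φ w' - w'.length * P)) := by
        rw [Real.exp_add, Real.exp_add]; field_simp
    _ ≤ _ := by
        refine mul_le_mul_of_nonneg_left (Real.exp_le_exp.2 ?_) hκ.le
        simp only [List.length_append, List.length_replicate]
        push_cast
        linarith

/-- Gibbs measures have maximal pressure. -/
theorem le_entropy_of_isGibbs {μ : Measure Phase} [IsProbabilityMeasure μ]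
    (hμ : IsGibbs h (wordSup F φ) P μ) :
    (P : EReal) ≤ entropy μ (map F) + ((∫ x : Phase, φ x ∂μ : ℝ) : EReal) := by
  obtain ⟨K, hK, hup⟩ := hμ.upper
  set I := ∫ x : Phase, φ x ∂μ with hI
  -- The Gibbs upper bound gives `-log μ(w) ≥ nP - Φ(w) - log K`, which is then averaged over `μ`.
  have hlow : ∀ n : ℕ, n * (P - I) - (Real.log K + V) ≤ joinEntropy μ (map F) h.digit n := by
    intro n
    rw [h.joinEntropy_eq_sum]
    have h1 : ∀ w ∈ words F n, μ.real (h.halfCylinder w) * (n * P - Real.log K) -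
        μ.real (h.halfCylinder w) * wordSup F φ w ≤
        Real.negMulLog (μ.real (h.halfCylinder w)) := by
      intro w hw
      rcases (measureReal_nonneg (μ := μ) (s := h.halfCylinder w)).eq_or_lt with h0 | h0
      · simp [← h0]
      · have hl : w ∈ language F := by
          by_contra hcon
          exact h0.ne' (h.real_halfCylinder_eq_zero μ hcon)
        have h2 := Real.log_le_log h0 (hup w hl)
        rw [Real.log_mul hK.ne' (Real.exp_pos _).ne', Real.log_exp, mem_words.1 hw] at h2
        have h3 := mul_le_mul_of_nonneg_left h2 h0.le
        unfold Real.negMulLog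
        linarith
    have h2 := Finset.sum_le_sum h1
    rw [Finset.sum_sub_distrib, ← Finset.sum_mul, h.sum_real_halfCylinder_eq_one] at h2
    have h3 := h.sum_wordSup_le hφ hμ.invariant n
    linarith
  have h2 : Tendsto (fun n : ℕ => ((P - I - (Real.log K + V) / n : ℝ) : EReal)) atTop
      (𝓝 ((P - I - 0 : ℝ) : EReal)) :=
    (continuous_coe_real_ereal.tendsto _).comp
      ((tendsto_const_div_atTop_nhds_zero_nat _).const_sub (P - I))
  have h3 : ((P - I - 0 : ℝ) : EReal) ≤ partitionEntropy μ (map F) h.digit := by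
    rw [← h2.limsup_eq]
    refine limsup_le_limsup ?_
    filter_upwards [eventually_gt_atTop 0] with n hn
    have hn' : (0 : ℝ) < n := by exact_mod_cast hn
    refine EReal.coe_le_coe_iff.2 ?_
    rw [sub_div' hn'.ne', div_le_div_iff_of_pos_right hn']
    linarith [hlow n]
  have h4 : partitionEntropy μ (map F) h.digit ≤ entropy μ (map F) :=
    le_iSup_of_le (numBranches F) (le_iSup_of_le h.digit (le_iSup_of_le h.measurable_digit le_rfl))
  calc (P : EReal) = ((P - I - 0 : ℝ) : EReal) + (I : EReal) := by
        rw [← EReal.coe_add]; simp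
    _ ≤ _ := add_le_add_left (h3.trans h4) _

end IsExpanding

end FTransformation

/-! ### Absolute continuity, ergodicity, support and the weak Gibbs property. -/

namespace FTransformation

open MeasureTheory Filter Topology ErgodicEntropy

namespace IsExpanding

variable {F : ℝ → ℝ} {α : ℝ} (h : IsExpanding F α) {φ : ℝ → ℝ} {V B : ℝ}
  (hφ : IsBowenPotential F φ V B) {P : ℝ}

include h hφ

-- Away from the high vertices the lower Gibbs bound converts small `μ`-measure into small weight.
open Classical in
theorem weightSum_le_of_lower {μ : Measure Phase} [IsProbabilityMeasure μ] {M : ℕ} {κ : ℝ}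
    (hκ : 0 < κ) (hlow : ∀ w, ∀ j ≤ M, GraphPath h.maxWord 0 w j →
      κ * Real.exp (wordSup F φ w - w.length * P) ≤ μ.real (h.halfCylinder w))
    (S : Set (List (Letter F))) (n : ℕ) :
    weightSum (wordSup F φ) ((S \ highWords h.maxWord M) ∩ language F) n ≤
      μ.real {x | h.itin n x ∈ S} / κ * Real.exp (n * P) := by
  obtain ⟨U, hU⟩ : ∃ U, U = (S \ highWords h.maxWord M) ∩ language F := ⟨_, rfl⟩
  have hUm : ∀ w ∈ U, (w ∈ S ∧ w ∉ highWords h.maxWord M) ∧ w ∈ language F :=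
    fun w hw => by rwa [hU] at hw
  rw [← hU]
  have h1 : weightSum (wordSup F φ) U n ≤
      ∑ w ∈ words F n with w ∈ S, μ.real (h.halfCylinder w) / κ * Real.exp (n * P) := by
    refine sum_le_sum_of_injOn id Function.injective_id.injOn (fun w hw => ?_) (fun w hw => ?_)
      fun _ _ => by positivity
    · have := Finset.mem_filter.1 hw
      exact Finset.mem_filter.2 ⟨this.1, (hUm w this.2).1.1⟩
    · have := Finset.mem_filter.1 hw
      have hw' := hUm w this.2
      obtain ⟨j, hj, hp⟩ := h.exists_lt_of_mem_highWords_compl hw'.2 hw'.1.2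
      have h2 := hlow w j hj hp
      rw [Real.exp_sub, mem_words.1 this.1] at h2
      rw [id, div_mul_eq_mul_div, le_div_iff₀ hκ]
      rw [mul_div_assoc', div_le_iff₀ (Real.exp_pos _)] at h2
      linarith
  refine h1.trans (le_of_eq ?_)
  rw [← Finset.sum_mul, ← Finset.sum_div, h.sum_real_halfCylinder]

/-- If `ν` charged a `μ`-null set, approximation by cylinders would give a class of words of tiny
weight, high vertices removed, that still carries `ν`-mass at least `δ/2`. The two-class inequality
forbids this. -/
theorem absolutelyContinuous_of_isGibbs
    (hP : Tendsto (fun n : ℕ => Real.log (weightSum (wordSup F φ) (language F) n) / n) atTop (𝓝 P))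
    {μ ν : Measure Phase} [IsProbabilityMeasure μ] [IsProbabilityMeasure ν]
    (hμ : IsGibbs h (wordSup F φ) P μ) (hν : MeasurePreserving (map F) ν ν)
    (hle : ∀ n : ℕ, n * P ≤ joinEntropy ν (map F) h.digit n + n * ∫ x : Phase, φ x ∂ν) :
    ν ≪ μ := by
  refine Measure.AbsolutelyContinuous.mk fun s hs hs0 => ?_
  by_contra hcon
  set δ := ν.real s with hδ
  have hδ0 : 0 < δ := ENNReal.toReal_pos hcon (measure_ne_top _ _)
  obtain ⟨C, hC, htail⟩ := h.exists_real_high_le hφ hP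
  obtain ⟨C', hC', hlang⟩ := h.exists_weightSum_language_le (hφ.isAlmostAdditive h) hP
  obtain ⟨M, hM⟩ := exists_nat_gt (4 * C / δ)
  have hM0 : (0 : ℝ) < M := lt_trans (by positivity) hM
  obtain ⟨κ, hκ, hlow⟩ := h.exists_lower_vertex hφ hμ M
  set L := 2 + |Real.log C'| with hL
  have hL0 : 0 < L := by positivity
  -- With `log D = -(2L/δ + 1)`, a class of mass at least `δ/2` contributes at most `-(L + δ/2)`,
  -- which the remaining terms, bounded by `L`, cannot offset.
  set η := min (δ / 4) (κ * Real.exp (-(2 * L / δ + 1))) with hη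
  have hη0 : 0 < η := lt_min (by positivity) (by positivity)
  obtain ⟨n, S, hS⟩ := h.exists_itin_approx (μ + ν) hs hη0
  rw [measureReal_add_apply] at hS
  have n1 := measureReal_nonneg (μ := μ) (s := symmDiff s {x | h.itin n x ∈ S})
  have n2 := measureReal_nonneg (μ := ν) (s := symmDiff s {x | h.itin n x ∈ S})
  have hμS : μ.real {x | h.itin n x ∈ S} ≤ η := by
    have : μ.real {x | h.itin n x ∈ S} ≤ μ.real s +
        μ.real (symmDiff s {x | h.itin n x ∈ S}) := by
      refine (measureReal_mono fun x hx => ?_).trans (measureReal_union_le _ _)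
      by_cases hxs : x ∈ s
      · exact Or.inl hxs
      · exact Or.inr (Or.inr ⟨hx, hxs⟩)
    rw [show μ.real s = 0 by simp [measureReal_def, hs0]] at this
    linarith
  have hhigh : ν.real {x | h.itin n x ∈ highWords h.maxWord M} ≤ δ / 4 := by
    have h1 := htail ν inferInstance hν hle n M
    rw [div_lt_iff₀ hδ0] at hM
    nlinarith
  have hνS : δ / 2 ≤ ν.real {x | h.itin n x ∈ S \ highWords h.maxWord M} := by
    have : ν.real s ≤ ν.real (symmDiff s {x | h.itin n x ∈ S}) +
        (ν.real {x | h.itin n x ∈ highWords h.maxWord M} +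
          ν.real {x | h.itin n x ∈ S \ highWords h.maxWord M}) := by
      refine (measureReal_mono fun x hx => ?_).trans ((measureReal_union_le _ _).trans
        (add_le_add_right (measureReal_union_le _ _) _))
      by_cases hxS : h.itin n x ∈ S
      · by_cases hxM : h.itin n x ∈ highWords h.maxWord M
        · exact Or.inr (Or.inl hxM)
        · exact Or.inr (Or.inr ⟨hxS, hxM⟩)
      · exact Or.inl (Or.inl ⟨hx, hxS⟩)
    have := min_le_left (δ / 4) (κ * Real.exp (-(2 * L / δ + 1)))
    linarith
  have hw := h.weightSum_le_of_lower hφ hκ hlow S n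
  have hw' : weightSum (wordSup F φ) ((S \ highWords h.maxWord M) ∩ language F) n ≤
      Real.exp (-(2 * L / δ + 1)) * Real.exp (n * P) := by
    refine hw.trans (mul_le_mul_of_nonneg_right ?_ (Real.exp_pos _).le)
    rw [div_le_iff₀ hκ, mul_comm]
    exact hμS.trans (min_le_right _ _)
  have h1 := h.two_class_le hφ hν (hle n) _ hw' (hlang n)
  rw [Real.log_exp] at h1
  set p := ν.real {x | h.itin n x ∈ S \ highWords h.maxWord M} with hp
  have hp1 : p ≤ 1 := measureReal_le_one
  have h2 : (1 - p) * Real.log C' ≤ |Real.log C'| := by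
    have := le_abs_self (Real.log C')
    have := abs_nonneg (Real.log C')
    nlinarith
  have h3 : δ / 2 * (2 * L / δ + 1) ≤ p * (2 * L / δ + 1) :=
    mul_le_mul_of_nonneg_right hνS (by positivity)
  have h4 : δ / 2 * (2 * L / δ + 1) = L + δ / 2 := by field_simp
  linarith

/-- Approximate an invariant set and its complement by cylinders avoiding high vertices. Mixing
makes a fixed proportion of points pass from one to the other, but by invariance such points lie in
the approximation error or in its preimage. -/
theorem ergodic_of_isGibbs
    (hP : Tendsto (fun n : ℕ => Real.log (weightSum (wordSup F φ) (language F) n) / n) atTop (𝓝 P))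
    {μ : Measure Phase} [IsProbabilityMeasure μ] (hμ : IsGibbs h (wordSup F φ) P μ) :
    Ergodic (map F) μ := by
  classical
  refine ⟨hμ.invariant, ⟨fun A hA hinv => ?_⟩⟩
  by_contra hcon
  obtain ⟨hA0, hA1⟩ : μ A ≠ 0 ∧ μ Aᶜ ≠ 0 := by
    simpa [eventuallyConst_set, ae_iff, and_comm] using! hcon
  set a := μ.real A with ha
  set a' := μ.real Aᶜ with ha'
  have ha0 : 0 < a := ENNReal.toReal_pos hA0 (measure_ne_top _ _)
  have ha0' : 0 < a' := ENNReal.toReal_pos hA1 (measure_ne_top _ _)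
  set δ := min a a' with hδ
  have hδ0 : 0 < δ := lt_min ha0 ha0'
  obtain ⟨C, hC, htail⟩ := h.exists_real_high_le hφ hP
  obtain ⟨M, hM⟩ := exists_nat_gt (4 * C / δ)
  have hM0 : (0 : ℝ) < M := lt_trans (by positivity) hM
  obtain ⟨N, κ, hκ, hmix⟩ := h.exists_mixing hφ hμ M
  have hle := h.le_joinEntropy_of_le hφ hμ.invariant (h.le_entropy_of_isGibbs hφ hμ)
  set η := min (δ / 4) (κ * (δ / 2 * (δ / 2)) / 4) with hη
  have hη0 : 0 < η := lt_min (by positivity) (by positivity)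
  obtain ⟨n, S, hS⟩ := h.exists_itin_approx μ hA hη0
  have hhigh : μ.real {x | h.itin n x ∈ highWords h.maxWord M} ≤ δ / 4 := by
    have h1 := htail μ inferInstance hμ.invariant hle n M
    rw [div_lt_iff₀ hδ0] at hM
    nlinarith
  have hηδ : η ≤ δ / 4 := min_le_left _ _
  have low : ∀ (D : Set Phase) (T : Set (List (Letter F))),
      μ.real (symmDiff D {x | h.itin n x ∈ T}) < η → δ ≤ μ.real D →
      δ / 2 ≤ μ.real {x | h.itin n x ∈ T \ highWords h.maxWord M} := by
    intro D T hT hD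
    have : μ.real D ≤ μ.real (symmDiff D {x | h.itin n x ∈ T}) +
        (μ.real {x | h.itin n x ∈ highWords h.maxWord M} +
          μ.real {x | h.itin n x ∈ T \ highWords h.maxWord M}) := by
      refine (measureReal_mono fun x hx => ?_).trans ((measureReal_union_le _ _).trans
        (add_le_add_right (measureReal_union_le _ _) _))
      by_cases hxS : h.itin n x ∈ T
      · by_cases hxM : h.itin n x ∈ highWords h.maxWord M
        · exact Or.inr (Or.inl hxM)
        · exact Or.inr (Or.inr ⟨hxS, hxM⟩)
      · exact Or.inl (Or.inl ⟨hx, hxS⟩)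
    linarith
  have hS1 := low A S hS (min_le_left _ _)
  have hS2 := low Aᶜ Sᶜ (by
    have : symmDiff Aᶜ {x | h.itin n x ∈ Sᶜ} = symmDiff A {x | h.itin n x ∈ S} :=
      compl_symmDiff_compl _ _
    rwa [this]) (min_le_right _ _)
  obtain ⟨U, hU⟩ : ∃ U, U = Sᶜ \ highWords h.maxWord M := ⟨_, rfl⟩
  obtain ⟨W, hW⟩ : ∃ W, W = S \ highWords h.maxWord M := ⟨_, rfl⟩
  rw [← hU] at hS2
  rw [← hW] at hS1
  have hUm : ∀ w ∈ U, w ∉ S ∧ w ∉ highWords h.maxWord M := fun w hw => by rwa [hU] at hw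
  have hWm : ∀ w ∈ W, w ∈ S ∧ w ∉ highWords h.maxWord M := fun w hw => by rwa [hW] at hw
  have hsum : κ * (μ.real {x | h.itin n x ∈ U} * μ.real {x | h.itin n x ∈ W}) ≤
      μ.real ({x | h.itin n x ∈ U} ∩ (map F)^[n + N] ⁻¹' {x | h.itin n x ∈ W}) := by
    rw [← h.sum_real_halfCylinder, ← h.sum_real_halfCylinder, Finset.sum_mul_sum,
      ← Finset.sum_product', Finset.mul_sum]
    have hterm : ∀ t ∈ ((words F n).filter (· ∈ U)) ×ˢ ((words F n).filter (· ∈ W)),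
        κ * (μ.real (h.halfCylinder t.1) * μ.real (h.halfCylinder t.2)) ≤
        μ.real ((fun x => (h.itin n x, h.itin n ((map F)^[n + N] x))) ⁻¹' {t}) := by
      rintro ⟨u, v⟩ ht
      simp only [Finset.mem_product, Finset.mem_filter, mem_words] at ht
      have hset : (fun x => (h.itin n x, h.itin n ((map F)^[n + N] x))) ⁻¹' {(u, v)} =
          h.halfCylinder u ∩ (map F)^[u.length + N] ⁻¹' h.halfCylinder v := by
        rw [h.halfCylinder_eq_preimage ht.1.1, h.halfCylinder_eq_preimage ht.2.1, ht.1.1]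
        ext x; simp
      rw [hset]
      by_cases hu : u ∈ language F
      · by_cases hv : v ∈ language F
        · obtain ⟨j, hj, hp⟩ := h.exists_lt_of_mem_highWords_compl hu (hUm u ht.1.2).2
          obtain ⟨j', hj', hp'⟩ := h.exists_lt_of_mem_highWords_compl hv (hWm v ht.2.2).2
          exact hmix u v j hj j' hj' hp hp'
        · simp [h.real_halfCylinder_eq_zero μ hv]
      · simp [h.real_halfCylinder_eq_zero μ hu]
    refine (Finset.sum_le_sum hterm).trans (le_of_eq ?_)
    rw [sum_measureReal_preimage_singleton]
    · congr 1
      ext x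
      simp
    · rintro ⟨u, v⟩ -
      have : (fun x => (h.itin n x, h.itin n ((map F)^[n + N] x))) ⁻¹' {(u, v)} =
          {x | h.itin n x ∈ ({u} : Set _)} ∩
            (map F)^[n + N] ⁻¹' {x | h.itin n x ∈ ({v} : Set _)} := by
        ext x; simp
      rw [this]
      exact (h.measurableSet_itin n _).inter
        ((h.measurable_map.iterate _) (h.measurableSet_itin n _))
  have hup : μ.real ({x | h.itin n x ∈ U} ∩ (map F)^[n + N] ⁻¹' {x | h.itin n x ∈ W}) ≤
      2 * η := by
    have hit : ∀ k, (map F)^[k] ⁻¹' A = A := fun k => by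
      induction k with
      | zero => rfl
      | succ k ih => rw [Function.iterate_succ, Set.preimage_comp, ih, hinv]
    have hpre : μ.real ((map F)^[n + N] ⁻¹' symmDiff A {x | h.itin n x ∈ S}) < η := by
      rw [measureReal_def, (hμ.invariant.iterate (n + N)).measure_preimage
        (hA.symmDiff (h.measurableSet_itin n S)).nullMeasurableSet]
      exact hS
    have : μ.real ({x | h.itin n x ∈ U} ∩ (map F)^[n + N] ⁻¹' {x | h.itin n x ∈ W}) ≤
        μ.real (symmDiff A {x | h.itin n x ∈ S}) +
        μ.real ((map F)^[n + N] ⁻¹' symmDiff A {x | h.itin n x ∈ S}) := by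
      refine (measureReal_mono fun x hx => ?_).trans (measureReal_union_le _ _)
      by_cases hxA : x ∈ A
      · exact Or.inl (Or.inl ⟨hxA, (hUm _ hx.1).1⟩)
      · refine Or.inr (Or.inr ⟨(hWm _ hx.2).1, fun hxA' => hxA ?_⟩)
        rw [← hit (n + N)]; exact hxA'
    linarith
  have h1 : κ * (δ / 2 * (δ / 2)) ≤
      κ * (μ.real {x | h.itin n x ∈ U} * μ.real {x | h.itin n x ∈ W}) := by
    gcongr
  have h2 : η ≤ κ * (δ / 2 * (δ / 2)) / 4 := min_le_right _ _
  have h3 : 0 < κ * (δ / 2 * (δ / 2)) := by positivity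
  linarith

theorem support_eq_univ_of_isGibbs {μ : Measure Phase} [IsProbabilityMeasure μ]
    (hμ : IsGibbs h (wordSup F φ) P μ) : μ.support = Set.univ := by
  refine Set.eq_univ_of_forall fun x => ?_
  rw [Measure.mem_support_iff_forall]
  intro U hU
  obtain ⟨n, hn⟩ := h.exists_halfCylinder_subset hU
  obtain ⟨j, hj, -⟩ := h.exists_path_zero n x
  obtain ⟨κ, hκ, hlow⟩ := h.exists_lower_vertex hφ hμ j
  have h1 : 0 < μ.real (h.halfCylinder (h.itin n x)) :=
    (mul_pos hκ (Real.exp_pos _)).trans_le (hlow _ j le_rfl hj)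
  exact (ENNReal.toReal_pos_iff.1 h1).1.trans_le (measure_mono hn)

/-- Closed and half-open cylinders differ by a null set of preimages of `0`, and a word `uv` of
`𝒢(M)` ends at the vertex `|v| ≤ M`. -/
theorem weakGibbs_of_isGibbs {μ : ProbabilityMeasure Phase}
    (hμ : IsGibbs h (wordSup F φ) P (μ : Measure Phase)) : WeakGibbs F φ P μ := by
  have hcyl : ∀ w, (μ : Measure Phase).real (cylinder F w) =
      (μ : Measure Phase).real (h.halfCylinder w) := by
    intro w
    refine le_antisymm ?_ (measureReal_mono (h.halfCylinder_subset_cylinder w))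
    have h1 : (μ : Measure Phase).real (cylinder F w) ≤
        (μ : Measure Phase).real (h.halfCylinder w) +
          (μ : Measure Phase).real {x | ∃ k, (((map F)^[k] x : Phase) : ℝ) = 0} := by
      refine (measureReal_mono fun x hx => ?_).trans (measureReal_union_le _ _)
      by_cases h0 : ∃ k, (((map F)^[k] x : Phase) : ℝ) = 0
      · exact Or.inr h0
      · exact Or.inl (h.mem_halfCylinder_of_mem_cylinder hx (not_exists.1 h0))
    rwa [measureReal_def (s := {x | ∃ k, (((map F)^[k] x : Phase) : ℝ) = 0}), hμ.null,
      ENNReal.toReal_zero, add_zero] at h1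
  obtain ⟨K, hK, hup⟩ := hμ.upper
  refine ⟨h.maxWord, h.isLexMax_maxWord, K, hK, fun M => ?_⟩
  obtain ⟨κ, hκ, hlow⟩ := h.exists_lower_vertex hφ hμ M
  refine ⟨κ, hκ, fun w hw => ?_⟩
  obtain ⟨hwl, u, hu, v, hv, hvM, rfl⟩ := hw
  have hv' : v = initWord h.maxWord v.length := hv
  have hp : GraphPath h.maxWord 0 (u ++ v) v.length :=
    GraphPath.append hu (by
      have := h.path_initWord v.length
      rwa [← hv'] at this)
  have e : ∀ w : List (Letter F), -(w.length : ℝ) * P + wordSup F φ w =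
      wordSup F φ w - w.length * P := fun w => by ring
  rw [hcyl, e, le_div_iff₀ (Real.exp_pos _), div_le_iff₀ (Real.exp_pos _)]
  exact ⟨hlow _ _ hvM hp, hup _ hwl⟩

end IsExpanding

end FTransformation

/-! ### Weighted sums over periodic points. -/

namespace FTransformation

open MeasureTheory Filter Topology ErgodicEntropy

namespace IsExpanding

variable {F : ℝ → ℝ} {α : ℝ} (h : IsExpanding F α)

include h

open Classical in
theorem weightedPeriodicSum_apply (φ : ℝ → ℝ) {n : ℕ} (hn : n ≠ 0) {A : Set Phase}
    (hA : MeasurableSet A) : weightedPeriodicSum F φ n A =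
      ENNReal.ofReal (∑ x ∈ (h.finite_periodicPoints hn).toFinset with x ∈ A,
        Real.exp (birkhoff F φ n x)) := by
  have : Fintype (periodicPoints F n) := (h.finite_periodicPoints hn).fintype
  rw [weightedPeriodicSum, Measure.sum_apply _ hA, tsum_fintype,
    ENNReal.ofReal_sum_of_nonneg fun _ _ => (Real.exp_pos _).le, Finset.sum_filter,
    Finset.sum_subtype (p := (· ∈ periodicPoints F n)) _ fun x =>
      (h.finite_periodicPoints hn).mem_toFinset]
  refine Finset.sum_congr rfl fun x _ => ?_
  by_cases hx : (x : Phase) ∈ A <;>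
    simp [Measure.dirac_apply' _ hA, hx]

theorem isFiniteMeasure_weightedPeriodicSum (φ : ℝ → ℝ) {n : ℕ} (hn : n ≠ 0) :
    IsFiniteMeasure (weightedPeriodicSum F φ n) :=
  ⟨by rw [h.weightedPeriodicSum_apply φ hn .univ]; exact ENNReal.ofReal_lt_top⟩

open Classical in
theorem real_weightedPeriodicSum (φ : ℝ → ℝ) {n : ℕ} (hn : n ≠ 0) {A : Set Phase}
    (hA : MeasurableSet A) : (weightedPeriodicSum F φ n).real A =
      ∑ x ∈ (h.finite_periodicPoints hn).toFinset with x ∈ A, Real.exp (birkhoff F φ n x) := by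
  rw [measureReal_def, h.weightedPeriodicSum_apply φ hn hA,
    ENNReal.toReal_ofReal (Finset.sum_nonneg fun _ _ => (Real.exp_pos _).le)]

/-- The map permutes the points of period `n`, and `S_n φ` is constant along their orbits. -/
theorem weightedPeriodicSum_preimage (φ : ℝ → ℝ) {n : ℕ} (hn : n ≠ 0) {A : Set Phase}
    (hA : MeasurableSet A) :
    weightedPeriodicSum F φ n (map F ⁻¹' A) = weightedPeriodicSum F φ n A := by
  classical
  rw [h.weightedPeriodicSum_apply φ hn hA, h.weightedPeriodicSum_apply φ hn (h.measurable_map hA)]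
  congr 1
  have hper : ∀ x : Phase, x ∈ periodicPoints F n → map F x ∈ periodicPoints F n := fun x hx => by
    have hx' : (map F)^[n] x = x := hx
    change (map F)^[n] (map F x) = map F x
    rw [← Function.iterate_succ_apply, Function.iterate_succ_apply', hx']
  refine Finset.sum_nbij (map F) (fun x hx => ?_) (fun x hx y hy e => ?_) (fun y hy => ?_)
    fun x hx => ?_
  · simp only [Finset.mem_filter, Set.Finite.mem_toFinset] at hx ⊢
    exact ⟨hper x hx.1, hx.2⟩
  · simp only [Finset.coe_filter, Set.Finite.mem_toFinset] at hx hy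
    have hx' : (map F)^[n] x = x := hx.1
    have hy' : (map F)^[n] y = y := hy.1
    obtain ⟨k, rfl⟩ := Nat.exists_eq_succ_of_ne_zero hn
    rw [← hx', ← hy', Function.iterate_succ_apply, Function.iterate_succ_apply, e]
  · simp only [Finset.coe_filter, Set.Finite.mem_toFinset] at hy
    have hy' : (map F)^[n] y = y := hy.1
    obtain ⟨k, rfl⟩ := Nat.exists_eq_succ_of_ne_zero hn
    have e : map F ((map F)^[k] y) = y := by rw [← Function.iterate_succ_apply' (map F), hy']
    refine ⟨(map F)^[k] y, ?_, e⟩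
    simp only [Finset.coe_filter, Set.Finite.mem_toFinset]
    refine ⟨?_, by change map F _ ∈ A; rw [e]; exact hy.2⟩
    change (map F)^[k + 1] ((map F)^[k] y) = (map F)^[k] y
    rw [← Function.iterate_add_apply, add_comm, Function.iterate_add_apply, hy']
  · simp only [Finset.mem_filter, Set.Finite.mem_toFinset] at hx
    have hx' : (map F)^[n] x = x := hx.1
    have h1 := birkhoff_add F φ n 1 x
    rw [add_comm, birkhoff_add, hx'] at h1
    simp only [Function.iterate_one] at h1
    congr 1
    linarith

variable {φ : ℝ → ℝ} {V B : ℝ} (hφ : IsBowenPotential F φ V B) {P : ℝ}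

include hφ

/-- A periodic point in the cylinder of `w` is determined by its remaining `n - |w|` digits. -/
theorem real_weightedPeriodicSum_le {n : ℕ} (hn : n ≠ 0) {w : List (Letter F)}
    (hw : w.length ≤ n) : (weightedPeriodicSum F φ n).real (h.halfCylinder w) ≤
      Real.exp (wordSup F φ w) * weightSum (wordSup F φ) (language F) (n - w.length) := by
  classical
  rw [h.real_weightedPeriodicSum φ hn (h.measurableSet_halfCylinder w), weightSum, Finset.mul_sum]
  obtain ⟨l, rfl⟩ := Nat.exists_eq_add_of_le hw
  rw [Nat.add_sub_cancel_left]
  refine sum_le_sum_of_injOn (fun x => h.itin l ((map F)^[w.length] x)) (fun x hx y hy e => ?_)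
    (fun x _ => ?_) (fun x hx => ?_) fun _ _ => by positivity
  · simp only [Finset.coe_filter, Set.Finite.mem_toFinset] at hx hy
    refine h.eq_of_mem_periodicPoints hn hx.1 hy.1 ?_
    have hxw : h.itin w.length x = w := hx.2
    have hyw : h.itin w.length y = w := hy.2
    rw [itin_add, itin_add, hxw, hyw]
    exact congrArg _ e
  · simp [h.itin_mem_language]
  · simp only [Finset.mem_filter] at hx
    rw [← Real.exp_add, birkhoff_add]
    refine Real.exp_le_exp.2 (add_le_add
      (hφ.birkhoff_le_wordSup (h.halfCylinder_subset_cylinder w hx.2)) ?_)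
    have := hφ.birkhoff_le_wordSup (w := h.itin l ((map F)^[w.length] x))
      (x := (map F)^[w.length] x)
      (h.halfCylinder_subset_cylinder _ (by simp [halfCylinder]))
    rwa [length_itin] at this

/-- Each closed continuation of `w` carries a periodic point. Passing from supremum to orbit sum
costs `V`, and concatenation costs `2V`. -/
theorem le_real_weightedPeriodicSum {n : ℕ} (hn : n ≠ 0) {w : List (Letter F)}
    (hw : w.length ≤ n) (hp : GraphPath h.maxWord 0 w 0) :
    Real.exp (wordSup F φ w - 3 * V) * weightSum (wordSup F φ) (goodCore h.maxWord) (n - w.length) ≤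
      (weightedPeriodicSum F φ n).real (h.halfCylinder w) := by
  classical
  rw [h.real_weightedPeriodicSum φ hn (h.measurableSet_halfCylinder w), weightSum, Finset.mul_sum]
  have key : ∀ u ∈ (words F (n - w.length)).filter (· ∈ goodCore h.maxWord),
      ∃ x : Phase, h.itin n x = w ++ u ∧ (map F)^[n] x = x := by
    intro u hu
    simp only [Finset.mem_filter, mem_words] at hu
    have hl : (w ++ u).length = n := by rw [List.length_append]; omega
    have := h.isFixedPt_of_path (w := w ++ u) (fun e => hn (by rw [← hl, e]; rfl)) (hp.append hu.2)
    rwa [hl] at this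
  choose! e he he' using key
  refine sum_le_sum_of_injOn e (fun u hu v hv huv => ?_) (fun u hu => ?_) (fun u hu => ?_)
    fun _ _ => by positivity
  · have h1 := he u hu
    rw [huv, he v hv] at h1
    exact (List.append_cancel_left h1).symm
  · simp only [Finset.mem_filter, Set.Finite.mem_toFinset]
    refine ⟨he' u hu, ?_⟩
    have h1 := he u hu
    simp only [Finset.mem_filter, mem_words] at hu
    have hl : (w ++ u).length = n := by rw [List.length_append]; omega
    rw [← hl] at h1
    exact (h.itin_append_iff.1 h1).1
  · have h1 := he u hu
    simp only [Finset.mem_filter, mem_words] at hu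
    have hl : (w ++ u).length = n := by rw [List.length_append]; omega
    have hlang : w ++ u ∈ language F := h.mem_language_of_path (hp.append hu.2)
    rw [← hl] at h1
    have h2 := hφ.wordSup_le_birkhoff_add hlang (h.halfCylinder_subset_cylinder _ h1)
    have h3 := (hφ.isAlmostAdditive h).le_append w u hlang
    rw [hl] at h2
    rw [← Real.exp_add]
    exact Real.exp_le_exp.2 (by linarith)

end IsExpanding

end FTransformation

/-! ### Periodic orbit measures and their cluster points. -/

namespace FTransformation

open MeasureTheory Filter Topology ErgodicEntropy

theorem real_periodicMeasure (F φ : ℝ → ℝ) (n : ℕ) (A : Set Phase) :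
    (periodicMeasure F φ n).real A =
      (weightedPeriodicSum F φ n).real A / (weightedPeriodicSum F φ n).real Set.univ := by
  rw [periodicMeasure, measureReal_ennreal_smul_apply, ENNReal.toReal_inv, div_eq_inv_mul,
    measureReal_def (s := Set.univ)]

namespace IsExpanding

variable {F : ℝ → ℝ} {α : ℝ} (h : IsExpanding F α)

include h

theorem exists_fixedPt : ∃ x : Phase, map F x = x := by
  obtain ⟨x, -, hx⟩ := h.isFixedPt_of_path (w := [h.zero']) (by simp)
    (.drop h.zero'_lt_maxWord_zero (.nil 0))
  exact ⟨x, hx⟩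

theorem isProbabilityMeasure_periodicMeasure (φ : ℝ → ℝ) {n : ℕ} (hn : n ≠ 0) :
    IsProbabilityMeasure (periodicMeasure F φ n) := by
  classical
  have := h.isFiniteMeasure_weightedPeriodicSum φ hn
  refine ⟨?_⟩
  rw [periodicMeasure, Measure.smul_apply, smul_eq_mul]
  refine ENNReal.inv_mul_cancel ?_ (measure_ne_top _ _)
  rw [h.weightedPeriodicSum_apply φ hn .univ]
  obtain ⟨x, hx⟩ := h.exists_fixedPt
  refine (ENNReal.ofReal_pos.2 (Finset.sum_pos (fun _ _ => Real.exp_pos _) ⟨x, ?_⟩)).ne'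
  simpa using! Function.iterate_fixed hx n

/-- The periodic orbit measures of period `n + 1`. -/
noncomputable def periodicProb (φ : ℝ → ℝ) (n : ℕ) : ProbabilityMeasure Phase :=
  ⟨periodicMeasure F φ (n + 1), h.isProbabilityMeasure_periodicMeasure φ n.succ_ne_zero⟩

theorem coe_periodicProb (φ : ℝ → ℝ) (n : ℕ) :
    (h.periodicProb φ n : Measure Phase) = periodicMeasure F φ (n + 1) := rfl

theorem periodicProb_preimage (φ : ℝ → ℝ) (n : ℕ) {A : Set Phase} (hA : MeasurableSet A) :
    (h.periodicProb φ n : Measure Phase) (map F ⁻¹' A) = (h.periodicProb φ n : Measure Phase) A := by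
  rw [coe_periodicProb, periodicMeasure, Measure.smul_apply, Measure.smul_apply,
    h.weightedPeriodicSum_preimage φ n.succ_ne_zero hA]

theorem exists_isCompact_periodicProb_compl (φ : ℝ → ℝ) (n : ℕ) :
    ∃ K : Set Phase, IsCompact K ∧ (h.periodicProb φ n : Measure Phase) Kᶜ = 0 := by
  classical
  have hfin := h.finite_periodicPoints n.succ_ne_zero
  refine ⟨_, hfin.isCompact, ?_⟩
  rw [coe_periodicProb, periodicMeasure, Measure.smul_apply,
    h.weightedPeriodicSum_apply φ n.succ_ne_zero hfin.measurableSet.compl,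
    Finset.sum_eq_zero, ENNReal.ofReal_zero, smul_zero]
  intro x hx
  simp at hx

variable {φ : ℝ → ℝ} {V B : ℝ} (hφ : IsBowenPotential F φ V B) {P : ℝ}
  (hP : Tendsto (fun n : ℕ => Real.log (weightSum (wordSup F φ) (language F) n) / n) atTop (𝓝 P))
  (hP' : ∀ n : ℕ, Real.exp (n * P) ≤ weightSum (wordSup F φ) (language F) n)

include hφ hP hP'

theorem exists_periodicProb_bounds : ∃ c > 0, ∃ K > 0, ∀ (n : ℕ) (w : List (Letter F)),
    w.length ≤ n + 1 →
      (w ∈ language F → (h.periodicProb φ n : Measure Phase).real (h.halfCylinder w) ≤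
        K * Real.exp (wordSup F φ w - w.length * P)) ∧
      (GraphPath h.maxWord 0 w 0 → c * Real.exp (wordSup F φ w - w.length * P) ≤
        (h.periodicProb φ n : Measure Phase).real (h.halfCylinder w)) := by
  have hΦ := hφ.isAlmostAdditive h
  obtain ⟨C, hC, hup⟩ := h.exists_weightSum_language_le hΦ hP
  obtain ⟨c, hc, hlow⟩ := h.exists_le_weightSum_good hΦ hP hP'
  set d := c * Real.exp (-(3 * V)) with hd
  have hd0 : 0 < d := by positivity
  have up : ∀ (n : ℕ) (w : List (Letter F)), w.length ≤ n + 1 → w ∈ language F →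
      (weightedPeriodicSum F φ (n + 1)).real (h.halfCylinder w) ≤
        C * Real.exp (wordSup F φ w - w.length * P) * Real.exp ((n + 1 : ℕ) * P) := by
    intro n w hw _
    refine (h.real_weightedPeriodicSum_le hφ n.succ_ne_zero hw).trans
      ((mul_le_mul_of_nonneg_left (hup _) (Real.exp_pos _).le).trans (le_of_eq ?_))
    rw [Nat.cast_sub hw, mul_left_comm, mul_assoc, ← Real.exp_add, ← Real.exp_add]
    congr 2
    ring
  have low : ∀ (n : ℕ) (w : List (Letter F)), w.length ≤ n + 1 → GraphPath h.maxWord 0 w 0 →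
      d * Real.exp (wordSup F φ w - w.length * P) * Real.exp ((n + 1 : ℕ) * P) ≤
      (weightedPeriodicSum F φ (n + 1)).real (h.halfCylinder w) := by
    intro n w hw hp
    refine le_trans (le_of_eq ?_) ((mul_le_mul_of_nonneg_left (hlow _) (Real.exp_pos _).le).trans
      (h.le_real_weightedPeriodicSum hφ n.succ_ne_zero hw hp))
    rw [Nat.cast_sub hw, hd, mul_left_comm, mul_assoc, mul_assoc, ← Real.exp_add, ← Real.exp_add,
      ← Real.exp_add]
    congr 2
    ring
  have hnil : h.halfCylinder [] = Set.univ := Set.eq_univ_of_forall fun _ => rfl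
  have e0 : Real.exp (wordSup F φ [] - ([] : List (Letter F)).length * P) = 1 := by
    rw [h.weight_nil hΦ]; simp
  refine ⟨d / C, by positivity, C / d, by positivity, fun n w hw => ?_⟩
  -- The empty word bounds the total mass, by which everything is normalised.
  have u0 := up n [] (Nat.zero_le _) (h.mem_language_of_path (.nil 0))
  have l0 := low n [] (Nat.zero_le _) (.nil 0)
  rw [hnil, e0, mul_one] at u0 l0
  have hE := Real.exp_pos ((n + 1 : ℕ) * P)
  have hZ : 0 < (weightedPeriodicSum F φ (n + 1)).real Set.univ :=
    (mul_pos hd0 hE).trans_le l0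
  have hX := Real.exp_pos (wordSup F φ w - w.length * P)
  rw [coe_periodicProb, real_periodicMeasure]
  refine ⟨fun hwl => ?_, fun hp => ?_⟩
  · rw [div_le_iff₀ hZ]
    refine (up n w hw hwl).trans ?_
    calc _ = C / d * Real.exp (wordSup F φ w - w.length * P) *
          (d * Real.exp ((n + 1 : ℕ) * P)) := by field_simp
      _ ≤ _ := mul_le_mul_of_nonneg_left l0 (by positivity)
  · rw [le_div_iff₀ hZ]
    refine le_trans ?_ (low n w hw hp)
    calc _ ≤ d / C * Real.exp (wordSup F φ w - w.length * P) *
          (C * Real.exp ((n + 1 : ℕ) * P)) := mul_le_mul_of_nonneg_left u0 (by positivity)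
      _ = _ := by field_simp

theorem exists_periodicProb_halfCylinder_le : ∃ K > 0, ∃ ε > 0, ∀ (n : ℕ), ∀ w ∈ language F,
    w.length ≤ n + 1 → (h.periodicProb φ n : Measure Phase).real (h.halfCylinder w) ≤
      K * Real.exp (-(ε * w.length)) := by
  obtain ⟨_, _, K, hK, hb⟩ := h.exists_periodicProb_bounds hφ hP hP'
  obtain ⟨ε, hε, C, hC, hgap⟩ := h.exists_pressure_gap (hφ.isAlmostAdditive h) hP
  refine ⟨K * Real.exp C, by positivity, ε, hε, fun n w hw hl => ?_⟩
  refine ((hb n w hl).1 hw).trans ?_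
  rw [mul_assoc, ← Real.exp_add]
  refine mul_le_mul_of_nonneg_left (Real.exp_le_exp.2 ?_) hK.le
  linarith [hgap w hw]

/-- Tightness in `[0,1)`: a left neighbourhood of `1` lies in a single `k`-cylinder, whose mass is
exponentially small in `k` for all large periods. The finitely many other measures have finite
support. -/
theorem isCompact_closure_range_periodicProb :
    IsCompact (closure (Set.range (h.periodicProb φ))) := by
  refine isCompact_closure_of_isTightMeasureSet
    (isTightMeasureSet_iff_exists_isCompact_measure_compl_le.2 fun δ hδ => ?_)
  obtain ⟨K, hK, ε, hε, hb⟩ := h.exists_periodicProb_halfCylinder_le hφ hP hP'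
  obtain ⟨k, hk⟩ : ∃ k : ℕ, ENNReal.ofReal (K * Real.exp (-(ε * k))) ≤ δ := by
    have : Tendsto (fun k : ℕ => ENNReal.ofReal (K * Real.exp (-(ε * k)))) atTop
        (𝓝 (ENNReal.ofReal (K * 0))) :=
      ENNReal.tendsto_ofReal ((Real.tendsto_exp_neg_atTop_nhds_zero.comp
        (tendsto_natCast_atTop_atTop.const_mul_atTop hε)).const_mul K)
    rw [mul_zero, ENNReal.ofReal_zero] at this
    exact (this.eventually_le_const hδ).exists
  obtain ⟨q, hq, w, hw, hwk, hqw⟩ := h.exists_left_mem_halfCylinder k (p := 1) (by simp)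
  choose L hL hL0 using h.exists_isCompact_periodicProb_compl φ
  have hI : IsCompact {x : Phase | (x : ℝ) ≤ q} := by
    rw [Subtype.isCompact_iff]
    have : Subtype.val '' {x : Phase | (x : ℝ) ≤ q} = Set.Icc 0 q := by
      ext t
      constructor
      · rintro ⟨x, hx, rfl⟩
        exact ⟨x.2.1, hx⟩
      · exact fun ht => ⟨⟨t, ht.1, ht.2.trans_lt hq⟩, ht.2, rfl⟩
    rw [this]
    exact isCompact_Icc
  refine ⟨{x : Phase | (x : ℝ) ≤ q} ∪ ⋃ n ∈ Finset.range k, L n,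
    hI.union ((Finset.range k).isCompact_biUnion fun n _ => hL n), ?_⟩
  rintro _ ⟨_, ⟨n, rfl⟩, rfl⟩
  by_cases hn : n < k
  · refine le_trans (measure_mono (t := (L n)ᶜ) fun x hx hxL => hx (Or.inr ?_))
      ((hL0 n).trans_le zero_le)
    exact Set.mem_biUnion (Finset.mem_coe.2 (Finset.mem_range.2 hn)) hxL
  · refine le_trans (measure_mono (t := h.halfCylinder w) fun x hx => ?_) (le_trans ?_ hk)
    · change h.itin w.length x = w
      rw [hwk]
      exact hqw x (not_le.1 fun hxq => hx (Or.inl hxq)) x.2.2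
    · rw [← ofReal_measureReal]
      refine ENNReal.ofReal_le_ofReal ?_
      rw [← hwk]
      exact hb n w hw (by omega)

/-- Every point has an open neighbourhood covered by two `k`-cylinders, one on each side, whose
masses decay in `k` uniformly in the period. -/
theorem measure_singleton_of_tendsto {l : Filter ℕ} [l.NeBot] (hl : l ≤ atTop)
    {μ : ProbabilityMeasure Phase} (hμ : Tendsto (h.periodicProb φ) l (𝓝 μ)) (x : Phase) :
    (μ : Measure Phase) {x} = 0 := by
  obtain ⟨K, hK, ε, hε, hb⟩ := h.exists_periodicProb_halfCylinder_le hφ hP hP'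
  have hk : ∀ k : ℕ, (μ : Measure Phase) {x} ≤ ENNReal.ofReal (2 * (K * Real.exp (-(ε * k)))) := by
    intro k
    obtain ⟨U, hU, hxU, w, hw, hwk, w', hw', hwk', hsub⟩ : ∃ U : Set Phase, IsOpen U ∧ x ∈ U ∧
        ∃ w ∈ language F, w.length = k ∧ ∃ w' ∈ language F, w'.length = k ∧
          U ⊆ h.halfCylinder w ∪ h.halfCylinder w' := by
      obtain ⟨r, hr, hxr⟩ := h.exists_right_mem_halfCylinder k x
      have hright : ∀ y : Phase, x ≤ y → (y : ℝ) < r → y ∈ h.halfCylinder (h.itin k x) :=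
        fun y h1 h2 => by
          change h.itin (h.itin k x).length y = _
          rw [length_itin]; exact hxr y h1 h2
      rcases x.2.1.eq_or_lt with h0 | h0
      · refine ⟨{y | (y : ℝ) < r}, isOpen_lt continuous_subtype_val continuous_const, hr,
          _, h.itin_mem_language k x, by simp, _, h.itin_mem_language k x, by simp, fun y hy => ?_⟩
        exact Or.inl (hright y (Subtype.coe_le_coe.1 (h0 ▸ y.2.1)) hy)
      · obtain ⟨q, hq, w, hw, hwk, hqw⟩ := h.exists_left_mem_halfCylinder k (p := x) ⟨h0, x.2.2.le⟩
        refine ⟨{y | q < y} ∩ {y | (y : ℝ) < r},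
          (isOpen_lt continuous_const continuous_subtype_val).inter
            (isOpen_lt continuous_subtype_val continuous_const), ⟨hq, hr⟩,
          _, h.itin_mem_language k x, by simp, w, hw, hwk, fun y hy => ?_⟩
        rcases le_or_gt x y with hxy | hxy
        · exact Or.inl (hright y hxy hy.2)
        · refine Or.inr ?_
          change h.itin w.length y = w
          rw [hwk]
          exact hqw y hy.1 hxy
    have hbound : ∀ᶠ n in l, (h.periodicProb φ n : Measure Phase) U ≤
        ENNReal.ofReal (2 * (K * Real.exp (-(ε * k)))) := by
      filter_upwards [hl (eventually_ge_atTop k)] with n hn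
      rw [← ofReal_measureReal]
      refine ENNReal.ofReal_le_ofReal ((measureReal_mono hsub).trans
        ((measureReal_union_le _ _).trans ?_))
      have h1 := hb n w hw (by omega)
      have h2 := hb n w' hw' (by omega)
      rw [hwk] at h1
      rw [hwk'] at h2
      linarith
    calc (μ : Measure Phase) {x} ≤ (μ : Measure Phase) U :=
          measure_mono (Set.singleton_subset_iff.2 hxU)
      _ ≤ l.liminf fun n => (h.periodicProb φ n : Measure Phase) U :=
          ProbabilityMeasure.le_liminf_measure_open_of_tendsto hμ hU
      _ ≤ _ := (liminf_le_liminf hbound).trans (liminf_const _).le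
  have : Tendsto (fun k : ℕ => ENNReal.ofReal (2 * (K * Real.exp (-(ε * k))))) atTop
      (𝓝 (ENNReal.ofReal (2 * (K * 0)))) :=
    ENNReal.tendsto_ofReal (((Real.tendsto_exp_neg_atTop_nhds_zero.comp
      (tendsto_natCast_atTop_atTop.const_mul_atTop hε)).const_mul K).const_mul 2)
  rw [mul_zero, mul_zero, ENNReal.ofReal_zero] at this
  exact le_antisymm (ge_of_tendsto' this hk) zero_le

/-- Without atoms, countable boundaries are null, so masses of cylinders converge and the uniform
Gibbs bounds pass to the limit. -/
theorem isGibbs_of_tendsto {l : Filter ℕ} [l.NeBot] (hl : l ≤ atTop)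
    {μ : ProbabilityMeasure Phase} (hμ : Tendsto (h.periodicProb φ) l (𝓝 μ)) :
    IsGibbs h (wordSup F φ) P (μ : Measure Phase) := by
  classical
  have : NullSingletonClass (μ : Measure Phase) :=
    ⟨fun x => h.measure_singleton_of_tendsto hφ hP hP' hl hμ x⟩
  have hnull := h.countable_hits_zero.measure_zero (μ : Measure Phase)
  have hlim : ∀ w, Tendsto (fun n => (h.periodicProb φ n : Measure Phase).real (h.halfCylinder w)) l
      (𝓝 ((μ : Measure Phase).real (h.halfCylinder w))) := fun w =>
    (ENNReal.tendsto_toReal (measure_ne_top _ _)).comp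
      (ProbabilityMeasure.tendsto_measure_of_null_frontier_of_tendsto' hμ
        (measure_mono_null (h.frontier_halfCylinder_subset w) hnull))
  obtain ⟨c, hc, K, hK, hb⟩ := h.exists_periodicProb_bounds hφ hP hP'
  have hev : ∀ w : List (Letter F), ∀ᶠ n in l, w.length ≤ n + 1 := fun w =>
    hl ((eventually_ge_atTop w.length).mono fun n hn => by omega)
  refine ⟨⟨h.measurable_map, ?_⟩, hnull, ⟨K, hK, fun w hw => ?_⟩, ⟨c, hc, fun w hp => ?_⟩⟩
  · have := Measure.isProbabilityMeasure_map (μ := (μ : Measure Phase)) h.measurable_map.aemeasurable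
    refine h.ext_of_halfCylinder fun w => ?_
    rw [Measure.map_apply h.measurable_map (h.measurableSet_halfCylinder w)]
    -- The map is discontinuous, so invariance is not automatic in the limit; the preimage of a
    -- cylinder is a finite union of cylinders one letter longer.
    have e : map F ⁻¹' h.halfCylinder w =
        {x | h.itin (w.length + 1) x ∈ {v : List (Letter F) | v.tail = w}} := rfl
    have h1 : Tendsto (fun n => (h.periodicProb φ n : Measure Phase).real
        (map F ⁻¹' h.halfCylinder w)) l (𝓝 ((μ : Measure Phase).real
        (map F ⁻¹' h.halfCylinder w))) := by
      simp only [e, ← h.sum_real_halfCylinder]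
      exact tendsto_finsetSum _ fun v _ => hlim v
    have h2 : (fun n => (h.periodicProb φ n : Measure Phase).real (map F ⁻¹' h.halfCylinder w)) =
        fun n => (h.periodicProb φ n : Measure Phase).real (h.halfCylinder w) := by
      funext n
      rw [measureReal_def, h.periodicProb_preimage φ n (h.measurableSet_halfCylinder w),
        measureReal_def]
    rw [h2] at h1
    exact (measureReal_eq_measureReal_iff).1 (tendsto_nhds_unique h1 (hlim w))
  · exact le_of_tendsto (hlim w) ((hev w).mono fun n hn => (hb n w hn).1 hw)
  · exact ge_of_tendsto (hlim w) ((hev w).mono fun n hn => (hb n w hn).2 hp)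

end IsExpanding

end FTransformation

/-! ### Uniqueness and convergence. -/

namespace FTransformation

open MeasureTheory Filter Topology ErgodicEntropy

namespace IsExpanding

variable {F : ℝ → ℝ} {α : ℝ} (h : IsExpanding F α) {φ : ℝ → ℝ} {V B : ℝ}
  (hφ : IsBowenPotential F φ V B) {P : ℝ}
  (hP : Tendsto (fun n : ℕ => Real.log (weightSum (wordSup F φ) (language F) n) / n) atTop (𝓝 P))

include h hφ hP

theorem isEquilibriumState_of_isGibbs {μ : ProbabilityMeasure Phase}
    (hμ : IsGibbs h (wordSup F φ) P (μ : Measure Phase)) :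
    IsEquilibriumState (map F) (fun x : Phase => φ x) μ :=
  ⟨hμ.invariant, fun _ hν =>
    (h.entropy_add_integral_le hφ hP hν).trans (h.le_entropy_of_isGibbs hφ hμ)⟩

theorem eq_of_isEquilibriumState {μ ν : ProbabilityMeasure Phase}
    (hμ : IsGibbs h (wordSup F φ) P (μ : Measure Phase))
    (hν : IsEquilibriumState (map F) (fun x : Phase => φ x) ν) : ν = μ := by
  have hle : (P : EReal) ≤ entropy (ν : Measure Phase) (map F) +
      ((∫ x : Phase, φ x ∂(ν : Measure Phase) : ℝ) : EReal) :=
    (h.le_entropy_of_isGibbs hφ hμ).trans (hν.2 μ hμ.invariant)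
  have hac := h.absolutelyContinuous_of_isGibbs hφ hP hμ hν.1 (h.le_joinEntropy_of_le hφ hν.1 hle)
  have e : (ν : Measure Phase) = μ :=
    (h.ergodic_of_isGibbs hφ hP hμ).eq_of_absolutelyContinuous hν.1 hac
  exact Subtype.ext e

theorem isPressure : IsPressure F φ P := by
  refine hP.congr fun n => ?_
  rw [partitionSum_eq_weightSum, div_eq_inv_mul, one_div]

/-- Every cluster point is Gibbs, hence an equilibrium state, hence the same measure; compactness
then gives convergence. -/
theorem exists_isGibbs_tendsto
    (hP' : ∀ n : ℕ, Real.exp (n * P) ≤ weightSum (wordSup F φ) (language F) n) :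
    ∃ μ : ProbabilityMeasure Phase, IsGibbs h (wordSup F φ) P (μ : Measure Phase) ∧
      Tendsto (h.periodicProb φ) atTop (𝓝 μ) := by
  have hK := h.isCompact_closure_range_periodicProb hφ hP hP'
  have hmem : ∀ n, h.periodicProb φ n ∈ closure (Set.range (h.periodicProb φ)) :=
    fun n => subset_closure ⟨n, rfl⟩
  have hgibbs : ∀ ν : ProbabilityMeasure Phase, MapClusterPt ν atTop (h.periodicProb φ) →
      IsGibbs h (wordSup F φ) P (ν : Measure Phase) := fun ν hν => by
    obtain ⟨U, hU, hlim⟩ := mapClusterPt_iff_ultrafilter.1 hν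
    exact h.isGibbs_of_tendsto hφ hP hP' hU hlim
  obtain ⟨μ, -, hμ⟩ := hK.exists_mapClusterPt (u := h.periodicProb φ) (f := atTop)
    (tendsto_principal.2 (Eventually.of_forall hmem))
  refine ⟨μ, hgibbs μ hμ, hK.tendsto_nhds_of_unique_mapClusterPt (Eventually.of_forall hmem)
    fun ν _ hν => ?_⟩
  exact h.eq_of_isEquilibriumState hφ hP (hgibbs μ hμ)
    (h.isEquilibriumState_of_isGibbs hφ hP (hgibbs ν hν))

end IsExpanding

end FTransformation
theorem mainTheorem9 (F : ℝ → ℝ) (α : ℝ) (hα : 1 < α)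
    (hFmono : StrictMonoOn F (Set.Icc 0 1))
    (hFsmooth : ContDiffOn ℝ 1 F (Set.Icc 0 1))
    (hFzero : F 0 = 0)
    (hFderiv : ∀ x ∈ Set.Icc (0 : ℝ) 1, α ≤ derivWithin F (Set.Icc 0 1) x)
    (φ : ℝ → ℝ)
    (hφcont : FTransformation.ContinuousPotential F φ)
    (hφbowen : FTransformation.BowenProperty F φ) :
    ∃ μ : MeasureTheory.ProbabilityMeasure FTransformation.Phase,
      ErgodicEntropy.IsEquilibriumState (FTransformation.map F)
        (fun x : FTransformation.Phase => φ x) μ ∧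
      (∀ ν : MeasureTheory.ProbabilityMeasure FTransformation.Phase,
        ErgodicEntropy.IsEquilibriumState (FTransformation.map F)
          (fun x : FTransformation.Phase => φ x) ν → ν = μ) ∧
      (μ : MeasureTheory.Measure FTransformation.Phase).support = Set.univ ∧
      (∃ P : ℝ, FTransformation.IsPressure F φ P ∧ FTransformation.WeakGibbs F φ P μ) ∧
      (∀ g : BoundedContinuousFunction FTransformation.Phase ℝ,
        Filter.Tendsto (fun n : ℕ => ∫ x, g x ∂(FTransformation.periodicMeasure F φ n))
          Filter.atTop
          (nhds (∫ x, g x ∂(μ : MeasureTheory.Measure FTransformation.Phase)))) := by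
  have h := FTransformation.isExpanding_of_derivWithin hα hFsmooth hFzero hFderiv
  obtain ⟨V, B, hφ⟩ := h.exists_isBowenPotential hφcont hφbowen
  obtain ⟨P, hP, hP'⟩ := h.exists_pressure (hφ.isAlmostAdditive h)
  obtain ⟨μ, hμ, hlim⟩ := h.exists_isGibbs_tendsto hφ hP hP'
  refine ⟨μ, h.isEquilibriumState_of_isGibbs hφ hP hμ,
    fun ν hν => h.eq_of_isEquilibriumState hφ hP hμ hν, h.support_eq_univ_of_isGibbs hφ hμ,
    ⟨P, h.isPressure hφ hP, h.weakGibbs_of_isGibbs hφ hμ⟩, fun g => ?_⟩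
  -- Periods start at `1`, because every point is fixed by `f^0`; the shift does not affect the
  -- limit.
  exact (Filter.tendsto_add_atTop_iff_nat 1).1
    (MeasureTheory.ProbabilityMeasure.tendsto_iff_forall_integral_tendsto.1 hlim g)
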